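/- Let $(X,\omega,J)$ be a Kähler manifold of complex dimension $n$, with Riemannian metric $g=\omega(\cdot,J\cdot)$ and Levi-Civita connection $\nabla$, which is Calabi–Yau in the sense that it carries a holomorphic volume form $\Omega$ of constant length one (that is, $\Omega$ is a holomorphic $(n,0)$-form with $|\Omega(e_1,\dots,e_n)|=1$ for every unitary frame $e_1,\dots,e_n$). Let $Y\subset X$ be an embedded coisotropic submanifold, i.e. $(TY)^\omega\subset TY$, of real dimension $n+k$. Notation. Let $T\mathcal F=(TY)^\omega=\ker(\omega|_Y)\subset TY$ be the tangent bundle of the null foliation $\mathcal F$, of rank $n-k$; let $NY=(TY)^\perp$, and let $H\subset TY$ be the orthogonal complement of $T\mathcal F$ in $TY$, a $J$-invariant bundle of complex rank $k$. * The transverse canonical bundle of $Y$ is $K_Y=\Lambda^{k,0}(N^*\mathcal F)$, where $N^*\mathcal F\cong H^*$ is the annihilator of $T\mathcal F\oplus NY$ in $T^*X|_Y$. The bundle $H$ carries the connection $\nabla^H_v\eta=\pi_H(\nabla_v\eta)$, with $\pi_H$ the orthogonal projection onto $H$, and $K_Y$ and $K_Y^{\otimes2}$ carry the connections induced by it. *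 The canonical transverse Maslov charge of $Y$ is the section $$\Delta_{(Y;\Omega)}=\bigl((u_{k+1}\wedge\cdots\wedge u_n)\rfloor\Omega\bigr)^{\otimes 2}\in\Gamma(K_Y^{\otimes 2}),\qquad u_\alpha=\tfrac12(e_\alpha-iJe_\alpha),$$ where $e_{k+1},\dots,e_n$ is any local orthonormal frame of $T\mathcal F$. One calls $Y$ leafwise special coisotropic if $\Delta_{(Y;\Omega)}$ is leafwise parallel, i.e. $\nabla_v\Delta_{(Y;\Omega)}=0$ for all $v\in T\mathcal F$. * Let $S(v,w)$, the component of $\nabla_vw$ normal to $Y$, be the second fundamental form of $Y\subset(X,g)$. The leafwise mean curvature vector is $\vec H^{\parallel}=\sum_{\alpha=k+1}^{n}S(e_\alpha,e_\alpha)$ and the leafwise mean curvature one-form is $\alpha_Y^{\parallel}=(\vec H^{\parallel}\rfloor\omega)|_{TY}$. One calls $Y$ leafwise minimal if $\alpha_Y^{\parallel}=0$. **Theorem 7.3.** $Y$ is leafwise special coisotropic if and only if it is leafwise minimal, i.e. $\alpha_Y^{\parallel}=0$. -/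

import Mathlib

open scoped Manifold ContDiff Bundle TensorProduct

noncomputable section

section AmbientGeometry

variable {E : Type*} [NormedAddCommGroup E] [NormedSpace ℝ E] [FiniteDimensional ℝ E]
  {X : Type*} [TopologicalSpace X] [ChartedSpace E X] [IsManifold 𝓘(ℝ, E) ∞ X]

instance tangentSpace_finiteDimensional (x : X) :
    FiniteDimensional ℝ (TangentSpace 𝓘(ℝ, E) x) :=
  inferInstanceAs (FiniteDimensional ℝ E)

variable [Bundle.RiemannianBundle (fun x : X ↦ TangentSpace 𝓘(ℝ, E) x)]

/-- A Kähler structure `(ω, J)` on `X`, whose Riemannian metric `g = ω(·, J ·)` is the one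
carried by the tangent bundle: `ω` (written `symp`) is a closed smooth 2-form and `J` is an
integrable smooth almost complex structure compatible with it. (Nondegeneracy of `ω` follows from `compatible`.) -/
structure KahlerStructure (E : Type*) [NormedAddCommGroup E] [NormedSpace ℝ E]
    [FiniteDimensional ℝ E] (X : Type*) [TopologicalSpace X] [ChartedSpace E X]
    [IsManifold 𝓘(ℝ, E) ∞ X] [Bundle.RiemannianBundle (fun x : X ↦ TangentSpace 𝓘(ℝ, E) x)] where
  /-- the symplectic form -/
  symp : Π x : X, TangentSpace 𝓘(ℝ, E) x →L[ℝ] TangentSpace 𝓘(ℝ, E) x →L[ℝ] ℝ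
  /-- the complex structure -/
  J : Π x : X, TangentSpace 𝓘(ℝ, E) x →L[ℝ] TangentSpace 𝓘(ℝ, E) x
  contMDiff_symp : ContMDiff 𝓘(ℝ, E) (𝓘(ℝ, E).prod 𝓘(ℝ, E →L[ℝ] E →L[ℝ] ℝ)) ∞
    (fun x ↦ Bundle.TotalSpace.mk' (E →L[ℝ] E →L[ℝ] ℝ)
      (E := fun x : X ↦ TangentSpace 𝓘(ℝ, E) x →L[ℝ] TangentSpace 𝓘(ℝ, E) x →L[ℝ] ℝ) x (symp x))
  contMDiff_J : ContMDiff 𝓘(ℝ, E) (𝓘(ℝ, E).prod 𝓘(ℝ, E →L[ℝ] E)) ∞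
    (fun x ↦ Bundle.TotalSpace.mk' (E →L[ℝ] E)
      (E := fun x : X ↦ TangentSpace 𝓘(ℝ, E) x →L[ℝ] TangentSpace 𝓘(ℝ, E) x) x (J x))
  symp_swap : ∀ (x : X) (v w : TangentSpace 𝓘(ℝ, E) x), symp x w v = -symp x v w
  J_J : ∀ (x : X) (v : TangentSpace 𝓘(ℝ, E) x), J x (J x v) = -v
  compatible : ∀ (x : X) (v w : TangentSpace 𝓘(ℝ, E) x), inner ℝ v w = symp x v (J x w)
  /-- `dω = 0`, by the invariant formula for the exterior derivative -/
  closed : ∀ (x : X) (U V W : Π x : X, TangentSpace 𝓘(ℝ, E) x),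
    MDiffAt (T% U) x → MDiffAt (T% V) x → MDiffAt (T% W) x →
    mvfderiv 𝓘(ℝ, E) (fun p ↦ symp p (V p) (W p)) x (U x)
      + mvfderiv 𝓘(ℝ, E) (fun p ↦ symp p (W p) (U p)) x (V x)
      + mvfderiv 𝓘(ℝ, E) (fun p ↦ symp p (U p) (V p)) x (W x)
      - symp x (VectorField.mlieBracket 𝓘(ℝ, E) U V x) (W x)
      - symp x (VectorField.mlieBracket 𝓘(ℝ, E) V W x) (U x)
      - symp x (VectorField.mlieBracket 𝓘(ℝ, E) W U x) (V x) = 0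
  /-- the Nijenhuis tensor of `J` vanishes -/
  integrable : ∀ (x : X) (V W : Π x : X, TangentSpace 𝓘(ℝ, E) x),
    MDiffAt (T% V) x → MDiffAt (T% W) x →
    VectorField.mlieBracket 𝓘(ℝ, E) (fun p ↦ J p (V p)) (fun p ↦ J p (W p)) x
      - J x (VectorField.mlieBracket 𝓘(ℝ, E) (fun p ↦ J p (V p)) W x)
      - J x (VectorField.mlieBracket 𝓘(ℝ, E) V (fun p ↦ J p (W p)) x)
      - VectorField.mlieBracket 𝓘(ℝ, E) V W x = 0

/-- The Lie derivative `(L_V Ω)(W₁, …, Wₙ)` at `x` of a complex-valued `n`-form. -/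
def formLieDeriv {n : ℕ} (Ω : Π x : X, TangentSpace 𝓘(ℝ, E) x [⋀^Fin n]→L[ℝ] ℂ)
    (V : Π x : X, TangentSpace 𝓘(ℝ, E) x) (W : Fin n → Π x : X, TangentSpace 𝓘(ℝ, E) x)
    (x : X) : ℂ :=
  mvfderiv 𝓘(ℝ, E) (fun p ↦ Ω p (fun j ↦ W j p)) x (V x)
    - ∑ j, Ω x (Function.update (fun j ↦ W j x) j
        (VectorField.mlieBracket 𝓘(ℝ, E) V (W j) x))

/-- A Calabi–Yau structure of complex dimension `n`: a Kähler structure together with a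
holomorphic volume form `Ω` of constant length one. -/
structure CalabiYauStructure (E : Type*) [NormedAddCommGroup E] [NormedSpace ℝ E]
    [FiniteDimensional ℝ E] (X : Type*) [TopologicalSpace X] [ChartedSpace E X]
    [IsManifold 𝓘(ℝ, E) ∞ X] [Bundle.RiemannianBundle (fun x : X ↦ TangentSpace 𝓘(ℝ, E) x)]
    (n : ℕ) extends KahlerStructure E X where
  finrank_eq : Module.finrank ℝ E = 2 * n
  /-- the holomorphic volume form -/
  Ω : Π x : X, TangentSpace 𝓘(ℝ, E) x [⋀^Fin n]→L[ℝ] ℂ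
  /-- the coefficients of `Ω` in local trivializations of the tangent bundle are smooth -/
  contMDiff_Ω : ∀ x₀ : X, ContMDiffAt 𝓘(ℝ, E) 𝓘(ℝ, E [⋀^Fin n]→L[ℝ] ℂ) ∞
    (fun x ↦ (Ω x).compContinuousLinearMap
      ((trivializationAt E (TangentSpace 𝓘(ℝ, E) : X → Type _) x₀).symmL ℝ x)) x₀
  /-- `Ω` is of type `(n, 0)`, i.e. complex linear in each argument -/
  type_Ω : ∀ (x : X) (v : Fin n → TangentSpace 𝓘(ℝ, E) x) (j : Fin n),
    Ω x (Function.update v j (J x (v j))) = Complex.I * Ω x v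
  /-- `∂̄Ω = 0`: for `Ω` of type `(n, 0)`, Cartan's formula shows that `L_V Ω + i L_{JV} Ω` is twice
  the contraction of `∂̄Ω = dΩ` with the `(0, 1)`-part `(V + i J V) / 2` of `V` -/
  holomorphic : ∀ (x : X) (V : Π x : X, TangentSpace 𝓘(ℝ, E) x)
    (W : Fin n → Π x : X, TangentSpace 𝓘(ℝ, E) x),
    MDiffAt (T% V) x → (∀ j, MDiffAt (T% (W j)) x) →
    formLieDeriv Ω V W x + Complex.I * formLieDeriv Ω (fun p ↦ J p (V p)) W x = 0
  /-- `Ω = f θ¹ ∧ ⋯ ∧ θⁿ` with `|f| = 1` in every unitary frame -/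
  norm_Ω : ∀ (x : X) (e : Fin n → TangentSpace 𝓘(ℝ, E) x), Orthonormal ℝ e →
    (∀ a b, symp x (e a) (e b) = 0) → ‖Ω x e‖ = 1

/-- The Koszul expression for `g(∇_U V, W)`. -/
def koszul (U V W : Π x : X, TangentSpace 𝓘(ℝ, E) x) (x : X) : ℝ :=
  (mvfderiv 𝓘(ℝ, E) (fun p ↦ inner ℝ (V p) (W p)) x (U x)
    + mvfderiv 𝓘(ℝ, E) (fun p ↦ inner ℝ (W p) (U p)) x (V x)
    - mvfderiv 𝓘(ℝ, E) (fun p ↦ inner ℝ (U p) (V p)) x (W x)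
    + inner ℝ (VectorField.mlieBracket 𝓘(ℝ, E) U V x) (W x)
    - inner ℝ (VectorField.mlieBracket 𝓘(ℝ, E) V W x) (U x)
    + inner ℝ (VectorField.mlieBracket 𝓘(ℝ, E) W U x) (V x)) / 2

/-- The Levi-Civita covariant derivative `∇_u V` at `x` of a vector field `V` differentiable
at `x`, given by the Koszul formula in an orthonormal basis of the tangent space. -/
def leviCivita (V : Π x : X, TangentSpace 𝓘(ℝ, E) x) (x : X) (u : TangentSpace 𝓘(ℝ, E) x) :
    TangentSpace 𝓘(ℝ, E) x :=
  ∑ j, koszul (FiberBundle.extend E u) V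
    (FiberBundle.extend E (stdOrthonormalBasis ℝ (TangentSpace 𝓘(ℝ, E) x) j)) x •
      stdOrthonormalBasis ℝ (TangentSpace 𝓘(ℝ, E) x) j

end AmbientGeometry

section CoisotropicGeometry

set_option linter.unusedSectionVars false

variable {E : Type*} [NormedAddCommGroup E] [NormedSpace ℝ E] [FiniteDimensional ℝ E]
  {X : Type*} [TopologicalSpace X] [ChartedSpace E X] [IsManifold 𝓘(ℝ, E) ∞ X]
  [Bundle.RiemannianBundle (fun x : X ↦ TangentSpace 𝓘(ℝ, E) x)]
  {F : Type*} [NormedAddCommGroup F] [NormedSpace ℝ F] [FiniteDimensional ℝ F]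
  {Y : Type*} [TopologicalSpace Y] [ChartedSpace F Y] [IsManifold 𝓘(ℝ, F) ∞ Y]

/-- The differential `di : T_y Y → T_{i(y)} X`. -/
abbrev differential (i : Y → X) (y : Y) :
    TangentSpace 𝓘(ℝ, F) y →L[ℝ] TangentSpace 𝓘(ℝ, E) (i y) :=
  mfderiv 𝓘(ℝ, F) 𝓘(ℝ, E) i y

/-- The tangent space of the submanifold `i : Y → X` as a subspace of `T_{i(y)} X`. -/
def tangentImage (i : Y → X) (y : Y) : Submodule ℝ (TangentSpace 𝓘(ℝ, E) (i y)) :=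
  LinearMap.range (differential (F := F) i y).toLinearMap

/-- The symplectic orthogonal complement `(T_y Y)^ω`, as a subspace of `T_{i(y)} X`. -/
def symplecticNormal (K : KahlerStructure E X) (i : Y → X) (y : Y) :
    Submodule ℝ (TangentSpace 𝓘(ℝ, E) (i y)) where
  carrier := {v | ∀ w ∈ tangentImage (F := F) i y, K.symp (i y) v w = 0}
  add_mem' hv hv' w hw := by simp [hv w hw, hv' w hw]
  zero_mem' w _ := by simp
  smul_mem' c v hv w hw := by simp [hv w hw]

/-- `i : Y → X` is (the inclusion of) an embedded coisotropic submanifold of real dimension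
`l + 2 k`, where `dim X = 2 (l + k)`; then `l` is the dimension of the leaves of the null
foliation and `2 k` the rank of the restriction of `ω` to `Y`. -/
structure IsCoisotropicSubmanifold (K : KahlerStructure E X) (l k : ℕ) (i : Y → X) : Prop where
  finrank_ambient : Module.finrank ℝ E = 2 * (l + k)
  finrank_eq : Module.finrank ℝ F = l + 2 * k
  isSmoothEmbedding : Manifold.IsSmoothEmbedding 𝓘(ℝ, F) 𝓘(ℝ, E) ∞ i
  coisotropic : ∀ y, symplecticNormal (F := F) K i y ≤ tangentImage (F := F) i y

/-- The null distribution `T_y 𝓕 = ker (i^* ω)_y ⊂ T_y Y`, tangent to the null foliation. -/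
def nullDistribution (K : KahlerStructure E X) (i : Y → X) (y : Y) :
    Submodule ℝ (TangentSpace 𝓘(ℝ, F) y) :=
  (symplecticNormal (F := F) K i y).comap (differential i y).toLinearMap

/-- The horizontal space `H_y`: the orthogonal complement of `T_y 𝓕` in `T_y Y`, as a subspace
of `T_{i(y)} X`. -/
def horizontalSpace (K : KahlerStructure E X) (i : Y → X) (y : Y) :
    Submodule ℝ (TangentSpace 𝓘(ℝ, E) (i y)) :=
  tangentImage (F := F) i y ⊓ ((nullDistribution K i y).map (differential (F := F) i y).toLinearMap)ᗮ

/-- The pullback to `i^* TX` of the Levi-Civita connection: `∇_v η` at `y`, for a section `η` of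
`i^* TX` differentiable at `y`. Near `y`, `η` is written in a local trivialization of `TX`
around `i(y)`; the first term differentiates its coefficients, and the second is the Levi-Civita
derivative of the field which has constant coefficients and extends `η(y)`. -/
def pullbackCov (i : Y → X) (η : Π y : Y, TangentSpace 𝓘(ℝ, E) (i y)) (y : Y)
    (v : TangentSpace 𝓘(ℝ, F) y) : TangentSpace 𝓘(ℝ, E) (i y) :=
  (trivializationAt E (TangentSpace 𝓘(ℝ, E) : X → Type _) (i y)).symm (i y)
      (mvfderiv 𝓘(ℝ, F) (fun p ↦ (trivializationAt E (TangentSpace 𝓘(ℝ, E) : X → Type _) (i y)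
        ⟨i p, η p⟩).2) y v)
    + leviCivita (FiberBundle.extend E (η y)) (i y) (differential i y v)

/-- The second fundamental form `S(v, w)` of `Y ⊂ X`: the component normal to `Y` of `∇_v w`. -/
def secondFundamentalForm (i : Y → X) (y : Y) (v w : TangentSpace 𝓘(ℝ, F) y) :
    TangentSpace 𝓘(ℝ, E) (i y) :=
  (tangentImage (F := F) i y)ᗮ.starProjection
    (pullbackCov i (fun p ↦ differential (E := E) i p (FiberBundle.extend F w p)) y v)

/-- `e` is an orthonormal family (for the induced metric) of `l` vectors tangent to the null
foliation at `y`. -/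
def IsLeafFrame (K : KahlerStructure E X) {l : ℕ} (i : Y → X) (y : Y)
    (e : Fin l → TangentSpace 𝓘(ℝ, F) y) : Prop :=
  (∀ a, e a ∈ nullDistribution K i y) ∧ Orthonormal ℝ (fun a ↦ differential (E := E) i y (e a))

theorem IsCoisotropicSubmanifold.differential_injective {K : KahlerStructure E X} {l k : ℕ}
    {i : Y → X} (h : IsCoisotropicSubmanifold (F := F) K l k i) (y : Y) :
    Function.Injective (differential (E := E) (F := F) i y) := by
  obtain ⟨G, _, _, hG⟩ := h.isSmoothEmbedding.isImmersion.isImmersionAt y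
  have hφ : MDiffAt hG.domChart y := mdifferentiableAt_of_mem_maximalAtlas
    (IsManifold.maximalAtlas_subset_of_le (by simp) hG.domChart_mem_maximalAtlas)
    hG.mem_domChart_source
  have hψ : MDiffAt hG.codChart (i y) := mdifferentiableAt_of_mem_maximalAtlas
    (IsManifold.maximalAtlas_subset_of_le (by simp) hG.codChart_mem_maximalAtlas)
    hG.mem_codChart_source
  have hi : MDiffAt i y := h.isSmoothEmbedding.contMDiff.mdifferentiable (by simp) y
  have heq : (hG.codChart ∘ i) =ᶠ[nhds y] fun p ↦ hG.equiv (hG.domChart p, 0) := by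
    filter_upwards [hG.domChart.open_source.mem_nhds hG.mem_domChart_source] with p hp
    have := hG.writtenInCharts (show hG.domChart p ∈ (hG.domChart.extend 𝓘(ℝ, F)).target by
      simpa using hG.domChart.map_source hp)
    simpa [hG.domChart.left_inv hp] using this
  have hL : MDiffAt (fun u : F ↦ hG.equiv (u, (0 : G))) (hG.domChart y) :=
    (hG.equiv.toContinuousLinearMap.differentiable.comp
      (differentiable_id.prodMk (differentiable_const _))).mdifferentiable _
  have h1 : (mfderiv 𝓘(ℝ, E) 𝓘(ℝ, E) hG.codChart (i y)).comp (differential i y)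
      = (mfderiv 𝓘(ℝ, F) 𝓘(ℝ, E) (fun u : F ↦ hG.equiv (u, (0 : G))) (hG.domChart y)).comp
        (mfderiv 𝓘(ℝ, F) 𝓘(ℝ, F) hG.domChart y) := by
    rw [← mfderiv_comp y hψ hi, heq.mfderiv_eq]
    exact mfderiv_comp y hL hφ
  have hL' : mfderiv 𝓘(ℝ, F) 𝓘(ℝ, E) (fun u : F ↦ hG.equiv (u, (0 : G))) (hG.domChart y)
      = hG.equiv.toContinuousLinearMap.comp (ContinuousLinearMap.inl ℝ F G) := by
    rw [mfderiv_eq_fderiv]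
    exact (hG.equiv.toContinuousLinearMap.comp (ContinuousLinearMap.inl ℝ F G)).fderiv
  have h0 : Function.Injective (mfderiv 𝓘(ℝ, F) 𝓘(ℝ, F) hG.domChart y) :=
    OpenPartialHomeomorph.MDifferentiable.mfderiv_injective (I := 𝓘(ℝ, F)) (I' := 𝓘(ℝ, F))
      ⟨fun p hp ↦ (mdifferentiableAt_of_mem_maximalAtlas (IsManifold.maximalAtlas_subset_of_le
          (by simp) hG.domChart_mem_maximalAtlas) hp).mdifferentiableWithinAt,
        fun p hp ↦ (mdifferentiableAt_symm_of_mem_maximalAtlas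
          (IsManifold.maximalAtlas_subset_of_le (by simp) hG.domChart_mem_maximalAtlas)
          hp).mdifferentiableWithinAt⟩ hG.mem_domChart_source
  have h2 : Function.Injective (hG.equiv.toContinuousLinearMap.comp
      (ContinuousLinearMap.inl ℝ F G)) :=
    hG.equiv.injective.comp (Prod.mk_left_injective (0 : G))
  intro v w hvw
  apply h0
  apply h2
  have hv := congrArg (fun L ↦ L v) h1
  have hw := congrArg (fun L ↦ L w) h1
  rw [hL'] at hv hw
  exact hv.symm.trans ((congrArg (mfderiv 𝓘(ℝ, E) 𝓘(ℝ, E) hG.codChart (i y)) hvw).trans hw)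

theorem symp_eq_inner (K : KahlerStructure E X) (x : X) (v w : TangentSpace 𝓘(ℝ, E) x) :
    K.symp x v w = inner ℝ (K.J x v) w := by
  have h : inner ℝ (K.J x v) w = inner ℝ w (K.J x v) := real_inner_comm _ _
  rw [h, K.compatible, K.J_J, map_neg, K.symp_swap x v w, neg_neg]

theorem IsCoisotropicSubmanifold.finrank_symplecticNormal {K : KahlerStructure E X} {l k : ℕ}
    {i : Y → X} (h : IsCoisotropicSubmanifold (F := F) K l k i) (y : Y) :
    Module.finrank ℝ (symplecticNormal (F := F) K i y) = l := by
  have hJ : Function.Injective (K.J (i y)).toLinearMap := by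
    intro v w hvw
    have := congrArg (K.J (i y)) hvw
    simpa [K.J_J] using this
  have h1 : (symplecticNormal (F := F) K i y).map (K.J (i y)).toLinearMap
      = (tangentImage (F := F) i y)ᗮ := by
    ext v
    simp only [Submodule.mem_map, Submodule.mem_orthogonal']
    constructor
    · rintro ⟨u, hu, rfl⟩ w hw
      exact (symp_eq_inner K _ u w).symm.trans (hu w hw)
    · intro hv
      refine ⟨-K.J (i y) v, fun w hw ↦ ?_, ?_⟩
      · rw [symp_eq_inner, map_neg, K.J_J, neg_neg]
        exact hv w hw
      · simp [K.J_J]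
  have h2 : Module.finrank ℝ (tangentImage (E := E) (F := F) i y) = l + 2 * k := by
    rw [tangentImage, LinearMap.finrank_range_of_inj (h.differential_injective y)]
    exact h.finrank_eq
  have h3 := (tangentImage (E := E) (F := F) i y).finrank_add_finrank_orthogonal
  have h4 : Module.finrank ℝ (TangentSpace 𝓘(ℝ, E) (i y)) = 2 * (l + k) := h.finrank_ambient
  have h5 := (Submodule.equivMapOfInjective _ hJ (symplecticNormal (F := F) K i y)).finrank_eq
  rw [h1] at h5
  omega

theorem IsCoisotropicSubmanifold.exists_isLeafFrame {K : KahlerStructure E X} {l k : ℕ}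
    {i : Y → X} (h : IsCoisotropicSubmanifold (F := F) K l k i) (y : Y) :
    ∃ e : Fin l → TangentSpace 𝓘(ℝ, F) y, IsLeafFrame K i y e := by
  let b := (stdOrthonormalBasis ℝ (symplecticNormal (F := F) K i y)).reindex
    (finCongr (h.finrank_symplecticNormal y))
  choose e he using fun a ↦ h.coisotropic y (b a).2
  have he' : (fun a ↦ differential i y (e a)) = fun a ↦ (b a : TangentSpace 𝓘(ℝ, E) (i y)) :=
    funext he
  refine ⟨e, fun a ↦ ?_, ?_⟩
  · have := congrFun he' a
    change differential i y (e a) ∈ symplecticNormal (F := F) K i y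
    exact this ▸ (b a).2
  · rw [he']
    exact b.orthonormal.comp_linearIsometry (symplecticNormal (F := F) K i y).subtypeₗᵢ

/-- An orthonormal basis of `T_y 𝓕`. -/
def leafFrame {K : KahlerStructure E X} {l k : ℕ} {i : Y → X}
    (h : IsCoisotropicSubmanifold (F := F) K l k i) (y : Y) : Fin l → TangentSpace 𝓘(ℝ, F) y :=
  (h.exists_isLeafFrame y).choose

theorem isLeafFrame_leafFrame {K : KahlerStructure E X} {l k : ℕ} {i : Y → X}
    (h : IsCoisotropicSubmanifold (F := F) K l k i) (y : Y) :
    IsLeafFrame K i y (leafFrame h y) :=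
  (h.exists_isLeafFrame y).choose_spec

/-- The leafwise mean curvature vector: the trace of the second fundamental form over `T_y 𝓕`
(which does not depend on the orthonormal basis). -/
def leafwiseMeanCurvature {K : KahlerStructure E X} {l k : ℕ} {i : Y → X}
    (h : IsCoisotropicSubmanifold (F := F) K l k i) (y : Y) : TangentSpace 𝓘(ℝ, E) (i y) :=
  ∑ a, secondFundamentalForm i y (leafFrame h y a) (leafFrame h y a)

/-- The leafwise mean curvature one-form `α = (H ⌟ ω)|_{TY}`. -/
def leafwiseMeanCurvatureForm {K : KahlerStructure E X} {l k : ℕ} {i : Y → X}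
    (h : IsCoisotropicSubmanifold (F := F) K l k i) (y : Y) : TangentSpace 𝓘(ℝ, F) y →L[ℝ] ℝ :=
  (K.symp (i y) (leafwiseMeanCurvature h y)).comp (differential i y)

/-- `Y` is leafwise minimal if its leafwise mean curvature one-form vanishes. -/
def IsLeafwiseMinimal {K : KahlerStructure E X} {l k : ℕ} {i : Y → X}
    (h : IsCoisotropicSubmanifold (F := F) K l k i) : Prop :=
  ∀ y, leafwiseMeanCurvatureForm h y = 0

/-- The fibre at `y` of the transverse canonical bundle `K_Y = Λ^{k,0}(N^*𝓕)`, where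
`N^*𝓕 ⊂ T^*X` is the annihilator of `T𝓕 ⊕ NY` and `NY` is the orthogonal complement of `TY`. -/
def transverseCanonical (K : KahlerStructure E X) (k : ℕ) (i : Y → X) (y : Y) :
    Submodule ℂ (TangentSpace 𝓘(ℝ, E) (i y) [⋀^Fin k]→L[ℝ] ℂ) where
  carrier := {ζ | (∀ v j, ζ (Function.update v j (K.J (i y) (v j))) = Complex.I * ζ v) ∧
    ∀ v j, v j ∈ (nullDistribution K i y).map (differential (F := F) i y).toLinearMap ⊔
      (tangentImage (F := F) i y)ᗮ → ζ v = 0}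
  add_mem' hζ hζ' :=
    ⟨fun v j ↦ by simp [hζ.1, hζ'.1, mul_add], fun v j hv ↦ by simp [hζ.2 v j hv, hζ'.2 v j hv]⟩
  zero_mem' := ⟨fun v j ↦ by simp, fun v j _ ↦ by simp⟩
  smul_mem' c ζ hζ :=
    ⟨fun v j ↦ by simp [hζ.1, mul_left_comm], fun v j hv ↦ by simp [hζ.2 v j hv]⟩

/-- Evaluation of an element of `K_Y ⊗ K_Y` on two `k`-tuples of vectors,
`(σ ⊗ τ)(η; η') = σ(η) τ(η')`. -/
def evalTensor {K : KahlerStructure E X} {k : ℕ} {i : Y → X} {y : Y}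
    (η η' : Fin k → TangentSpace 𝓘(ℝ, E) (i y)) :
    transverseCanonical (F := F) K k i y ⊗[ℂ] transverseCanonical (F := F) K k i y →ₗ[ℂ] ℂ :=
  TensorProduct.lift (LinearMap.mk₂ ℂ (fun σ τ ↦ σ.1 η * τ.1 η')
    (fun _ _ _ ↦ by simp [add_mul]) (fun _ _ _ ↦ by simp [mul_assoc])
    (fun _ _ _ ↦ by simp [mul_add]) (fun _ _ _ ↦ by simp [mul_left_comm]))

theorem append_update {V : Type*} {l k : ℕ} [DecidableEq (Fin k)] (e : Fin l → V) (η : Fin k → V)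
    (j : Fin k) (v : V) : Fin.append e (Function.update η j v)
      = Function.update (Fin.append e η) (Fin.natAdd l j) v := by
  ext a
  refine Fin.addCases (fun b ↦ ?_) (fun b ↦ ?_) a
  · have hne : Fin.castAdd k b ≠ Fin.natAdd l j := fun h ↦ by
      have := congrArg Fin.val h
      simp at this
      omega
    simp [hne]
  · simp [Function.update_apply]

/-- The contraction `(e₁ ∧ ⋯ ∧ e_l) ⌟ Ω`. -/
def contract {V : Type*} [AddCommGroup V] [Module ℝ V] [TopologicalSpace V] {l k : ℕ}
    (Ω : V [⋀^Fin (l + k)]→L[ℝ] ℂ) (e : Fin l → V) : V [⋀^Fin k]→L[ℝ] ℂ where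
  toFun η := Ω (Fin.append e η)
  map_update_add' {_} η j v w := by
    simp [append_update]
  map_update_smul' {_} η j c v := by
    simp [append_update]
  map_eq_zero_of_eq' η a b hab hne := by
    refine Ω.map_eq_zero_of_eq _ (i := Fin.natAdd l a) (j := Fin.natAdd l b) (by simpa using hab) ?_
    simpa using hne
  cont := by
    refine Ω.cont.comp (continuous_pi fun a ↦ ?_)
    refine Fin.addCases (fun b ↦ ?_) (fun b ↦ ?_) a
    · simpa using continuous_const
    · simpa using continuous_apply b

/-- Contracting with vectors spanning `T_y 𝓕` a form of type `(l + k, 0)` gives an element of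
`K_Y`. -/
theorem contract_mem_transverseCanonical {K : KahlerStructure E X} {l k : ℕ} {i : Y → X}
    (h : IsCoisotropicSubmanifold (F := F) K l k i) (y : Y)
    {Ω : TangentSpace 𝓘(ℝ, E) (i y) [⋀^Fin (l + k)]→L[ℝ] ℂ}
    (hΩ : ∀ v j, Ω (Function.update v j (K.J (i y) (v j))) = Complex.I * Ω v)
    {e : Fin l → TangentSpace 𝓘(ℝ, F) y} (he : IsLeafFrame K i y e) :
    contract Ω (fun a ↦ differential i y (e a)) ∈ transverseCanonical (F := F) K k i y := by
  have hJ : ∀ v j, contract Ω (fun a ↦ differential i y (e a))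
      (Function.update v j (K.J (i y) (v j)))
        = Complex.I * contract Ω (fun a ↦ differential i y (e a)) v := by
    intro v j
    have := hΩ (Fin.append (fun a ↦ differential i y (e a)) v) (Fin.natAdd l j)
    rw [Fin.append_right, ← append_update] at this
    exact this
  refine ⟨hJ, ?_⟩
  -- the frame spans the image of `T_y 𝓕`
  have hspan : symplecticNormal (F := F) K i y
      ≤ Submodule.span ℝ (Set.range fun a ↦ differential i y (e a)) := by
    refine (Submodule.eq_of_le_of_finrank_eq (Submodule.span_le.2 ?_) ?_).ge
    · rintro _ ⟨a, rfl⟩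
      exact he.1 a
    · rw [finrank_span_eq_card he.2.linearIndependent, h.finrank_symplecticNormal y,
        Fintype.card_fin]
  have h1 : ∀ v j (w : TangentSpace 𝓘(ℝ, E) (i y)), w ∈ symplecticNormal (F := F) K i y →
      contract Ω (fun a ↦ differential i y (e a)) (Function.update v j w) = 0 := by
    intro v j w hw
    have hw' := hspan hw
    clear hw
    induction hw' using Submodule.span_induction with
    | mem w hw =>
      obtain ⟨a, rfl⟩ := hw
      refine Ω.map_eq_zero_of_eq _ (i := Fin.castAdd k a) (j := Fin.natAdd l j) (by simp) ?_
      intro h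
      have := congrArg Fin.val h
      simp at this
      omega
    | zero => exact ContinuousAlternatingMap.map_coord_zero _ j (by simp)
    | add w w' _ _ hw hw' => rw [ContinuousAlternatingMap.map_update_add, hw, hw', add_zero]
    | smul c w _ hw => rw [ContinuousAlternatingMap.map_update_smul, hw, smul_zero]
  have h2 : ∀ v j (w : TangentSpace 𝓘(ℝ, E) (i y)), w ∈ (tangentImage (F := F) i y)ᗮ →
      contract Ω (fun a ↦ differential i y (e a)) (Function.update v j w) = 0 := by
    intro v j w hw
    have h3 : K.J (i y) w ∈ symplecticNormal (F := F) K i y := by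
      intro u hu
      rw [symp_eq_inner, K.J_J, inner_neg_left, (Submodule.mem_orthogonal' _ _).1 hw u hu, neg_zero]
    have h4 := hJ (Function.update v j w) j
    rw [Function.update_self, Function.update_idem, h1 _ _ _ h3] at h4
    simpa using h4.symm
  intro v j hv
  obtain ⟨w, hw, w', hw', hww'⟩ := Submodule.mem_sup.1 hv
  have hw0 : w ∈ symplecticNormal (F := F) K i y := by
    obtain ⟨u, hu, rfl⟩ := hw
    exact hu
  rw [← Function.update_eq_self j v, ← hww', ContinuousAlternatingMap.map_update_add,
    h1 _ _ _ hw0, h2 _ _ _ hw', add_zero]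

/-- The canonical transverse Maslov charge: the section
`((u_{k+1} ∧ ⋯ ∧ u_{k+l}) ⌟ Ω)^{⊗ 2}` of `K_Y^{⊗ 2}`, where `e_{k+1}, …, e_{k+l}` is an orthonormal
basis of `T_y 𝓕` and `u_a = (e_a - i J e_a) / 2`. As `Ω` is of type `(n, 0)`, contracting it with
`u_a` is the same as contracting it with `e_a`. Another orthonormal basis, or another order of the
arguments, changes the contraction at most by a sign, which the square removes. -/
def canonicalMaslovCharge {l k : ℕ} (C : CalabiYauStructure E X (l + k)) {i : Y → X}
    (h : IsCoisotropicSubmanifold (F := F) C.toKahlerStructure l k i) (y : Y) :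
    transverseCanonical (F := F) C.toKahlerStructure k i y ⊗[ℂ]
      transverseCanonical (F := F) C.toKahlerStructure k i y :=
  ⟨_, contract_mem_transverseCanonical h y (C.type_Ω (i y)) (isLeafFrame_leafFrame h y)⟩
    ⊗ₜ[ℂ]
  ⟨_, contract_mem_transverseCanonical h y (C.type_Ω (i y)) (isLeafFrame_leafFrame h y)⟩

/-- The connection on the bundle `H` induced from `i^* TX`: `∇^H_v η = π_H (∇_v η)`, where `π_H` is
the orthogonal projection onto `H`. -/
def horizontalCov (K : KahlerStructure E X) (i : Y → X)
    (η : Π y : Y, TangentSpace 𝓘(ℝ, E) (i y)) (y : Y) (v : TangentSpace 𝓘(ℝ, F) y) :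
    TangentSpace 𝓘(ℝ, E) (i y) :=
  (horizontalSpace (F := F) K i y).starProjection (pullbackCov i η y v)

/-- `η` is a section of the bundle `H`, differentiable at `y`. -/
def IsHorizontalSectionAt (K : KahlerStructure E X) (i : Y → X)
    (η : Π y : Y, TangentSpace 𝓘(ℝ, E) (i y)) (y : Y) : Prop :=
  (∀ p, η p ∈ horizontalSpace (F := F) K i p) ∧
    MDifferentiableAt 𝓘(ℝ, F) (𝓘(ℝ, E).prod 𝓘(ℝ, E))
      (fun p ↦ (⟨i p, η p⟩ : TangentBundle 𝓘(ℝ, E) X)) y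

/-- The connection on `K_Y^{⊗ 2}` induced by `∇^H`: the value `(∇_v Δ)(η; η')` at `y` for sections
`η₁, …, η_k, η'₁, …, η'_k` of `H`. -/
def maslovCov {K : KahlerStructure E X} {k : ℕ} {i : Y → X}
    (Δ : Π y : Y, transverseCanonical (F := F) K k i y ⊗[ℂ] transverseCanonical (F := F) K k i y)
    (y : Y) (v : TangentSpace 𝓘(ℝ, F) y)
    (η η' : Fin k → Π y : Y, TangentSpace 𝓘(ℝ, E) (i y)) : ℂ :=
  mvfderiv 𝓘(ℝ, F) (fun p ↦ evalTensor (fun j ↦ η j p) (fun j ↦ η' j p) (Δ p)) y v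
    - ∑ j, evalTensor (Function.update (fun j ↦ η j y) j (horizontalCov K i (η j) y v))
        (fun j ↦ η' j y) (Δ y)
    - ∑ j, evalTensor (fun j ↦ η j y)
        (Function.update (fun j ↦ η' j y) j (horizontalCov K i (η' j) y v)) (Δ y)

/-- A section `Δ` of `K_Y^{⊗ 2}` is leafwise parallel if `∇_v Δ = 0` for all `v` tangent to the
null foliation. -/
def IsLeafwiseParallel {K : KahlerStructure E X} {k : ℕ} {i : Y → X}
    (Δ : Π y : Y, transverseCanonical (F := F) K k i y ⊗[ℂ]
      transverseCanonical (F := F) K k i y) : Prop :=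
  ∀ y, ∀ v ∈ nullDistribution K i y, ∀ η η' : Fin k → Π y : Y, TangentSpace 𝓘(ℝ, E) (i y),
    (∀ j, IsHorizontalSectionAt (F := F) K i (η j) y) →
    (∀ j, IsHorizontalSectionAt (F := F) K i (η' j) y) → maslovCov Δ y v η η' = 0

/-- `Y` is leafwise special coisotropic if its canonical transverse Maslov charge is leafwise
parallel. -/
def IsLeafwiseSpecial {l k : ℕ} (C : CalabiYauStructure E X (l + k)) {i : Y → X}
    (h : IsCoisotropicSubmanifold (F := F) C.toKahlerStructure l k i) : Prop :=
  IsLeafwiseParallel (canonicalMaslovCharge C h)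

end CoisotropicGeometry

end

/-!
The equivalence follows from the formula `∇_v Δ = -2 i α(v) Δ` for `v` tangent to the null
foliation (`IsCoisotropicSubmanifold.maslovCov_canonicalMaslovCharge`), where `Δ` is the canonical
Maslov charge and `α` the leafwise mean curvature form.

On a Calabi–Yau manifold `Ω` is parallel: `∇J = 0` (`JDeriv_eq`) is the classical consequence of
`dω = 0` and of the integrability of `J`, and `∇Ω = 0` (`volumeCov_eq_zero`) holds since `∇_u Ω` is
of type `(n, 0)`, while on a unitary basis `∇_u Ω / Ω` is imaginary because `|Ω|` is constant, and
`i` times an imaginary number because `Ω` is holomorphic. Both facts are proved in coordinates at a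
single point, where the trivialization of the tangent bundle is the identity and the connection is
given by the Christoffel symbols. Along `i : Y → X` they turn into Leibniz rules for the pulled back
connection (`MDiffAlong.inner`, `MDiffAlong.pullbackCov_J`, `MDiffAlong.volume`).

The leafwise orthonormal frame of `T𝓕` in the definition of `Δ` is arbitrary at each point, with no
continuity. Near a point `y` it is replaced by the projections `f_a` to `(TY)^ω` of constant fields,
which are differentiable and agree with it at `y`; this multiplies `Δ` by the Gram determinant of
`f` (`map_mul_map_eq_gram_det`). Differentiating `Ω(f, η)` for horizontal `η`, the components of
`∇η_j` in `T𝓕 ⊕ NY` do not contribute, and `∇f_a` contributes its Hermitian product with `e_a`. The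
real parts cancel against the derivative of the Gram determinant, and the imaginary parts add up to
`∑ ⟨∇_v f_a, J e_a⟩ = ∑ ⟨S(v, e_a), J e_a⟩`. As `⟨S(u, v), J w⟩` is totally symmetric in vectors
`u`, `v`, `w` tangent to the foliation (`S` is symmetric, and `⟨f_a, J f_c⟩ = 0`), this is the
pairing of the mean curvature vector with `J v`, that is `-α(v)`.

For the converse, `Δ` is nonzero on horizontal sections completing the leafwise frame to a unitary
basis, and `α` vanishes as soon as it does on `T𝓕`, since `J` maps the mean curvature vector to
`T𝓕`.
-/


set_option linter.unusedSectionVars false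

noncomputable section

/-! ### Hermitian linear algebra -/

section HermitianAlgebra

variable {V : Type*} [NormedAddCommGroup V] [InnerProductSpace ℝ V] {ι : Type*}

/-- A family is *unitary* for the almost complex structure `J` if it is orthonormal over `ℝ` and
spans an isotropic subspace of `⟨J ·, ·⟩`, i.e. if it is orthonormal for the Hermitian metric. -/
structure IsUnitaryFamily (J : V →L[ℝ] V) (e : ι → V) : Prop where
  orthonormal : Orthonormal ℝ e
  isotropic : ∀ a b, inner ℝ (J (e a)) (e b) = 0

/-- A complex multiple `c • v`, for the complex structure `J`. -/
def complexSMul (J : V →L[ℝ] V) (c : ℂ) (v : V) : V := c.re • v + c.im • J v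

/-- The Hermitian product `⟨u, v⟩ + i ⟨u, J v⟩`, complex linear in `u`. -/
def hermitian (J : V →L[ℝ] V) (u v : V) : ℂ := inner ℝ u v + Complex.I * inner ℝ u (J v)

variable {J : V →L[ℝ] V}

theorem apply_inner_apply (hJJ : ∀ v, J (J v) = -v)
    (hskew : ∀ u v, inner ℝ (J u) v = -inner ℝ u (J v)) (u v : V) :
    inner ℝ (J u) (J v) = inner ℝ u v := by
  rw [hskew, hJJ, inner_neg_right, neg_neg]

theorem inner_apply_self (hskew : ∀ u v, inner ℝ (J u) v = -inner ℝ u (J v)) (u : V) :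
    inner ℝ (J u) u = 0 := by
  have h := hskew u u
  rw [real_inner_comm] at h ⊢
  linarith

theorem map_complexSMul_of_type [DecidableEq ι] (Φ : V [⋀^ι]→ₗ[ℝ] ℂ)
    (hΦ : ∀ v j, Φ (Function.update v j (J (v j))) = Complex.I * Φ v) (v : ι → V) (j : ι) (c : ℂ)
    (x : V) : Φ (Function.update v j (complexSMul J c x)) = c * Φ (Function.update v j x) := by
  have h := hΦ (Function.update v j x) j
  rw [Function.update_self, Function.update_idem] at h
  rw [complexSMul, AlternatingMap.map_update_add, AlternatingMap.map_update_smul,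
    AlternatingMap.map_update_smul, h, Complex.real_smul, Complex.real_smul]
  conv_rhs => rw [← Complex.re_add_im c]
  ring

/-- A form of type `(n, 0)` transforms by the complex determinant. -/
theorem map_sum_complexSMul [Fintype ι] [inst : DecidableEq ι] (hJJ : ∀ v, J (J v) = -v)
    (Φ : V [⋀^ι]→ₗ[ℝ] ℂ)
    (hΦ : ∀ v j, Φ (Function.update v j (J (v j))) = Complex.I * Φ v)
    (e : ι → V) (z : Matrix ι ι ℂ) :
    Φ (fun a ↦ ∑ b, complexSMul J (z a b) (e b)) = z.det * Φ e := by
  let T : (ι → ℂ) → V := fun c ↦ ∑ b, complexSMul J (c b) (e b)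
  have hadd : ∀ c d, T (c + d) = T c + T d := fun c d ↦ by
    simp only [T, complexSMul, ← Finset.sum_add_distrib, Pi.add_apply, Complex.add_re,
      Complex.add_im]
    exact Finset.sum_congr rfl fun b _ ↦ by module
  have hsmul : ∀ (s : ℂ) c, T (s • c) = complexSMul J s (T c) := fun s c ↦ by
    simp only [T, complexSMul, map_sum, Finset.smul_sum, ← Finset.sum_add_distrib, Pi.smul_apply,
      smul_eq_mul, Complex.mul_re, Complex.mul_im, map_add, map_smul, hJJ]
    exact Finset.sum_congr rfl fun b _ ↦ by module
  have hup : ∀ (m : ι → ι → ℂ) (i : ι) (x : ι → ℂ) (_ : DecidableEq ι),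
      (fun a ↦ T (Function.update m i x a)) = Function.update (fun a ↦ T (m a)) i (T x) := by
    intro m i x _
    ext a
    rcases eq_or_ne a i with rfl | h
    · simp
    · simp [h]
  let Ψ : (ι → ℂ) [⋀^ι]→ₗ[ℂ] ℂ :=
    { toFun := fun m ↦ Φ fun a ↦ T (m a)
      map_update_add' := by
        intro _ m i x y
        simp only [hup, hadd, AlternatingMap.map_update_add]
      map_update_smul' := by
        intro inst' m i c x
        obtain rfl : inst' = inst := Subsingleton.elim _ _
        rw [hup, hup, hsmul]
        exact map_complexSMul_of_type Φ hΦ (fun a ↦ T (m a)) i c (T x)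
      map_eq_zero_of_eq' := fun m i j hij hne ↦
        Φ.map_eq_zero_of_eq _ (congrArg T hij) hne }
  have h : Ψ z = Ψ (Pi.basisFun ℂ ι) * (Pi.basisFun ℂ ι).det z :=
    DFunLike.congr_fun (Ψ.eq_smul_basis_det (Pi.basisFun ℂ ι)) z
  have h1 : (fun a ↦ T (Pi.basisFun ℂ ι a)) = e := by
    ext a
    simp only [T, complexSMul, Pi.basisFun_apply, Pi.single_apply]
    rw [Finset.sum_eq_single a]
    · simp
    · intro b _ hb; simp [hb]
    · simp
  have h2 : (Pi.basisFun ℂ ι).det z = z.det := by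
    rw [Pi.basisFun_det]
    rfl
  have h3 : Ψ (Pi.basisFun ℂ ι) = Φ e := congrArg Φ h1
  rw [h2, h3, mul_comm] at h
  exact h

theorem IsUnitaryFamily.orthonormal_sumElim (hJJ : ∀ v, J (J v) = -v)
    (hskew : ∀ u v, inner ℝ (J u) v = -inner ℝ u (J v)) {e : ι → V} (he : IsUnitaryFamily J e) :
    Orthonormal ℝ (Sum.elim e fun a ↦ J (e a)) := by
  classical
  have h := orthonormal_iff_ite.1 he.orthonormal
  rw [orthonormal_iff_ite]
  rintro (a | a) (b | b)
  · simpa using h a b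
  · simpa [real_inner_comm] using he.isotropic b a
  · simpa using he.isotropic a b
  · simpa [apply_inner_apply hJJ hskew] using h a b

/-- The expansion of a vector in a unitary basis. -/
theorem IsUnitaryFamily.sum_hermitian [Fintype ι] [FiniteDimensional ℝ V]
    (hJJ : ∀ v, J (J v) = -v)
    (hskew : ∀ u v, inner ℝ (J u) v = -inner ℝ u (J v)) {e : ι → V} (he : IsUnitaryFamily J e)
    (hcard : Module.finrank ℝ V = 2 * Fintype.card ι) (v : V) :
    ∑ b, complexSMul J (hermitian J v (e b)) (e b) = v := by
  classical
  have ho := he.orthonormal_sumElim hJJ hskew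
  let B : OrthonormalBasis (ι ⊕ ι) ℝ V := OrthonormalBasis.mk ho
    (ho.linearIndependent.span_eq_top_of_card_eq_finrank' (by simp [hcard, two_mul])).ge
  have h := B.sum_repr' v
  simp only [B, OrthonormalBasis.coe_mk, Fintype.sum_sum_type, Sum.elim_inl, Sum.elim_inr,
    ← Finset.sum_add_distrib] at h
  conv_rhs => rw [← h]
  refine Finset.sum_congr rfl fun b _ ↦ ?_
  simp [complexSMul, hermitian, real_inner_comm]

theorem IsUnitaryFamily.sum_hermitian_mul [Fintype ι] [FiniteDimensional ℝ V]
    (hJJ : ∀ v, J (J v) = -v)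
    (hskew : ∀ u v, inner ℝ (J u) v = -inner ℝ u (J v)) {e : ι → V} (he : IsUnitaryFamily J e)
    (hcard : Module.finrank ℝ V = 2 * Fintype.card ι) (u v : V) :
    ∑ b, hermitian J u (e b) * starRingEnd ℂ (hermitian J v (e b)) = hermitian J u v := by
  have h1 := congrArg (fun x ↦ inner ℝ u x) (he.sum_hermitian hJJ hskew hcard v)
  have h2 := congrArg (fun x ↦ inner ℝ u (J x)) (he.sum_hermitian hJJ hskew hcard v)
  simp only [complexSMul, hermitian, map_sum, inner_sum, map_add, map_smul, inner_add_right,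
    inner_smul_right, hJJ, inner_neg_right] at h1 h2
  apply Complex.ext
  · simp [hermitian, ← h1]
    exact Finset.sum_congr rfl fun b _ ↦ by ring
  · simp [hermitian, ← h2]
    exact Finset.sum_congr rfl fun b _ ↦ by ring

/-- In a unitary basis, a form of type `(n, 0)` is the complex determinant. -/
theorem IsUnitaryFamily.map_eq_det [Fintype ι] [DecidableEq ι] [FiniteDimensional ℝ V]
    (hJJ : ∀ v, J (J v) = -v)
    (hskew : ∀ u v, inner ℝ (J u) v = -inner ℝ u (J v)) {e : ι → V} (he : IsUnitaryFamily J e)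
    (hcard : Module.finrank ℝ V = 2 * Fintype.card ι) (Φ : V [⋀^ι]→ₗ[ℝ] ℂ)
    (hΦ : ∀ v j, Φ (Function.update v j (J (v j))) = Complex.I * Φ v) (w : ι → V) :
    Φ w = (Matrix.of fun a b ↦ hermitian J (w a) (e b)).det * Φ e := by
  rw [← map_sum_complexSMul hJJ Φ hΦ]
  simp only [Matrix.of_apply, he.sum_hermitian hJJ hskew hcard]

/-- If `Φ` has length one in unitary frames, `|Φ(w)|²` is the Hermitian Gram determinant of `w`. -/
theorem IsUnitaryFamily.map_mul_conj_eq_det [Fintype ι] [DecidableEq ι] [FiniteDimensional ℝ V]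
    (hJJ : ∀ v, J (J v) = -v)
    (hskew : ∀ u v, inner ℝ (J u) v = -inner ℝ u (J v)) {e : ι → V} (he : IsUnitaryFamily J e)
    (hcard : Module.finrank ℝ V = 2 * Fintype.card ι) (Φ : V [⋀^ι]→ₗ[ℝ] ℂ)
    (hΦ : ∀ v j, Φ (Function.update v j (J (v j))) = Complex.I * Φ v) (hnorm : ‖Φ e‖ = 1)
    (w : ι → V) :
    Φ w * starRingEnd ℂ (Φ w) = (Matrix.of fun a b ↦ hermitian J (w a) (w b)).det := by
  have h0 : Φ e * starRingEnd ℂ (Φ e) = 1 := by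
    rw [Complex.mul_conj, Complex.normSq_eq_norm_sq, hnorm]; simp
  have h1 : (Matrix.of fun a b ↦ hermitian J (w a) (w b))
      = (Matrix.of fun a b ↦ hermitian J (w a) (e b))
        * (Matrix.of fun a b ↦ hermitian J (w a) (e b)).conjTranspose := by
    ext a b
    simp only [Matrix.of_apply, Matrix.mul_apply, Matrix.conjTranspose_apply]
    exact (he.sum_hermitian_mul hJJ hskew hcard _ _).symm
  rw [h1, Matrix.det_mul, Matrix.det_conjTranspose, he.map_eq_det hJJ hskew hcard Φ hΦ w, map_mul]
  rw [Complex.star_def]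
  linear_combination (Matrix.of fun a b ↦ hermitian J (w a) (e b)).det
    * starRingEnd ℂ (Matrix.of fun a b ↦ hermitian J (w a) (e b)).det * h0

/-- A form of type `(n, 0)` vanishes on vectors which are all Hermitian orthogonal to a fixed
member of a unitary basis. -/
theorem IsUnitaryFamily.map_eq_zero_of_hermitian_eq_zero [Fintype ι] [DecidableEq ι]
    [FiniteDimensional ℝ V] (hJJ : ∀ v, J (J v) = -v)
    (hskew : ∀ u v, inner ℝ (J u) v = -inner ℝ u (J v)) {e : ι → V} (he : IsUnitaryFamily J e)
    (hcard : Module.finrank ℝ V = 2 * Fintype.card ι) (Φ : V [⋀^ι]→ₗ[ℝ] ℂ)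
    (hΦ : ∀ v j, Φ (Function.update v j (J (v j))) = Complex.I * Φ v) (w : ι → V) (b : ι)
    (hw : ∀ a, hermitian J (w a) (e b) = 0) : Φ w = 0 := by
  rw [he.map_eq_det hJJ hskew hcard Φ hΦ w, Matrix.det_eq_zero_of_column_eq_zero b hw, zero_mul]

theorem hermitian_complexSMul (hJJ : ∀ v, J (J v) = -v)
    (hskew : ∀ u v, inner ℝ (J u) v = -inner ℝ u (J v)) (c : ℂ) (u v : V) :
    hermitian J (complexSMul J c u) v = c * hermitian J u v := by
  apply Complex.ext
  · simp [hermitian, complexSMul, inner_add_left, inner_smul_left, hskew]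
    ring
  · simp [hermitian, complexSMul, inner_add_left, inner_smul_left, apply_inner_apply hJJ hskew]

theorem hermitian_self_of_norm_eq_one (hskew : ∀ u v, inner ℝ (J u) v = -inner ℝ u (J v)) {u : V}
    (hu : ‖u‖ = 1) : hermitian J u u = 1 := by
  have h := inner_apply_self hskew u
  rw [real_inner_comm] at h
  simp [hermitian, h, hu]

theorem IsUnitaryFamily.hermitian_eq_zero {e : ι → V} (he : IsUnitaryFamily J e) {a b : ι}
    (hab : a ≠ b) : hermitian J (e a) (e b) = 0 := by
  rw [hermitian, he.orthonormal.2 hab, real_inner_comm, he.isotropic]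
  simp

/-- Replacing a member `e a` of a unitary basis by any `x`, next to vectors which are Hermitian
orthogonal to `e a`, multiplies a form of type `(n, 0)` by the Hermitian product of `x` and
`e a`. -/
theorem IsUnitaryFamily.map_update [Fintype ι] [DecidableEq ι] [FiniteDimensional ℝ V]
    (hJJ : ∀ v, J (J v) = -v) (hskew : ∀ u v, inner ℝ (J u) v = -inner ℝ u (J v)) {e : ι → V}
    (he : IsUnitaryFamily J e) (hcard : Module.finrank ℝ V = 2 * Fintype.card ι)
    (Φ : V [⋀^ι]→ₗ[ℝ] ℂ) (hΦ : ∀ v j, Φ (Function.update v j (J (v j))) = Complex.I * Φ v)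
    (w : ι → V) (a : ι) (hw : ∀ b, b ≠ a → hermitian J (w b) (e a) = 0) (x : V) :
    Φ (Function.update w a x) = hermitian J x (e a) * Φ (Function.update w a (e a)) := by
  have h1 : Φ (Function.update w a (x - complexSMul J (hermitian J x (e a)) (e a))) = 0 := by
    refine he.map_eq_zero_of_hermitian_eq_zero hJJ hskew hcard Φ hΦ _ a fun b ↦ ?_
    rcases eq_or_ne b a with rfl | hb
    · have h2 := hermitian_complexSMul hJJ hskew (hermitian J x (e b)) (e b) (e b)
      rw [hermitian_self_of_norm_eq_one hskew (he.orthonormal.1 b), mul_one] at h2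
      have h3 : ∀ u v : V, hermitian J (u - v) (e b) = hermitian J u (e b) - hermitian J v (e b) :=
        fun u v ↦ by simp only [hermitian, inner_sub_left]; push_cast; ring
      rw [Function.update_self, h3, h2, sub_self]
    · rw [Function.update_of_ne hb]
      exact hw b hb
  rw [← map_complexSMul_of_type Φ hΦ, ← sub_eq_zero, ← h1, ← AlternatingMap.map_update_sub]

/-- The action of an endomorphism `D` on an alternating form by derivations:
`w ↦ ∑ j, Φ (w₁, …, D wⱼ, …, wₙ)`. -/
def derivationAction [Fintype ι] [DecidableEq ι] (Φ : V [⋀^ι]→ₗ[ℝ] ℂ) (D : V →ₗ[ℝ] V) :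
    V [⋀^ι]→ₗ[ℝ] ℂ :=
  { ∑ j, Φ.toMultilinearMap.compLinearMap (fun m ↦ if m = j then D else LinearMap.id) with
    map_eq_zero_of_eq' := by
      intro w a b hab hne
      have hterm : ∀ j, (Φ.toMultilinearMap.compLinearMap
          (fun m ↦ if m = j then D else LinearMap.id)) w = Φ (Function.update w j (D (w j))) := by
        intro j
        refine congrArg Φ (funext fun m ↦ ?_)
        rcases eq_or_ne m j with rfl | h
        · simp
        · simp [h]
      simp only [MultilinearMap.toFun_eq_coe, sum_apply, hterm]
      rw [Finset.sum_eq_add a b hne]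
      · have hswap : Function.update w b (D (w b))
            = Function.update w a (D (w a)) ∘ Equiv.swap a b := by
          ext m
          rcases eq_or_ne m a with rfl | hma
          · simp [hne, hne.symm, hab]
          · rcases eq_or_ne m b with rfl | hmb
            · simp [hab]
            · simp [hma, hmb, Equiv.swap_apply_of_ne_of_ne hma hmb]
        rw [hswap, Φ.map_swap _ hne]
        simp
      · intro j _ hj
        refine Φ.map_eq_zero_of_eq _ (i := a) (j := b) ?_ hne
        rw [Function.update_of_ne hj.1.symm, Function.update_of_ne hj.2.symm, hab]
      · simp
      · simp }

theorem derivationAction_apply [Fintype ι] [DecidableEq ι] (Φ : V [⋀^ι]→ₗ[ℝ] ℂ) (D : V →ₗ[ℝ] V)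
    (w : ι → V) : derivationAction Φ D w = ∑ j, Φ (Function.update w j (D (w j))) := by
  have h : derivationAction Φ D w = (∑ j, Φ.toMultilinearMap.compLinearMap
    (fun m ↦ if m = j then D else LinearMap.id)) w := rfl
  rw [h, sum_apply]
  refine Finset.sum_congr rfl fun j _ ↦ congrArg Φ (funext fun m ↦ ?_)
  rcases eq_or_ne m j with rfl | h
  · simp
  · simp [h]

/-- A unitary family extends by one vector as long as it does not span. -/
theorem IsUnitaryFamily.exists_snoc [FiniteDimensional ℝ V]
    (hskew : ∀ u v, inner ℝ (J u) v = -inner ℝ u (J v)) {m : ℕ} {e : Fin m → V}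
    (he : IsUnitaryFamily J e) (hm : 2 * m < Module.finrank ℝ V) :
    ∃ v : V, IsUnitaryFamily J (Fin.snoc e v : Fin (m + 1) → V) := by
  let S := Submodule.span ℝ (Set.range (Sum.elim e fun a ↦ J (e a)))
  have hS : Module.finrank ℝ S < Module.finrank ℝ V := by
    refine (finrank_range_le_card _).trans_lt ?_
    simpa [two_mul] using hm
  have hne : Sᗮ ≠ ⊥ := by
    rw [Ne, Submodule.orthogonal_eq_bot_iff]
    rintro h
    rw [h, finrank_top] at hS
    exact lt_irrefl _ hS
  obtain ⟨u, hu, hu0⟩ := Submodule.exists_mem_ne_zero_of_ne_bot hne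
  have h1 : ∀ a, inner ℝ (e a) u = 0 := fun a ↦
    (Submodule.mem_orthogonal _ _).1 hu _ (Submodule.subset_span ⟨Sum.inl a, rfl⟩)
  have h2 : ∀ a, inner ℝ (J (e a)) u = 0 := fun a ↦
    (Submodule.mem_orthogonal _ _).1 hu _ (Submodule.subset_span ⟨Sum.inr a, rfl⟩)
  have hn := orthonormal_iff_ite.1 he.orthonormal
  refine ⟨‖u‖⁻¹ • u, ?_, ?_⟩
  · rw [orthonormal_iff_ite]
    intro a b
    refine Fin.lastCases ?_ (fun a ↦ ?_) a <;> refine Fin.lastCases ?_ (fun b ↦ ?_) b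
    · rw [Fin.snoc_last, real_inner_self_eq_norm_sq, norm_smul, norm_inv, norm_norm,
        inv_mul_cancel₀ (norm_ne_zero_iff.2 hu0)]
      simp
    · rw [real_inner_comm]
      simp [inner_smul_right, h1, Fin.ext_iff, b.2.ne']
    · simp [inner_smul_right, h1, Fin.ext_iff, a.2.ne]
    · simpa using hn a b
  · intro a b
    refine Fin.lastCases ?_ (fun a ↦ ?_) a <;> refine Fin.lastCases ?_ (fun b ↦ ?_) b
    · simp [inner_smul_left, inner_smul_right, inner_apply_self hskew]
    · simp only [Fin.snoc_last, Fin.snoc_castSucc, map_smul, inner_smul_left]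
      rw [hskew, real_inner_comm, h2]; simp
    · simp [inner_smul_right, h2]
    · simpa using he.isotropic a b

/-- A unitary family extends to a unitary basis. -/
theorem IsUnitaryFamily.exists_append [FiniteDimensional ℝ V]
    (hskew : ∀ u v, inner ℝ (J u) v = -inner ℝ u (J v)) {m : ℕ} {e : Fin m → V}
    (he : IsUnitaryFamily J e) (k : ℕ) (hk : 2 * (m + k) ≤ Module.finrank ℝ V) :
    ∃ η : Fin k → V, IsUnitaryFamily J (Fin.append e η) := by
  induction k with
  | zero => exact ⟨Fin.elim0, by simpa using! he⟩
  | succ k ih =>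
    obtain ⟨η, hη⟩ := ih (by omega)
    obtain ⟨v, hv⟩ := hη.exists_snoc hskew (by omega)
    exact ⟨Fin.snoc η v, by rw [Fin.append_snoc]; exact hv⟩

theorem IsUnitaryFamily.exists_basis [FiniteDimensional ℝ V]
    (hskew : ∀ u v, inner ℝ (J u) v = -inner ℝ u (J v)) (n : ℕ)
    (hn : 2 * n ≤ Module.finrank ℝ V) : ∃ e : Fin n → V, IsUnitaryFamily J e := by
  have h0 : IsUnitaryFamily J (Fin.elim0 : Fin 0 → V) :=
    ⟨⟨fun a ↦ a.elim0, fun a ↦ a.elim0⟩, fun a ↦ a.elim0⟩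
  obtain ⟨η, hη⟩ := h0.exists_append hskew n (by omega)
  refine ⟨η, ⟨?_, fun a b ↦ ?_⟩⟩
  · convert hη.orthonormal.comp (Fin.natAdd 0) (Fin.natAdd_injective _ _) using 1
    ext a; simp
  · simpa using hη.isotropic (Fin.natAdd 0 a) (Fin.natAdd 0 b)

/-- The product of two forms of type `(l, 0)` depends on an orthonormal family only through its
span; on another family with the same span it is multiplied by the Gram determinant. -/
theorem map_mul_map_eq_gram_det [Fintype ι] [DecidableEq ι] (hJJ : ∀ v, J (J v) = -v)
    (Φ Φ' : V [⋀^ι]→ₗ[ℝ] ℂ)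
    (hΦ : ∀ v j, Φ (Function.update v j (J (v j))) = Complex.I * Φ v)
    (hΦ' : ∀ v j, Φ' (Function.update v j (J (v j))) = Complex.I * Φ' v)
    {e : ι → V} (he : Orthonormal ℝ e) (f : ι → V)
    (hf : ∀ a, f a ∈ Submodule.span ℝ (Set.range e)) :
    Φ f * Φ' f = (Matrix.of fun a b ↦ (inner ℝ (f a) (f b) : ℂ)).det * (Φ e * Φ' e) := by
  have hexp : ∀ a, ∑ b, inner ℝ (f a) (e b) • e b = f a := by
    intro a
    obtain ⟨c, hc⟩ := (Submodule.mem_span_range_iff_exists_fun ℝ).1 (hf a)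
    rw [← hc]
    refine Finset.sum_congr rfl fun b _ ↦ ?_
    rw [real_inner_comm, he.inner_right_fintype]
  let z : Matrix ι ι ℂ := Matrix.of fun a b ↦ (inner ℝ (f a) (e b) : ℂ)
  have hz : (fun a ↦ ∑ b, complexSMul J (z a b) (e b)) = f := by
    ext a
    simp [z, complexSMul, hexp]
  have hG : (Matrix.of fun a b ↦ (inner ℝ (f a) (f b) : ℂ)) = z * z.transpose := by
    ext a b
    simp only [z, Matrix.of_apply, Matrix.mul_apply, Matrix.transpose_apply]
    conv_lhs => rw [← hexp b, inner_sum]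
    simp [inner_smul_right, mul_comm]
  have h1 := map_sum_complexSMul hJJ Φ hΦ e z
  have h2 := map_sum_complexSMul hJJ Φ' hΦ' e z
  rw [hz] at h1 h2
  rw [h1, h2, hG, Matrix.det_mul, Matrix.det_transpose]
  ring

end HermitianAlgebra

section KahlerAlgebra

variable {V : Type*} [NormedAddCommGroup V] [InnerProductSpace ℝ V]

/-- The covariant derivative of `J` vanishes as soon as `dω = 0` and the Nijenhuis tensor vanishes.
Here `A u v` stands for `(∇_u J) v`, and the last two hypotheses are the expressions of these two
conditions through a torsion-free connection. -/
theorem covariantDerivative_eq_zero_of_closed_of_integrable {J : V →L[ℝ] V}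
    (hJJ : ∀ v, J (J v) = -v) (hskew : ∀ u v, inner ℝ (J u) v = -inner ℝ u (J v))
    (A : V → V → V) (hAskew : ∀ u v w, inner ℝ (A u v) w = -inner ℝ v (A u w))
    (hAJ : ∀ u v, A u (J v) = -J (A u v))
    (hclosed : ∀ u v w, inner ℝ (A u v) w + inner ℝ (A v w) u + inner ℝ (A w u) v = 0)
    (hint : ∀ v w, A (J v) w - A (J w) v + J (A w v) - J (A v w) = 0) (u v : V) : A u v = 0 := by
  let a : V → V → V → ℝ := fun u v w ↦ inner ℝ (A u v) w
  have anti : ∀ u v w, a u v w = -a u w v := fun u v w ↦ by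
    simp only [a]; rw [hAskew, real_inner_comm]
  have moveJ : ∀ u v w, a u (J v) w = a u v (J w) := fun u v w ↦ by
    simp only [a]; rw [hAJ, inner_neg_left, hskew, neg_neg]
  have negr : ∀ u v w, a u v (-w) = -a u v w := fun u v w ↦ by
    simp only [a]; rw [inner_neg_right]
  have hN : ∀ v w z, a (J v) w z + a v w (J z) = a (J w) v z + a w v (J z) := fun v w z ↦ by
    have h := congrArg (fun x ↦ inner ℝ x z) (hint v w)
    simp only [inner_add_left, inner_sub_left, inner_zero_left, hskew (A _ _)] at h
    simp only [a]; linarith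
  let b : V → V → V → ℝ := fun v w z ↦ a (J v) w z + a v w (J z)
  have bsymm : ∀ v w z, b v w z = b w v z := hN
  have banti : ∀ v w z, b v w z = -b v z w := fun v w z ↦ by
    simp only [b]
    rw [anti (J v) w z, anti v w (J z), moveJ]; ring
  -- a tensor symmetric in its first two and skew in its last two arguments vanishes
  have bzero : ∀ v w z, b v w z = 0 := fun v w z ↦ by
    linarith [bsymm v w z, banti w v z, bsymm w z v, banti z w v, bsymm z v w, banti v z w]
  have hb : ∀ v w z, a (J v) w z = -a v w (J z) := fun v w z ↦ by
    have := bzero v w z; simp only [b] at this; linarith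
  have key : ∀ u v w, a w u v = 0 := fun u v w ↦ by
    have h1 := hclosed u v w
    have h2 := hclosed (J u) (J v) w
    change a u v w + a v w u + a w u v = 0 at h1
    change a (J u) (J v) w + a (J v) w (J u) + a w (J u) (J v) = 0 at h2
    rw [hb, moveJ, hb, hJJ, moveJ, hJJ, negr, negr, hJJ, negr] at h2
    linarith
  exact inner_self_eq_zero (𝕜 := ℝ) |>.1 (key v (A u v) u)

end KahlerAlgebra

/-! ### Calculus on manifolds in the preferred charts -/

section Calculus

variable {F : Type*} [NormedAddCommGroup F] [NormedSpace ℝ F]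
  {M : Type*} [TopologicalSpace M] [ChartedSpace F M]
  {W W₁ W₂ W₃ : Type*} [NormedAddCommGroup W] [NormedSpace ℝ W] [NormedAddCommGroup W₁]
  [NormedSpace ℝ W₁] [NormedAddCommGroup W₂] [NormedSpace ℝ W₂] [NormedAddCommGroup W₃]
  [NormedSpace ℝ W₃] {y : M}

/-- The derivative at `y` of a vector-valued function on a manifold, as a linear map on the model
space, which is the tangent space at `y` read in the preferred chart at `y`. -/
def chartDeriv (f : M → W) (y : M) : F →L[ℝ] W := mvfderiv 𝓘(ℝ, F) f y

theorem MDifferentiableAt.hasFDerivAt_comp_extChartAt_symm {f : M → W}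
    (hf : MDifferentiableAt 𝓘(ℝ, F) 𝓘(ℝ, W) f y) :
    HasFDerivAt (f ∘ (extChartAt 𝓘(ℝ, F) y).symm) (chartDeriv (F := F) f y)
      (extChartAt 𝓘(ℝ, F) y y) := by
  have h : HasFDerivWithinAt (f ∘ (extChartAt 𝓘(ℝ, F) y).symm)
      (chartDeriv (F := F) f y) (Set.range 𝓘(ℝ, F)) (extChartAt 𝓘(ℝ, F) y y) :=
    hf.hasMFDerivAt.2
  rwa [ModelWithCorners.Boundaryless.range_eq_univ, hasFDerivWithinAt_univ] at h

theorem HasFDerivAt.mdifferentiableAt_and_chartDeriv {f : M → W} {f' : F →L[ℝ] W}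
    (hf : HasFDerivAt (f ∘ (extChartAt 𝓘(ℝ, F) y).symm) f' (extChartAt 𝓘(ℝ, F) y y)) :
    MDifferentiableAt 𝓘(ℝ, F) 𝓘(ℝ, W) f y ∧ ∀ v : F, chartDeriv (F := F) f y v = f' v := by
  have hc : ContinuousAt f y := by
    have h1 : ContinuousAt ((f ∘ (extChartAt 𝓘(ℝ, F) y).symm) ∘ extChartAt 𝓘(ℝ, F) y) y :=
      hf.continuousAt.comp (continuousAt_extChartAt y)
    refine h1.congr ?_
    filter_upwards [extChartAt_source_mem_nhds (I := 𝓘(ℝ, F)) y] with p hp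
    exact congrArg f ((extChartAt 𝓘(ℝ, F) y).left_inv hp)
  have h : HasMFDerivAt 𝓘(ℝ, F) 𝓘(ℝ, W) f y f' := by
    exact ⟨hc, hf.hasFDerivWithinAt⟩
  refine ⟨h.mdifferentiableAt, fun v ↦ ?_⟩
  have := h.mfderiv
  simp only [chartDeriv, mvfderiv, this]
  rfl

theorem chartDeriv_congr {f g : M → W} (h : f =ᶠ[nhds y] g) :
    chartDeriv (F := F) f y = chartDeriv (F := F) g y := by
  have h1 := h.mfderiv_eq (I := 𝓘(ℝ, F)) (I' := 𝓘(ℝ, W))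
  ext v
  exact congrArg (fun L : F →L[ℝ] W ↦ L v) h1

theorem chartDeriv_const (c : W) (y : M) : chartDeriv (F := F) (fun _ ↦ c) y = 0 :=
  mvfderiv_const c

theorem chartDeriv_eq_zero_of_eventually_eq {f : M → W} {c : W} (h : ∀ᶠ p in nhds y, f p = c) :
    chartDeriv (F := F) f y = 0 := by
  rw [chartDeriv_congr (g := fun _ ↦ c) h, chartDeriv_const]

theorem mdifferentiableAt_clm_apply {L : M → W →L[ℝ] W₁} {s : M → W}
    (hL : MDifferentiableAt 𝓘(ℝ, F) 𝓘(ℝ, W →L[ℝ] W₁) L y)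
    (hs : MDifferentiableAt 𝓘(ℝ, F) 𝓘(ℝ, W) s y) :
    MDifferentiableAt 𝓘(ℝ, F) 𝓘(ℝ, W₁) (fun p ↦ L p (s p)) y ∧
    ∀ v : F, chartDeriv (F := F) (fun p ↦ L p (s p)) y v
      = chartDeriv (F := F) L y v (s y) + L y (chartDeriv (F := F) s y v) := by
  have h := (hL.hasFDerivAt_comp_extChartAt_symm.clm_apply
    hs.hasFDerivAt_comp_extChartAt_symm).mdifferentiableAt_and_chartDeriv
    (f := fun p ↦ L p (s p))
  refine ⟨h.1, fun v ↦ (h.2 v).trans ?_⟩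
  simp [add_comm]

theorem mdifferentiableAt_clm_apply₂ {B : M → W →L[ℝ] W₁ →L[ℝ] W₂} {s : M → W} {t : M → W₁}
    (hB : MDifferentiableAt 𝓘(ℝ, F) 𝓘(ℝ, W →L[ℝ] W₁ →L[ℝ] W₂) B y)
    (hs : MDifferentiableAt 𝓘(ℝ, F) 𝓘(ℝ, W) s y) (ht : MDifferentiableAt 𝓘(ℝ, F) 𝓘(ℝ, W₁) t y) :
    MDifferentiableAt 𝓘(ℝ, F) 𝓘(ℝ, W₂) (fun p ↦ B p (s p) (t p)) y ∧
    ∀ v : F, chartDeriv (F := F) (fun p ↦ B p (s p) (t p)) y v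
      = chartDeriv (F := F) B y v (s y) (t y) + B y (chartDeriv (F := F) s y v) (t y)
        + B y (s y) (chartDeriv (F := F) t y v) := by
  have h1 := mdifferentiableAt_clm_apply hB hs
  have h2 := mdifferentiableAt_clm_apply h1.1 ht
  refine ⟨h2.1, fun v ↦ ?_⟩
  rw [h2.2, h1.2]
  simp

theorem mdifferentiableAt_alternating_apply {ι : Type*} [Fintype ι] [DecidableEq ι]
    {Ω : M → W [⋀^ι]→L[ℝ] W₁} {s : ι → M → W}
    (hΩ : MDifferentiableAt 𝓘(ℝ, F) 𝓘(ℝ, W [⋀^ι]→L[ℝ] W₁) Ω y)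
    (hs : ∀ j, MDifferentiableAt 𝓘(ℝ, F) 𝓘(ℝ, W) (s j) y) :
    MDifferentiableAt 𝓘(ℝ, F) 𝓘(ℝ, W₁) (fun p ↦ Ω p (fun j ↦ s j p)) y ∧
    ∀ v : F, chartDeriv (F := F) (fun p ↦ Ω p (fun j ↦ s j p)) y v
      = chartDeriv (F := F) Ω y v (fun j ↦ s j y)
        + ∑ j, Ω y (Function.update (fun j ↦ s j y) j (chartDeriv (F := F) (s j) y v)) := by
  have h := (hΩ.hasFDerivAt_comp_extChartAt_symm.continuousAlternatingMap_apply (fun j ↦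
    (hs j).hasFDerivAt_comp_extChartAt_symm)).mdifferentiableAt_and_chartDeriv
    (f := fun p ↦ Ω p (fun j ↦ s j p))
  refine ⟨h.1, fun v ↦ (h.2 v).trans ?_⟩
  rw [add_apply, sum_apply]
  have hy : (extChartAt 𝓘(ℝ, F) y).symm (extChartAt 𝓘(ℝ, F) y y) = y := extChartAt_to_inv y
  simp only [ContinuousLinearMap.comp_apply, Function.comp_apply, hy]
  rfl

theorem mdifferentiableAt_mul {A : Type*} [NormedRing A] [NormedAlgebra ℝ A] {f g : M → A}
    (hf : MDifferentiableAt 𝓘(ℝ, F) 𝓘(ℝ, A) f y) (hg : MDifferentiableAt 𝓘(ℝ, F) 𝓘(ℝ, A) g y) :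
    MDifferentiableAt 𝓘(ℝ, F) 𝓘(ℝ, A) (fun p ↦ f p * g p) y ∧
    ∀ v : F, chartDeriv (F := F) (fun p ↦ f p * g p) y v
      = f y * chartDeriv (F := F) g y v + chartDeriv (F := F) f y v * g y := by
  have h := (hf.hasFDerivAt_comp_extChartAt_symm.mul'
    hg.hasFDerivAt_comp_extChartAt_symm).mdifferentiableAt_and_chartDeriv (f := fun p ↦ f p * g p)
  refine ⟨h.1, fun v ↦ (h.2 v).trans ?_⟩
  simp

theorem mdifferentiableAt_clm_comp (L : W →L[ℝ] W₁) {s : M → W}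
    (hs : MDifferentiableAt 𝓘(ℝ, F) 𝓘(ℝ, W) s y) :
    MDifferentiableAt 𝓘(ℝ, F) 𝓘(ℝ, W₁) (fun p ↦ L (s p)) y ∧
    ∀ v : F, chartDeriv (F := F) (fun p ↦ L (s p)) y v = L (chartDeriv (F := F) s y v) := by
  have h := (L.hasFDerivAt.comp _
    hs.hasFDerivAt_comp_extChartAt_symm).mdifferentiableAt_and_chartDeriv (f := fun p ↦ L (s p))
  exact ⟨h.1, fun v ↦ (h.2 v).trans rfl⟩

theorem mdifferentiableAt_sum {ι : Type*} (u : Finset ι) {f : ι → M → W}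
    (hf : ∀ j ∈ u, MDifferentiableAt 𝓘(ℝ, F) 𝓘(ℝ, W) (f j) y) :
    MDifferentiableAt 𝓘(ℝ, F) 𝓘(ℝ, W) (fun p ↦ ∑ j ∈ u, f j p) y := by
  have h := HasFDerivAt.fun_sum (u := u) fun j hj ↦ (hf j hj).hasFDerivAt_comp_extChartAt_symm
  exact (HasFDerivAt.mdifferentiableAt_and_chartDeriv (f := fun p ↦ ∑ j ∈ u, f j p) h).1

/-- A family of linear maps on a finite-dimensional space is differentiable as soon as its values
at each vector are. -/
theorem mdifferentiableAt_clm_of_forall_apply [FiniteDimensional ℝ W] {L : M → W →L[ℝ] W₁}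
    (hL : ∀ w, MDifferentiableAt 𝓘(ℝ, F) 𝓘(ℝ, W₁) (fun p ↦ L p w) y) :
    MDifferentiableAt 𝓘(ℝ, F) 𝓘(ℝ, W →L[ℝ] W₁) L y := by
  let b := Module.finBasis ℝ W
  have h : L = fun p ↦ ∑ j, ContinuousLinearMap.smulRightL ℝ W W₁ (b.coord j).toContinuousLinearMap
      (L p (b j)) := by
    ext p w
    conv_lhs => rw [← b.sum_repr w, map_sum]
    simp
  rw [h]
  exact mdifferentiableAt_sum _ fun j _ ↦ (mdifferentiableAt_clm_comp _ (hL (b j))).1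

/-- The derivative of the determinant at the identity is the trace. -/
theorem mdifferentiableAt_det {n : ℕ} {G : Fin n → Fin n → M → ℂ}
    (hG : ∀ a b, MDifferentiableAt 𝓘(ℝ, F) 𝓘(ℝ, ℂ) (G a b) y)
    (h1 : ∀ a b, G a b y = if a = b then 1 else 0) :
    MDifferentiableAt 𝓘(ℝ, F) 𝓘(ℝ, ℂ) (fun p ↦ (Matrix.of fun a b ↦ G a b p).det) y ∧
    ∀ v : F, chartDeriv (F := F) (fun p ↦ (Matrix.of fun a b ↦ G a b p).det) y v
      = ∑ a, chartDeriv (F := F) (G a a) y v := by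
  let D : (Fin n → ℂ) [⋀^Fin n]→L[ℝ] ℂ :=
    { (Matrix.detRowAlternating (n := Fin n) (R := ℂ)).toMultilinearMap.restrictScalars ℝ with
      map_eq_zero_of_eq' := (Matrix.detRowAlternating (n := Fin n) (R := ℂ)).map_eq_zero_of_eq'
      cont := by
        change Continuous fun m : Matrix (Fin n) (Fin n) ℂ ↦ m.det
        exact Continuous.matrix_det continuous_id }
  have hrow : ∀ a, HasFDerivAt (fun z ↦ fun b ↦ G a b ((extChartAt 𝓘(ℝ, F) y).symm z))
      (ContinuousLinearMap.pi fun b ↦ chartDeriv (F := F) (G a b) y)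
      (extChartAt 𝓘(ℝ, F) y y) := fun a ↦
    hasFDerivAt_pi.2 fun b ↦ (hG a b).hasFDerivAt_comp_extChartAt_symm
  have h0 := (hasFDerivAt_const D (extChartAt 𝓘(ℝ, F) y y)).continuousAlternatingMap_apply hrow
  have h := HasFDerivAt.mdifferentiableAt_and_chartDeriv
    (f := fun p ↦ (Matrix.of fun a b ↦ G a b p).det) h0
  refine ⟨h.1, fun v ↦ (h.2 v).trans ?_⟩
  rw [add_apply, sum_apply]
  have hy : (extChartAt 𝓘(ℝ, F) y).symm (extChartAt 𝓘(ℝ, F) y y) = y := extChartAt_to_inv y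
  simp only [ContinuousLinearMap.comp_apply, hy, zero_apply, map_zero, zero_add]
  refine Finset.sum_congr rfl fun a _ ↦ ?_
  change (Matrix.updateRow (Matrix.of fun a b ↦ G a b y) a
    (fun b ↦ chartDeriv (F := F) (G a b) y v)).det = _
  have hone : (Matrix.of fun a b ↦ G a b y) = (1 : Matrix (Fin n) (Fin n) ℂ) := by
    ext a b
    simp [h1, Matrix.one_apply]
  rw [hone, ← Matrix.cramer_transpose_apply]
  simp

theorem mdifferentiableAt_inv {A : Type*} [NormedField A]
    [NormedAlgebra ℝ A] {f : M → A} (hf : MDifferentiableAt 𝓘(ℝ, F) 𝓘(ℝ, A) f y) (h0 : f y ≠ 0) :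
    MDifferentiableAt 𝓘(ℝ, F) 𝓘(ℝ, A) (fun p ↦ (f p)⁻¹) y ∧
    ∀ v : F, chartDeriv (F := F) (fun p ↦ (f p)⁻¹) y v
      = -((f y)⁻¹ * chartDeriv (F := F) f y v * (f y)⁻¹) := by
  have hy : (extChartAt 𝓘(ℝ, F) y).symm (extChartAt 𝓘(ℝ, F) y y) = y := extChartAt_to_inv y
  have h1 : HasFDerivAt (Inv.inv : A → A) (-ContinuousLinearMap.mulLeftRight ℝ A (f y)⁻¹ (f y)⁻¹)
      ((f ∘ (extChartAt 𝓘(ℝ, F) y).symm) (extChartAt 𝓘(ℝ, F) y y)) := by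
    rw [Function.comp_apply, hy]
    exact hasFDerivAt_inv' h0
  have h := (h1.comp _ hf.hasFDerivAt_comp_extChartAt_symm).mdifferentiableAt_and_chartDeriv
    (f := fun p ↦ (f p)⁻¹)
  refine ⟨h.1, fun v ↦ (h.2 v).trans ?_⟩
  exact congrArg Neg.neg (ContinuousLinearMap.mulLeftRight_apply ℝ A _ _ _)

end Calculus

/-! ### Coordinates on the tangent bundle around a point -/

section Coordinates

variable {E : Type*} [NormedAddCommGroup E] [NormedSpace ℝ E]
  {X : Type*} [TopologicalSpace X] [ChartedSpace E X] [IsManifold 𝓘(ℝ, E) ∞ X]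

variable (E) in
/-- The preferred trivialization of the tangent bundle at `x₀`; it is the identity at `x₀`. -/
abbrev tangentTriv (x₀ : X) := trivializationAt E (TangentSpace 𝓘(ℝ, E) : X → Type _) x₀

variable (E) in
/-- The tangent space at `x` is the model space, by definition. Passing through this equivalence
keeps apart the two types, which carry different norms. -/
def toModel (x : X) : TangentSpace 𝓘(ℝ, E) x ≃L[ℝ] E := ContinuousLinearEquiv.refl ℝ E

theorem mvfderiv_eq_chartDeriv_toModel {W : Type*} [NormedAddCommGroup W] [NormedSpace ℝ W]
    (f : X → W) (x : X) (v : TangentSpace 𝓘(ℝ, E) x) :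
    mvfderiv 𝓘(ℝ, E) f x v = chartDeriv f x (toModel E x v) := rfl

theorem tangentTriv_self (x₀ : X) (v : TangentSpace 𝓘(ℝ, E) x₀) :
    (tangentTriv E x₀ ⟨x₀, v⟩).2 = toModel E x₀ v :=
  tangentCoordChange_self (I := 𝓘(ℝ, E)) (mem_extChartAt_source x₀)

theorem tangentTriv_symm_self (x₀ : X) (u : E) :
    (tangentTriv E x₀).symm x₀ u = (toModel E x₀).symm u := by
  have h := (tangentTriv E x₀).symm_apply_apply_mk (FiberBundle.mem_baseSet_trivializationAt' x₀)
    ((toModel E x₀).symm u)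
  rw [tangentTriv_self] at h
  simpa using h

variable (E) in
/-- The vector field which has the constant coefficients `u` in the trivialization at `x₀`. Outside
the base set of this trivialization its values are meaningless. -/
def constField (x₀ : X) (u : E) (x : X) : TangentSpace 𝓘(ℝ, E) x :=
  (tangentTriv E x₀).symm x u

variable (E) in
/-- The coefficients of a tangent vector at `x` in the trivialization at `x₀`. -/
def coord (x₀ x : X) : TangentSpace 𝓘(ℝ, E) x →L[ℝ] E :=
  (tangentTriv E x₀).continuousLinearMapAt ℝ x

theorem extend_eq_constField (x₀ : X) (u : TangentSpace 𝓘(ℝ, E) x₀) :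
    FiberBundle.extend E u = constField E x₀ (toModel E x₀ u) := by
  ext x
  simp only [FiberBundle.extend]
  rw [tangentTriv_self]
  rfl

theorem mdifferentiableAt_constField (x₀ : X) (u : E) :
    MDiffAt (T% (constField E x₀ u)) x₀ := by
  have := FiberBundle.mdifferentiableAt_extend 𝓘(ℝ, E) E
    (V := (TangentSpace 𝓘(ℝ, E) : X → Type _)) (x := x₀) ((toModel E x₀).symm u)
  rwa [extend_eq_constField, ContinuousLinearEquiv.apply_symm_apply] at this

theorem mem_baseSet_self (x₀ : X) : x₀ ∈ (tangentTriv E x₀).baseSet :=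
  FiberBundle.mem_baseSet_trivializationAt' x₀

theorem eventually_mem_baseSet (x₀ : X) : ∀ᶠ x in nhds x₀, x ∈ (tangentTriv E x₀).baseSet :=
  (tangentTriv E x₀).open_baseSet.mem_nhds (mem_baseSet_self (E := E) x₀)

theorem coord_apply {x₀ x : X} (hx : x ∈ (tangentTriv E x₀).baseSet) (v : TangentSpace 𝓘(ℝ, E) x) :
    coord E x₀ x v = (tangentTriv E x₀ ⟨x, v⟩).2 := by
  simp [coord, (tangentTriv E x₀).coe_linearMapAt_of_mem hx]

theorem constField_eq_symmL {x₀ x : X} (hx : x ∈ (tangentTriv E x₀).baseSet) (u : E) :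
    constField E x₀ u x = (tangentTriv E x₀).symmL ℝ x u :=
  ((tangentTriv E x₀).symmL_apply hx u).symm

theorem coord_constField {x₀ x : X} (hx : x ∈ (tangentTriv E x₀).baseSet) (u : E) :
    coord E x₀ x (constField E x₀ u x) = u := by
  rw [constField_eq_symmL hx]
  exact (tangentTriv E x₀).continuousLinearMapAt_symmL hx u

theorem constField_coord {x₀ x : X} (hx : x ∈ (tangentTriv E x₀).baseSet)
    (v : TangentSpace 𝓘(ℝ, E) x) : constField E x₀ (coord E x₀ x v) x = v := by
  rw [constField_eq_symmL hx]
  exact (tangentTriv E x₀).symmL_continuousLinearMapAt hx v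

theorem coord_self (x₀ : X) (v : TangentSpace 𝓘(ℝ, E) x₀) : coord E x₀ x₀ v = toModel E x₀ v := by
  rw [coord_apply (mem_baseSet_self (E := E) x₀), tangentTriv_self]

theorem constField_self (x₀ : X) (u : E) : constField E x₀ u x₀ = (toModel E x₀).symm u := by
  rw [← constField_coord (mem_baseSet_self (E := E) x₀) ((toModel E x₀).symm u), coord_self,
    ContinuousLinearEquiv.apply_symm_apply]

theorem mdifferentiableAt_coord {x₀ : X} {V : Π x : X, TangentSpace 𝓘(ℝ, E) x}
    (hV : MDiffAt (T% V) x₀) :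
    MDifferentiableAt 𝓘(ℝ, E) 𝓘(ℝ, E) (fun x ↦ coord E x₀ x (V x)) x₀ := by
  refine ((mdifferentiableAt_section 𝓘(ℝ, E) _).1 hV).congr_of_eventuallyEq ?_
  filter_upwards [eventually_mem_baseSet (E := E) x₀] with x hx
  rw [coord_apply hx]

/-- The Lie bracket in coordinates. The fields are pulled back along the chart at `x₀`, whose
derivative is the trivialization at `x₀`. -/
theorem mlieBracket_eq (x₀ : X) (V W : Π x : X, TangentSpace 𝓘(ℝ, E) x)
    (hV : MDiffAt (T% V) x₀) (hW : MDiffAt (T% W) x₀) :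
    toModel E x₀ (VectorField.mlieBracket 𝓘(ℝ, E) V W x₀)
      = chartDeriv (fun x ↦ coord E x₀ x (W x)) x₀ (toModel E x₀ (V x₀))
        - chartDeriv (fun x ↦ coord E x₀ x (V x)) x₀ (toModel E x₀ (W x₀)) := by
  have : IsManifold 𝓘(ℝ, E) 1 X := .of_le (n := ∞) (by simp)
  have key : ∀ V : Π x : X, TangentSpace 𝓘(ℝ, E) x,
      (VectorField.mpullbackWithin 𝓘(ℝ, E) 𝓘(ℝ, E) (extChartAt 𝓘(ℝ, E) x₀).symm V
        (Set.range 𝓘(ℝ, E)))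
      =ᶠ[nhds (extChartAt 𝓘(ℝ, E) x₀ x₀)]
        (fun x ↦ coord E x₀ x (V x)) ∘ (extChartAt 𝓘(ℝ, E) x₀).symm := by
    intro V
    filter_upwards [extChartAt_target_mem_nhds (I := 𝓘(ℝ, E)) x₀] with z hz
    have hx : (extChartAt 𝓘(ℝ, E) x₀).symm z ∈ (chartAt E x₀).source := by
      simpa using (extChartAt 𝓘(ℝ, E) x₀).map_target hz
    have h := TangentBundle.symmL_trivializationAt (I := 𝓘(ℝ, E)) hx
    rw [(extChartAt 𝓘(ℝ, E) x₀).right_inv hz] at h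
    rw [VectorField.mpullbackWithin_apply]
    refine (congrArg (fun L : E →L[ℝ] TangentSpace 𝓘(ℝ, E) ((extChartAt 𝓘(ℝ, E) x₀).symm z) ↦
      L.inverse (V ((extChartAt 𝓘(ℝ, E) x₀).symm z))) h.symm).trans ?_
    have h2 : (tangentTriv E x₀).symmL ℝ ((extChartAt 𝓘(ℝ, E) x₀).symm z)
        = ((tangentTriv E x₀).continuousLinearEquivAt ℝ _ hx).symm := by
      ext u
      exact (congrFun (Bundle.Trivialization.symm_continuousLinearEquivAt_eq (R := ℝ)
        (tangentTriv E x₀) hx) u).symm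
    rw [h2, ContinuousLinearMap.inverse_equiv]
    exact congrFun (Bundle.Trivialization.coe_continuousLinearEquivAt_eq (R := ℝ)
      (tangentTriv E x₀) hx) _
  have hinv : mfderiv 𝓘(ℝ, E) 𝓘(ℝ, E) (extChartAt 𝓘(ℝ, E) x₀) x₀
      = (toModel E x₀ : _ →L[ℝ] E) := by
    rw [← TangentBundle.continuousLinearMapAt_trivializationAt (mem_chart_source E x₀)]
    ext v
    exact coord_self x₀ v
  have h1 : VectorField.mlieBracket 𝓘(ℝ, E) V W x₀
      = (toModel E x₀).symm (VectorField.lieBracketWithin ℝ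
        (VectorField.mpullbackWithin 𝓘(ℝ, E) 𝓘(ℝ, E) (extChartAt 𝓘(ℝ, E) x₀).symm V
          (Set.range 𝓘(ℝ, E)))
        (VectorField.mpullbackWithin 𝓘(ℝ, E) 𝓘(ℝ, E) (extChartAt 𝓘(ℝ, E) x₀).symm W
          (Set.range 𝓘(ℝ, E)))
        ((extChartAt 𝓘(ℝ, E) x₀).symm ⁻¹' Set.univ ∩ Set.range 𝓘(ℝ, E))
        (extChartAt 𝓘(ℝ, E) x₀ x₀)) := by
    rw [← VectorField.mlieBracketWithin_univ, VectorField.mlieBracketWithin_apply, hinv]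
    exact congrArg (fun L : E →L[ℝ] TangentSpace 𝓘(ℝ, E) x₀ ↦ L _)
      (ContinuousLinearMap.inverse_equiv (toModel E x₀))
  rw [h1, ContinuousLinearEquiv.apply_symm_apply,
    Filter.EventuallyEq.lieBracketWithin_vectorField_eq_nhds (key V) (key W),
    Set.preimage_univ, Set.univ_inter, ModelWithCorners.Boundaryless.range_eq_univ,
    VectorField.lieBracketWithin_univ, VectorField.lieBracket_eq]
  have hy : (extChartAt 𝓘(ℝ, E) x₀).symm (extChartAt 𝓘(ℝ, E) x₀ x₀) = x₀ := extChartAt_to_inv x₀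
  have hval : ∀ V : Π x : X, TangentSpace 𝓘(ℝ, E) x,
      coord E x₀ ((extChartAt 𝓘(ℝ, E) x₀).symm (extChartAt 𝓘(ℝ, E) x₀ x₀))
        (V ((extChartAt 𝓘(ℝ, E) x₀).symm (extChartAt 𝓘(ℝ, E) x₀ x₀))) = toModel E x₀ (V x₀) :=
    fun V ↦ (congrArg (fun x ↦ coord E x₀ x (V x)) hy).trans (coord_self x₀ (V x₀))
  simp only [Function.comp_apply, hval]
  rw [(mdifferentiableAt_coord hV).hasFDerivAt_comp_extChartAt_symm.fderiv,
    (mdifferentiableAt_coord hW).hasFDerivAt_comp_extChartAt_symm.fderiv]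

end Coordinates

/-! ### The Levi-Civita connection in coordinates -/

section LeviCivita

variable {E : Type*} [NormedAddCommGroup E] [NormedSpace ℝ E]
  {X : Type*} [TopologicalSpace X] [ChartedSpace E X] [IsManifold 𝓘(ℝ, E) ∞ X]
  [Bundle.RiemannianBundle (fun x : X ↦ TangentSpace 𝓘(ℝ, E) x)]

variable (E) in
/-- The coefficients of the metric in the coordinates around `x₀`. -/
def metricHat (x₀ x : X) : E →L[ℝ] E →L[ℝ] ℝ :=
  (innerSL ℝ).bilinearComp ((tangentTriv E x₀).symmL ℝ x) ((tangentTriv E x₀).symmL ℝ x)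

theorem metricHat_apply {x₀ x : X} (hx : x ∈ (tangentTriv E x₀).baseSet) (u v : E) :
    metricHat E x₀ x u v = inner ℝ (constField E x₀ u x) (constField E x₀ v x) := by
  rw [constField_eq_symmL hx, constField_eq_symmL hx]
  rfl

theorem metricHat_coord {x₀ x : X} (hx : x ∈ (tangentTriv E x₀).baseSet)
    (v w : TangentSpace 𝓘(ℝ, E) x) :
    metricHat E x₀ x (coord E x₀ x v) (coord E x₀ x w) = inner ℝ v w := by
  rw [metricHat_apply hx, constField_coord hx, constField_coord hx]

theorem metricHat_self (x₀ : X) (v w : TangentSpace 𝓘(ℝ, E) x₀) :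
    metricHat E x₀ x₀ (toModel E x₀ v) (toModel E x₀ w) = inner ℝ v w := by
  rw [← coord_self, ← coord_self, metricHat_coord (mem_baseSet_self x₀)]

theorem chartDeriv_coord_constField (x₀ : X) (u : E) :
    chartDeriv (F := E) (fun x ↦ coord E x₀ x (constField E x₀ u x)) x₀ = 0 :=
  chartDeriv_eq_zero_of_eventually_eq (c := u)
    ((eventually_mem_baseSet x₀).mono fun _ hx ↦ coord_constField hx u)

theorem mlieBracket_constField (x₀ : X) (u v : E) :
    VectorField.mlieBracket 𝓘(ℝ, E) (constField E x₀ u) (constField E x₀ v) x₀ = 0 := by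
  apply (toModel E x₀).injective
  rw [mlieBracket_eq _ _ _ (mdifferentiableAt_constField _ _) (mdifferentiableAt_constField _ _),
    chartDeriv_coord_constField, chartDeriv_coord_constField]
  simp

variable [FiniteDimensional ℝ E]
  [IsContMDiffRiemannianBundle 𝓘(ℝ, E) ∞ E (fun x : X ↦ TangentSpace 𝓘(ℝ, E) x)]

theorem mdifferentiableAt_metricHat (x₀ : X) :
    MDifferentiableAt 𝓘(ℝ, E) 𝓘(ℝ, E →L[ℝ] E →L[ℝ] ℝ) (metricHat E x₀) x₀ := by
  refine mdifferentiableAt_clm_of_forall_apply fun u ↦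
    mdifferentiableAt_clm_of_forall_apply fun v ↦ ?_
  have h := MDifferentiableAt.inner_bundle (IB := 𝓘(ℝ, E)) (F := E) (b := id)
    (E := fun x : X ↦ TangentSpace 𝓘(ℝ, E) x) (mdifferentiableAt_constField (E := E) x₀ u)
    (mdifferentiableAt_constField (E := E) x₀ v)
  refine h.congr_of_eventuallyEq ?_
  filter_upwards [eventually_mem_baseSet (E := E) x₀] with x hx
  exact metricHat_apply hx u v

/-- The derivative of the metric coefficients. -/
def metricDeriv (x₀ : X) (u v w : TangentSpace 𝓘(ℝ, E) x₀) : ℝ :=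
  chartDeriv (F := E) (metricHat E x₀) x₀ (toModel E x₀ u) (toModel E x₀ v) (toModel E x₀ w)

theorem mvfderiv_inner_constField (x₀ : X) (u v w : TangentSpace 𝓘(ℝ, E) x₀) :
    mvfderiv 𝓘(ℝ, E) (fun p ↦ inner ℝ (constField E x₀ (toModel E x₀ v) p)
      (constField E x₀ (toModel E x₀ w) p)) x₀ u = metricDeriv x₀ u v w := by
  rw [mvfderiv_eq_chartDeriv_toModel, chartDeriv_congr
    (g := fun x ↦ metricHat E x₀ x (toModel E x₀ v) (toModel E x₀ w))]
  · rw [(mdifferentiableAt_clm_apply₂ (mdifferentiableAt_metricHat x₀) mdifferentiableAt_const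
      mdifferentiableAt_const).2]
    simp [metricDeriv, chartDeriv_const]
  · filter_upwards [eventually_mem_baseSet (E := E) x₀] with x hx
    exact (metricHat_apply hx _ _).symm

theorem metricDeriv_comm (x₀ : X) (u v w : TangentSpace 𝓘(ℝ, E) x₀) :
    metricDeriv x₀ u v w = metricDeriv x₀ u w v := by
  rw [← mvfderiv_inner_constField, ← mvfderiv_inner_constField]
  congr 2
  ext p
  exact real_inner_comm _ _

theorem koszul_extend (x₀ : X) (u v w : TangentSpace 𝓘(ℝ, E) x₀) :
    koszul (FiberBundle.extend E u) (FiberBundle.extend E v) (FiberBundle.extend E w) x₀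
      = (metricDeriv x₀ u v w + metricDeriv x₀ v w u - metricDeriv x₀ w u v) / 2 := by
  simp only [koszul, FiberBundle.extend_apply_self]
  simp only [extend_eq_constField, mlieBracket_constField, mvfderiv_inner_constField,
    inner_zero_left, sub_zero, add_zero]

set_option synthInstance.maxHeartbeats 400000 in
theorem inner_leviCivita_extend (x₀ : X) (u v w : TangentSpace 𝓘(ℝ, E) x₀) :
    inner ℝ (leviCivita (FiberBundle.extend E v) x₀ u) w
      = (metricDeriv x₀ u v w + metricDeriv x₀ v w u - metricDeriv x₀ w u v) / 2 := by
  let b := stdOrthonormalBasis ℝ (TangentSpace 𝓘(ℝ, E) x₀)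
  have hw : w = ∑ j, inner ℝ (b j) w • b j := (b.sum_repr' w).symm
  have h1 : inner ℝ (leviCivita (FiberBundle.extend E v) x₀ u) w
      = ∑ j, inner ℝ (b j) w *
        ((metricDeriv x₀ u v (b j) + metricDeriv x₀ v (b j) u - metricDeriv x₀ (b j) u v) / 2) := by
    simp only [leviCivita, sum_inner, inner_smul_left, koszul_extend]
    exact Finset.sum_congr rfl fun j _ ↦ by simp [b, mul_comm]
  rw [h1]
  conv_rhs => rw [hw]
  simp only [metricDeriv, map_sum, map_smul, sum_apply, smul_apply, smul_eq_mul]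
  rw [← Finset.sum_add_distrib, ← Finset.sum_sub_distrib, Finset.sum_div]
  exact Finset.sum_congr rfl fun j _ ↦ by ring

set_option synthInstance.maxHeartbeats 400000 in
/-- The Christoffel symbols at `x₀` in the coordinates around `x₀`: `christoffel x₀ u v` is the
Levi-Civita derivative along `u` of the field with constant coefficients extending `v`. -/
def christoffel (x₀ : X) : TangentSpace 𝓘(ℝ, E) x₀ →ₗ[ℝ] TangentSpace 𝓘(ℝ, E) x₀ →ₗ[ℝ]
    TangentSpace 𝓘(ℝ, E) x₀ :=
  LinearMap.mk₂ ℝ (fun u v ↦ leviCivita (FiberBundle.extend E v) x₀ u)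
    (fun u u' v ↦ by
      refine ext_inner_right ℝ fun w ↦ ?_
      simp only [inner_add_left, inner_leviCivita_extend, metricDeriv, map_add, add_apply]
      ring)
    (fun c u v ↦ by
      refine ext_inner_right ℝ fun w ↦ ?_
      simp only [inner_smul_left, inner_leviCivita_extend, metricDeriv, map_smul, smul_apply]
      simp
      ring)
    (fun u v v' ↦ by
      refine ext_inner_right ℝ fun w ↦ ?_
      simp only [inner_add_left, inner_leviCivita_extend, metricDeriv, map_add, add_apply]
      ring)
    (fun c u v ↦ by
      refine ext_inner_right ℝ fun w ↦ ?_
      simp only [inner_smul_left, inner_leviCivita_extend, metricDeriv, map_smul, smul_apply]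
      simp
      ring)

theorem christoffel_apply (x₀ : X) (u v : TangentSpace 𝓘(ℝ, E) x₀) :
    christoffel x₀ u v = leviCivita (FiberBundle.extend E v) x₀ u := rfl

theorem inner_christoffel (x₀ : X) (u v w : TangentSpace 𝓘(ℝ, E) x₀) :
    inner ℝ (christoffel x₀ u v) w
      = (metricDeriv x₀ u v w + metricDeriv x₀ v w u - metricDeriv x₀ w u v) / 2 :=
  inner_leviCivita_extend x₀ u v w

/-- The Levi-Civita connection is torsion-free. -/
theorem christoffel_comm (x₀ : X) (u v : TangentSpace 𝓘(ℝ, E) x₀) :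
    christoffel x₀ u v = christoffel x₀ v u := by
  refine ext_inner_right ℝ fun w ↦ ?_
  rw [inner_christoffel, inner_christoffel, metricDeriv_comm x₀ u v w, metricDeriv_comm x₀ v w u,
    metricDeriv_comm x₀ w u v]
  ring

/-- The Levi-Civita connection is metric. -/
theorem metricDeriv_eq (x₀ : X) (u v w : TangentSpace 𝓘(ℝ, E) x₀) :
    metricDeriv x₀ u v w = inner ℝ (christoffel x₀ u v) w + inner ℝ v (christoffel x₀ u w) := by
  rw [← real_inner_comm v, inner_christoffel, inner_christoffel, metricDeriv_comm x₀ u w v,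
    metricDeriv_comm x₀ w u v, metricDeriv_comm x₀ v w u]
  ring

end LeviCivita

/-! ### Kähler manifolds: the complex structure is parallel -/

section Kahler

variable {E : Type*} [NormedAddCommGroup E] [NormedSpace ℝ E] [FiniteDimensional ℝ E]
  {X : Type*} [TopologicalSpace X] [ChartedSpace E X] [IsManifold 𝓘(ℝ, E) ∞ X]
  [Bundle.RiemannianBundle (fun x : X ↦ TangentSpace 𝓘(ℝ, E) x)]

theorem KahlerStructure.inner_J (K : KahlerStructure E X) (x : X) (u v : TangentSpace 𝓘(ℝ, E) x) :
    inner ℝ (K.J x u) v = -inner ℝ u (K.J x v) := by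
  rw [← symp_eq_inner, K.compatible, K.J_J, map_neg, neg_neg]

/-- The coefficients of `J` in the coordinates around `x₀`. -/
def JHat (K : KahlerStructure E X) (x₀ x : X) : E →L[ℝ] E :=
  ((tangentTriv E x₀).continuousLinearMapAt ℝ x).comp
    ((K.J x).comp ((tangentTriv E x₀).symmL ℝ x))

theorem JHat_apply (K : KahlerStructure E X) {x₀ x : X} (hx : x ∈ (tangentTriv E x₀).baseSet)
    (u : E) : JHat K x₀ x u = coord E x₀ x (K.J x (constField E x₀ u x)) := by
  rw [constField_eq_symmL hx]
  rfl

theorem JHat_coord (K : KahlerStructure E X) {x₀ x : X} (hx : x ∈ (tangentTriv E x₀).baseSet)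
    (v : TangentSpace 𝓘(ℝ, E) x) : JHat K x₀ x (coord E x₀ x v) = coord E x₀ x (K.J x v) := by
  rw [JHat_apply K hx, constField_coord hx]

theorem JHat_self (K : KahlerStructure E X) (x₀ : X) (v : TangentSpace 𝓘(ℝ, E) x₀) :
    JHat K x₀ x₀ (toModel E x₀ v) = toModel E x₀ (K.J x₀ v) := by
  rw [← coord_self, ← coord_self, JHat_coord K (mem_baseSet_self x₀)]

theorem mdifferentiableAt_J_comp {F : Type*} [NormedAddCommGroup F] [NormedSpace ℝ F]
    {Y : Type*} [TopologicalSpace Y] [ChartedSpace F Y] (K : KahlerStructure E X)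
    {i : Y → X} {y : Y} {σ : Π y : Y, TangentSpace 𝓘(ℝ, E) (i y)}
    (hi : MDifferentiableAt 𝓘(ℝ, F) 𝓘(ℝ, E) i y)
    (hσ : MDifferentiableAt 𝓘(ℝ, F) (𝓘(ℝ, E).prod 𝓘(ℝ, E))
      (fun p ↦ (⟨i p, σ p⟩ : TangentBundle 𝓘(ℝ, E) X)) y) :
    MDifferentiableAt 𝓘(ℝ, F) (𝓘(ℝ, E).prod 𝓘(ℝ, E))
      (fun p ↦ (⟨i p, K.J (i p) (σ p)⟩ : TangentBundle 𝓘(ℝ, E) X)) y := by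
  have hJ := (K.contMDiff_J.mdifferentiableAt (by simp) (x := i y)).comp y hi
  exact MDifferentiableAt.clm_bundle_apply (F₁ := E) (F₂ := E) (IB := 𝓘(ℝ, E))
    (E₁ := (TangentSpace 𝓘(ℝ, E) : X → Type _)) (E₂ := (TangentSpace 𝓘(ℝ, E) : X → Type _)) hJ hσ

theorem mdifferentiableAt_J (K : KahlerStructure E X) {x₀ : X} {V : Π x : X, TangentSpace 𝓘(ℝ, E) x}
    (hV : MDiffAt (T% V) x₀) : MDiffAt (T% (fun x ↦ K.J x (V x))) x₀ :=
  mdifferentiableAt_J_comp K (i := id) mdifferentiableAt_id hV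

theorem coord_J_constField (K : KahlerStructure E X) (x₀ : X) (u : E) :
    (fun x ↦ coord E x₀ x (K.J x (constField E x₀ u x))) =ᶠ[nhds x₀] fun x ↦ JHat K x₀ x u :=
  (eventually_mem_baseSet x₀).mono fun _ hx ↦ (JHat_apply K hx u).symm

theorem mdifferentiableAt_JHat (K : KahlerStructure E X) (x₀ : X) :
    MDifferentiableAt 𝓘(ℝ, E) 𝓘(ℝ, E →L[ℝ] E) (JHat K x₀) x₀ :=
  mdifferentiableAt_clm_of_forall_apply fun u ↦
    (mdifferentiableAt_coord (mdifferentiableAt_J K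
      (mdifferentiableAt_constField x₀ u))).congr_of_eventuallyEq (coord_J_constField K x₀ u).symm

/-- The derivative of the coefficients of `J`. -/
def JDeriv (K : KahlerStructure E X) (x₀ : X) (u v : TangentSpace 𝓘(ℝ, E) x₀) :
    TangentSpace 𝓘(ℝ, E) x₀ :=
  (toModel E x₀).symm (chartDeriv (F := E) (JHat K x₀) x₀ (toModel E x₀ u) (toModel E x₀ v))

theorem toModel_JDeriv (K : KahlerStructure E X) (x₀ : X) (u v : TangentSpace 𝓘(ℝ, E) x₀) :
    toModel E x₀ (JDeriv K x₀ u v)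
      = chartDeriv (F := E) (JHat K x₀) x₀ (toModel E x₀ u) (toModel E x₀ v) := by
  rw [JDeriv, ContinuousLinearEquiv.apply_symm_apply]

theorem mdifferentiableAt_JHat_apply (K : KahlerStructure E X) (x₀ : X) (v : E) :
    MDifferentiableAt 𝓘(ℝ, E) 𝓘(ℝ, E) (fun x ↦ JHat K x₀ x v) x₀ ∧
    ∀ u : E, chartDeriv (F := E) (fun x ↦ JHat K x₀ x v) x₀ u
      = chartDeriv (F := E) (JHat K x₀) x₀ u v := by
  have h := mdifferentiableAt_clm_apply (mdifferentiableAt_JHat K x₀)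
    (mdifferentiableAt_const (c := v))
  refine ⟨h.1, fun u ↦ (h.2 u).trans ?_⟩
  rw [chartDeriv_eq_zero_of_eventually_eq (Filter.Eventually.of_forall fun _ ↦ rfl)]
  simp

/-- The derivative of `J² = -1`. -/
theorem JDeriv_J (K : KahlerStructure E X) (x₀ : X) (u v : TangentSpace 𝓘(ℝ, E) x₀) :
    JDeriv K x₀ u (K.J x₀ v) = -K.J x₀ (JDeriv K x₀ u v) := by
  apply (toModel E x₀).injective
  have h := mdifferentiableAt_JHat_apply K x₀ (toModel E x₀ v)
  have h1 := (mdifferentiableAt_clm_apply (mdifferentiableAt_JHat K x₀) h.1).2 (toModel E x₀ u)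
  rw [chartDeriv_eq_zero_of_eventually_eq (c := -toModel E x₀ v), h.2, JHat_self,
    ← toModel_JDeriv, ← toModel_JDeriv, JHat_self] at h1
  · rw [map_neg, eq_neg_iff_add_eq_zero]
    exact h1.symm
  · filter_upwards [eventually_mem_baseSet (E := E) x₀] with x hx
    rw [JHat_apply K hx (toModel E x₀ v), JHat_coord K hx, K.J_J, map_neg, coord_constField hx]

theorem chartDeriv_coord_J_constField (K : KahlerStructure E X) (x₀ : X)
    (u v : TangentSpace 𝓘(ℝ, E) x₀) :
    chartDeriv (F := E) (fun x ↦ coord E x₀ x (K.J x (constField E x₀ (toModel E x₀ v) x))) x₀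
      (toModel E x₀ u) = toModel E x₀ (JDeriv K x₀ u v) := by
  rw [chartDeriv_congr (coord_J_constField K x₀ _), (mdifferentiableAt_JHat_apply K x₀ _).2,
    toModel_JDeriv]

theorem mlieBracket_J_constField (K : KahlerStructure E X) (x₀ : X)
    (v w : TangentSpace 𝓘(ℝ, E) x₀) :
    VectorField.mlieBracket 𝓘(ℝ, E) (fun p ↦ K.J p (constField E x₀ (toModel E x₀ v) p))
      (constField E x₀ (toModel E x₀ w)) x₀ = -JDeriv K x₀ w v := by
  apply (toModel E x₀).injective
  rw [mlieBracket_eq _ _ _ (mdifferentiableAt_J K (mdifferentiableAt_constField x₀ _))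
    (mdifferentiableAt_constField x₀ _), chartDeriv_coord_constField,
    constField_self (u := toModel E x₀ w), ContinuousLinearEquiv.symm_apply_apply,
    chartDeriv_coord_J_constField]
  simp

/-- The vanishing of the Nijenhuis tensor, evaluated on fields with constant coefficients. -/
theorem JDeriv_integrable (K : KahlerStructure E X) (x₀ : X) (v w : TangentSpace 𝓘(ℝ, E) x₀) :
    JDeriv K x₀ (K.J x₀ v) w - JDeriv K x₀ (K.J x₀ w) v + K.J x₀ (JDeriv K x₀ w v)
      - K.J x₀ (JDeriv K x₀ v w) = 0 := by
  have hv := mdifferentiableAt_constField x₀ (toModel E x₀ v)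
  have hw := mdifferentiableAt_constField x₀ (toModel E x₀ w)
  have h := K.integrable x₀ _ _ hv hw
  have b1 : VectorField.mlieBracket 𝓘(ℝ, E) (fun p ↦ K.J p (constField E x₀ (toModel E x₀ v) p))
      (fun p ↦ K.J p (constField E x₀ (toModel E x₀ w) p)) x₀
      = JDeriv K x₀ (K.J x₀ v) w - JDeriv K x₀ (K.J x₀ w) v := by
    apply (toModel E x₀).injective
    rw [mlieBracket_eq _ _ _ (mdifferentiableAt_J K hv) (mdifferentiableAt_J K hw),
      chartDeriv_coord_J_constField, chartDeriv_coord_J_constField,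
      constField_self, constField_self]
    simp
  have b3 : VectorField.mlieBracket 𝓘(ℝ, E) (constField E x₀ (toModel E x₀ v))
      (fun p ↦ K.J p (constField E x₀ (toModel E x₀ w) p)) x₀ = JDeriv K x₀ v w := by
    apply (toModel E x₀).injective
    rw [mlieBracket_eq _ _ _ hv (mdifferentiableAt_J K hw), chartDeriv_coord_constField,
      constField_self (u := toModel E x₀ v), ContinuousLinearEquiv.symm_apply_apply,
      chartDeriv_coord_J_constField]
    simp
  rw [b1, mlieBracket_J_constField, b3, mlieBracket_constField, map_neg, sub_neg_eq_add,
    sub_zero] at h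
  exact h

variable [IsContMDiffRiemannianBundle 𝓘(ℝ, E) ∞ E (fun x : X ↦ TangentSpace 𝓘(ℝ, E) x)]

theorem chartDeriv_metricHat_JHat (K : KahlerStructure E X) (x₀ : X)
    (u v w : TangentSpace 𝓘(ℝ, E) x₀) :
    chartDeriv (F := E) (fun x ↦ metricHat E x₀ x (JHat K x₀ x (toModel E x₀ v))
      (toModel E x₀ w)) x₀ (toModel E x₀ u)
      = metricDeriv x₀ u (K.J x₀ v) w + inner ℝ (JDeriv K x₀ u v) w := by
  have h := mdifferentiableAt_JHat_apply K x₀ (toModel E x₀ v)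
  rw [(mdifferentiableAt_clm_apply₂ (mdifferentiableAt_metricHat x₀) h.1
    (mdifferentiableAt_const (c := toModel E x₀ w))).2, h.2,
    chartDeriv_eq_zero_of_eventually_eq (f := fun _ ↦ toModel E x₀ w)
      (Filter.Eventually.of_forall fun _ ↦ rfl), JHat_self, ← toModel_JDeriv, metricHat_self]
  simp [metricDeriv]

theorem chartDeriv_metricHat_JHat_right (K : KahlerStructure E X) (x₀ : X)
    (u v w : TangentSpace 𝓘(ℝ, E) x₀) :
    chartDeriv (F := E) (fun x ↦ metricHat E x₀ x (toModel E x₀ v)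
      (JHat K x₀ x (toModel E x₀ w))) x₀ (toModel E x₀ u)
      = metricDeriv x₀ u v (K.J x₀ w) + inner ℝ v (JDeriv K x₀ u w) := by
  have h := mdifferentiableAt_JHat_apply K x₀ (toModel E x₀ w)
  rw [(mdifferentiableAt_clm_apply₂ (mdifferentiableAt_metricHat x₀)
    (mdifferentiableAt_const (c := toModel E x₀ v)) h.1).2, h.2,
    chartDeriv_eq_zero_of_eventually_eq (f := fun _ ↦ toModel E x₀ v)
      (Filter.Eventually.of_forall fun _ ↦ rfl), JHat_self, ← toModel_JDeriv, metricHat_self]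
  simp [metricDeriv]

/-- The derivative of `⟨J v, w⟩ = -⟨v, J w⟩` for fields with constant coefficients. -/
theorem inner_JDeriv (K : KahlerStructure E X) (x₀ : X) (u v w : TangentSpace 𝓘(ℝ, E) x₀) :
    metricDeriv x₀ u (K.J x₀ v) w + inner ℝ (JDeriv K x₀ u v) w
      = -(metricDeriv x₀ u v (K.J x₀ w) + inner ℝ v (JDeriv K x₀ u w)) := by
  rw [← chartDeriv_metricHat_JHat, ← chartDeriv_metricHat_JHat_right]
  rw [chartDeriv_congr (g := -(fun x ↦ metricHat E x₀ x (toModel E x₀ v)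
      (JHat K x₀ x (toModel E x₀ w))))]
  · rw [chartDeriv, mvfderiv_neg]
    rfl
  · filter_upwards [eventually_mem_baseSet (E := E) x₀] with x hx
    rw [Pi.neg_apply, JHat_apply K hx, JHat_apply K hx]
    conv_lhs => rw [← coord_constField hx (toModel E x₀ w)]
    conv_rhs => rw [← coord_constField hx (toModel E x₀ v)]
    rw [metricHat_coord hx, metricHat_coord hx, K.inner_J]

theorem mvfderiv_symp_constField (K : KahlerStructure E X) (x₀ : X)
    (u v w : TangentSpace 𝓘(ℝ, E) x₀) :
    mvfderiv 𝓘(ℝ, E) (fun p ↦ K.symp p (constField E x₀ (toModel E x₀ v) p)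
      (constField E x₀ (toModel E x₀ w) p)) x₀ u
      = metricDeriv x₀ u (K.J x₀ v) w + inner ℝ (JDeriv K x₀ u v) w := by
  rw [mvfderiv_eq_chartDeriv_toModel, ← chartDeriv_metricHat_JHat]
  congr 1
  refine chartDeriv_congr ?_
  filter_upwards [eventually_mem_baseSet (E := E) x₀] with x hx
  conv_rhs => rw [← coord_constField hx (toModel E x₀ w)]
  rw [JHat_apply K hx, metricHat_coord hx, symp_eq_inner]

/-- The equation `dω = 0`, evaluated on fields with constant coefficients. -/
theorem JDeriv_closed (K : KahlerStructure E X) (x₀ : X) (u v w : TangentSpace 𝓘(ℝ, E) x₀) :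
    (metricDeriv x₀ u (K.J x₀ v) w + inner ℝ (JDeriv K x₀ u v) w)
      + (metricDeriv x₀ v (K.J x₀ w) u + inner ℝ (JDeriv K x₀ v w) u)
      + (metricDeriv x₀ w (K.J x₀ u) v + inner ℝ (JDeriv K x₀ w u) v) = 0 := by
  have h := K.closed x₀ _ _ _ (mdifferentiableAt_constField x₀ (toModel E x₀ u))
    (mdifferentiableAt_constField x₀ (toModel E x₀ v))
    (mdifferentiableAt_constField x₀ (toModel E x₀ w))
  simp only [mlieBracket_constField, constField_self, ContinuousLinearEquiv.symm_apply_apply,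
    mvfderiv_symp_constField, map_zero, zero_apply, sub_zero] at h
  linarith

/-- On a Kähler manifold `∇J = 0`: here `∇J = dJ + [Γ, J]` in coordinates. -/
theorem JDeriv_eq (K : KahlerStructure E X) (x₀ : X) (u v : TangentSpace 𝓘(ℝ, E) x₀) :
    JDeriv K x₀ u v = K.J x₀ (christoffel x₀ u v) - christoffel x₀ u (K.J x₀ v) := by
  have key := covariantDerivative_eq_zero_of_closed_of_integrable (K.J_J x₀) (K.inner_J x₀)
    (fun u v ↦ JDeriv K x₀ u v + christoffel x₀ u (K.J x₀ v) - K.J x₀ (christoffel x₀ u v))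
    ?_ ?_ ?_ ?_ u v
  · rw [sub_eq_zero] at key
    rw [← key]; abel
  · intro u v w
    have h := inner_JDeriv K x₀ u v w
    rw [metricDeriv_eq, metricDeriv_eq, K.inner_J, ← neg_eq_iff_eq_neg.2 (K.inner_J x₀ _ w)] at h
    simp only [inner_sub_left, inner_add_left, inner_sub_right, inner_add_right, K.inner_J] at h ⊢
    linarith
  · intro u v
    simp only [JDeriv_J, K.J_J, map_sub, map_add, map_neg]
    abel
  · intro u v w
    have h := JDeriv_closed K x₀ u v w
    simp only [metricDeriv_eq] at h
    have hJ : ∀ a b c, inner ℝ (K.J x₀ a) (christoffel x₀ b c)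
        = inner ℝ (christoffel x₀ c b) (K.J x₀ a) := fun a b c ↦ by
      rw [real_inner_comm, christoffel_comm]
    simp only [hJ] at h
    simp only [inner_sub_left, inner_add_left, K.inner_J]
    linarith
  · intro v w
    have h := JDeriv_integrable K x₀ v w
    simp only [map_sub, map_add, K.J_J]
    rw [christoffel_comm x₀ w v, christoffel_comm x₀ (K.J x₀ w) v,
      christoffel_comm x₀ (K.J x₀ w) (K.J x₀ v), christoffel_comm x₀ w (K.J x₀ v)]
    refine Eq.trans ?_ h
    abel

end Kahler

/-! ### Calabi–Yau manifolds: the holomorphic volume form is parallel -/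

section CalabiYau

/-- The action of `D` preserves the type `(n, 0)` up to the commutator of `D` and `J`. -/
theorem derivationAction_update_of_type {V : Type*} [NormedAddCommGroup V] [InnerProductSpace ℝ V]
    {ι : Type*} [Fintype ι] [DecidableEq ι] {J : V →L[ℝ] V} (Φ : V [⋀^ι]→ₗ[ℝ] ℂ)
    (hΦ : ∀ v j, Φ (Function.update v j (J (v j))) = Complex.I * Φ v) (D : V →ₗ[ℝ] V) (w : ι → V)
    (j : ι) :
    derivationAction Φ D (Function.update w j (J (w j)))
      = Complex.I * derivationAction Φ D w + Φ (Function.update w j (D (J (w j))))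
        - Φ (Function.update w j (J (D (w j)))) := by
  have hj : Φ (Function.update w j (J (D (w j))))
      = Complex.I * Φ (Function.update w j (D (w j))) := by
    simpa using hΦ (Function.update w j (D (w j))) j
  rw [derivationAction_apply, derivationAction_apply,
    ← Finset.add_sum_erase _ _ (Finset.mem_univ j),
    ← Finset.add_sum_erase _ _ (Finset.mem_univ j), mul_add,
    Finset.mul_sum, hj,
    Function.update_self, Function.update_idem]
  have : ∀ b ∈ Finset.univ.erase j, Φ (Function.update (Function.update w j (J (w j))) b
      (D (Function.update w j (J (w j)) b)))
        = Complex.I * Φ (Function.update w b (D (w b))) := by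
    intro b hb
    have hbj : b ≠ j := Finset.ne_of_mem_erase hb
    rw [Function.update_of_ne hbj, Function.update_comm hbj.symm, ← hΦ _ j,
      Function.update_of_ne hbj.symm]
  rw [Finset.sum_congr rfl this]
  ring

variable {E : Type*} [NormedAddCommGroup E] [NormedSpace ℝ E] [FiniteDimensional ℝ E]
  {X : Type*} [TopologicalSpace X] [ChartedSpace E X] [IsManifold 𝓘(ℝ, E) ∞ X]
  [Bundle.RiemannianBundle (fun x : X ↦ TangentSpace 𝓘(ℝ, E) x)] {n : ℕ}

/-- The coefficients of `Ω` in the coordinates around `x₀`. -/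
def volumeHat (C : CalabiYauStructure E X n) (x₀ x : X) : E [⋀^Fin n]→L[ℝ] ℂ :=
  (C.Ω x).compContinuousLinearMap ((tangentTriv E x₀).symmL ℝ x)

theorem volumeHat_apply (C : CalabiYauStructure E X n) {x₀ x : X}
    (hx : x ∈ (tangentTriv E x₀).baseSet) (u : Fin n → E) :
    volumeHat C x₀ x u = C.Ω x (fun j ↦ constField E x₀ (u j) x) := by
  simp only [constField_eq_symmL hx]
  rfl

theorem volumeHat_coord (C : CalabiYauStructure E X n) {x₀ x : X}
    (hx : x ∈ (tangentTriv E x₀).baseSet) (w : Fin n → TangentSpace 𝓘(ℝ, E) x) :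
    volumeHat C x₀ x (fun j ↦ coord E x₀ x (w j)) = C.Ω x w := by
  rw [volumeHat_apply C hx]
  simp only [constField_coord hx]

theorem volumeHat_self (C : CalabiYauStructure E X n) (x₀ : X)
    (w : Fin n → TangentSpace 𝓘(ℝ, E) x₀) :
    volumeHat C x₀ x₀ (fun j ↦ toModel E x₀ (w j)) = C.Ω x₀ w := by
  simp only [← coord_self]
  exact volumeHat_coord C (mem_baseSet_self x₀) w

theorem mdifferentiableAt_volumeHat (C : CalabiYauStructure E X n) (x₀ : X) :
    MDifferentiableAt 𝓘(ℝ, E) 𝓘(ℝ, E [⋀^Fin n]→L[ℝ] ℂ) (volumeHat C x₀) x₀ :=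
  (C.contMDiff_Ω x₀).mdifferentiableAt (by simp)

/-- The derivative of the coefficients of `Ω`. -/
def volumeDeriv (C : CalabiYauStructure E X n) (x₀ : X) (u : TangentSpace 𝓘(ℝ, E) x₀) :
    TangentSpace 𝓘(ℝ, E) x₀ [⋀^Fin n]→ₗ[ℝ] ℂ :=
  (chartDeriv (F := E) (volumeHat C x₀) x₀ (toModel E x₀ u)).toAlternatingMap.compLinearMap
    (toModel E x₀).toLinearMap

theorem volumeDeriv_apply (C : CalabiYauStructure E X n) (x₀ : X) (u : TangentSpace 𝓘(ℝ, E) x₀)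
    (w : Fin n → TangentSpace 𝓘(ℝ, E) x₀) :
    volumeDeriv C x₀ u w
      = chartDeriv (F := E) (volumeHat C x₀) x₀ (toModel E x₀ u) (fun j ↦ toModel E x₀ (w j)) := rfl

theorem mdifferentiableAt_volumeHat_apply (C : CalabiYauStructure E X n) (x₀ : X)
    (w : Fin n → TangentSpace 𝓘(ℝ, E) x₀) :
    MDifferentiableAt 𝓘(ℝ, E) 𝓘(ℝ, ℂ)
      (fun x ↦ volumeHat C x₀ x (fun j ↦ toModel E x₀ (w j))) x₀ ∧
    ∀ u : TangentSpace 𝓘(ℝ, E) x₀, chartDeriv (F := E)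
      (fun x ↦ volumeHat C x₀ x (fun j ↦ toModel E x₀ (w j))) x₀ (toModel E x₀ u)
        = volumeDeriv C x₀ u w := by
  have h := mdifferentiableAt_alternating_apply (mdifferentiableAt_volumeHat C x₀)
    (s := fun j _ ↦ toModel E x₀ (w j)) (fun j ↦ mdifferentiableAt_const)
  refine ⟨h.1, fun u ↦ (h.2 _).trans ?_⟩
  rw [volumeDeriv_apply, Finset.sum_eq_zero, add_zero]
  intro j _
  rw [chartDeriv_const]
  exact ContinuousAlternatingMap.map_coord_zero _ j (by simp)

/-- The derivative of `Ω(…, J w_j, …) = i Ω(w)` for fields with constant coefficients. -/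
theorem volumeDeriv_update_J (C : CalabiYauStructure E X n) (x₀ : X)
    (u : TangentSpace 𝓘(ℝ, E) x₀) (w : Fin n → TangentSpace 𝓘(ℝ, E) x₀) (j : Fin n) :
    volumeDeriv C x₀ u (Function.update w j (C.J x₀ (w j)))
      + C.Ω x₀ (Function.update w j (JDeriv C.toKahlerStructure x₀ u (w j)))
      = Complex.I * volumeDeriv C x₀ u w := by
  have hJ := mdifferentiableAt_JHat_apply C.toKahlerStructure x₀ (toModel E x₀ (w j))
  let s : Fin n → X → E := Function.update (fun a _ ↦ toModel E x₀ (w a)) j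
    (fun x ↦ JHat C.toKahlerStructure x₀ x (toModel E x₀ (w j)))
  have hs : ∀ a, MDifferentiableAt 𝓘(ℝ, E) 𝓘(ℝ, E) (s a) x₀ := fun a ↦ by
    rcases eq_or_ne a j with rfl | ha
    · simpa [s] using hJ.1
    · simpa [s, ha] using mdifferentiableAt_const
  have hs' : ∀ x, (fun a ↦ s a x) = Function.update (fun a ↦ toModel E x₀ (w a)) j
      (JHat C.toKahlerStructure x₀ x (toModel E x₀ (w j))) := fun x ↦ by
    ext1 a
    rcases eq_or_ne a j with rfl | ha
    · simp [s]
    · simp [s, ha]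
  have hm : ∀ v : TangentSpace 𝓘(ℝ, E) x₀, Function.update (fun a ↦ toModel E x₀ (w a)) j
      (toModel E x₀ v) = fun a ↦ toModel E x₀ (Function.update w j v a) := fun v ↦ by
    ext1 a
    rcases eq_or_ne a j with rfl | ha
    · simp
    · simp [ha]
  have h := mdifferentiableAt_alternating_apply (mdifferentiableAt_volumeHat C x₀) hs
  have h1 := h.2 (toModel E x₀ u)
  have h2 := (mdifferentiableAt_mul (mdifferentiableAt_const (c := Complex.I))
    (mdifferentiableAt_volumeHat_apply C x₀ w).1).2 (toModel E x₀ u)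
  rw [(mdifferentiableAt_volumeHat_apply C x₀ w).2, chartDeriv_const, zero_apply, zero_mul,
    add_zero] at h2
  rw [← h2, ← chartDeriv_congr (f := fun x ↦ volumeHat C x₀ x (fun a ↦ s a x)), h1, hs', JHat_self,
    hm, ← volumeDeriv_apply, Finset.sum_eq_single j]
  · congr 1
    rw [← hm, Function.update_idem, show s j = fun x ↦ JHat C.toKahlerStructure x₀ x
      (toModel E x₀ (w j)) by simp [s], hJ.2, ← toModel_JDeriv, hm, volumeHat_self]
  · intro b _ hb
    rw [show s b = fun _ ↦ toModel E x₀ (w b) by simp [s, hb], chartDeriv_const]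
    exact ContinuousAlternatingMap.map_coord_zero _ b (by simp)
  · simp
  · filter_upwards [eventually_mem_baseSet (E := E) x₀] with x hx
    rw [hs', volumeHat_apply C hx (fun j ↦ toModel E x₀ (w j)), ← C.type_Ω x _ j,
      ← volumeHat_coord C hx]
    congr 1
    ext1 a
    rcases eq_or_ne a j with rfl | ha
    · simp [JHat_apply C.toKahlerStructure hx]
    · simp [ha, coord_constField hx]

theorem formLieDeriv_constField (C : CalabiYauStructure E X n) (x₀ : X)
    (v : TangentSpace 𝓘(ℝ, E) x₀) (w : Fin n → TangentSpace 𝓘(ℝ, E) x₀) :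
    formLieDeriv C.Ω (constField E x₀ (toModel E x₀ v))
      (fun j ↦ constField E x₀ (toModel E x₀ (w j))) x₀
      = volumeDeriv C x₀ v w := by
  rw [formLieDeriv, Finset.sum_eq_zero, sub_zero, mvfderiv_eq_chartDeriv_toModel, constField_self,
    ContinuousLinearEquiv.symm_apply_apply, ← (mdifferentiableAt_volumeHat_apply C x₀ w).2]
  · congr 1
    refine chartDeriv_congr ?_
    filter_upwards [eventually_mem_baseSet (E := E) x₀] with x hx
    rw [volumeHat_apply C hx]
  · intro j _
    rw [mlieBracket_constField]
    exact ContinuousAlternatingMap.map_coord_zero _ j (by simp)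

theorem formLieDeriv_J_constField (C : CalabiYauStructure E X n) (x₀ : X)
    (v : TangentSpace 𝓘(ℝ, E) x₀) (w : Fin n → TangentSpace 𝓘(ℝ, E) x₀) :
    formLieDeriv C.Ω (fun p ↦ C.J p (constField E x₀ (toModel E x₀ v) p))
      (fun j ↦ constField E x₀ (toModel E x₀ (w j))) x₀
      = volumeDeriv C x₀ (C.J x₀ v) w
        + ∑ j, C.Ω x₀ (Function.update w j (JDeriv C.toKahlerStructure x₀ (w j) v)) := by
  have hw : (fun j ↦ constField E x₀ (toModel E x₀ (w j)) x₀) = w := by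
    ext1 j
    rw [constField_self, ContinuousLinearEquiv.symm_apply_apply]
  rw [formLieDeriv, sub_eq_add_neg, ← Finset.sum_neg_distrib]
  congr 1
  · rw [mvfderiv_eq_chartDeriv_toModel, constField_self,
    ContinuousLinearEquiv.symm_apply_apply, ← (mdifferentiableAt_volumeHat_apply C x₀ w).2]
    congr 1
    refine chartDeriv_congr ?_
    filter_upwards [eventually_mem_baseSet (E := E) x₀] with x hx
    rw [volumeHat_apply C hx]
  · refine Finset.sum_congr rfl fun j _ ↦ ?_
    rw [hw, mlieBracket_J_constField]
    have := (C.Ω x₀).map_update_smul w j (-1 : ℝ) (JDeriv C.toKahlerStructure x₀ (w j) v)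
    rw [neg_one_smul, neg_one_smul] at this
    rw [this, neg_neg]

variable [IsContMDiffRiemannianBundle 𝓘(ℝ, E) ∞ E (fun x : X ↦ TangentSpace 𝓘(ℝ, E) x)]

/-- The covariant derivative `∇_u Ω` at `x₀`. -/
def volumeCov (C : CalabiYauStructure E X n) (x₀ : X) (u : TangentSpace 𝓘(ℝ, E) x₀) :
    TangentSpace 𝓘(ℝ, E) x₀ [⋀^Fin n]→ₗ[ℝ] ℂ :=
  volumeDeriv C x₀ u - derivationAction (C.Ω x₀).toAlternatingMap (christoffel x₀ u)

theorem volumeCov_apply (C : CalabiYauStructure E X n) (x₀ : X) (u : TangentSpace 𝓘(ℝ, E) x₀)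
    (w : Fin n → TangentSpace 𝓘(ℝ, E) x₀) :
    volumeCov C x₀ u w
      = volumeDeriv C x₀ u w - ∑ j, C.Ω x₀ (Function.update w j (christoffel x₀ u (w j))) := by
  rw [volumeCov, AlternatingMap.sub_apply, derivationAction_apply]
  rfl

/-- The form `∇_u Ω` is of type `(n, 0)`, as `∇J = 0`. -/
theorem volumeCov_type (C : CalabiYauStructure E X n) (x₀ : X) (u : TangentSpace 𝓘(ℝ, E) x₀)
    (w : Fin n → TangentSpace 𝓘(ℝ, E) x₀) (j : Fin n) :
    volumeCov C x₀ u (Function.update w j (C.J x₀ (w j))) = Complex.I * volumeCov C x₀ u w := by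
  have h1 := volumeDeriv_update_J C x₀ u w j
  have h2 := derivationAction_update_of_type (C.Ω x₀).toAlternatingMap (C.type_Ω x₀)
    (christoffel x₀ u) w j
  have h3 : C.Ω x₀ (Function.update w j (JDeriv C.toKahlerStructure x₀ u (w j)))
      = C.Ω x₀ (Function.update w j (C.J x₀ (christoffel x₀ u (w j))))
        - C.Ω x₀ (Function.update w j (christoffel x₀ u (C.J x₀ (w j)))) := by
    rw [JDeriv_eq]
    exact (C.Ω x₀).map_update_sub w j _ _
  rw [volumeCov, AlternatingMap.sub_apply, AlternatingMap.sub_apply, mul_sub, ← h1, h2, h3]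
  simp only [ContinuousAlternatingMap.coe_toAlternatingMap]
  ring

/-- The equation `∂̄Ω = 0`; the terms from the Lie brackets with `J V` turn `dΩ` into `∇Ω`. -/
theorem volumeCov_holomorphic (C : CalabiYauStructure E X n) (x₀ : X)
    (v : TangentSpace 𝓘(ℝ, E) x₀) (w : Fin n → TangentSpace 𝓘(ℝ, E) x₀) :
    volumeCov C x₀ v w + Complex.I * volumeCov C x₀ (C.J x₀ v) w = 0 := by
  have h := C.holomorphic x₀ _ (fun j ↦ constField E x₀ (toModel E x₀ (w j)))
    (mdifferentiableAt_constField x₀ (toModel E x₀ v)) (fun j ↦ mdifferentiableAt_constField x₀ _)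
  rw [formLieDeriv_constField, formLieDeriv_J_constField] at h
  have h3 : ∀ j, C.Ω x₀ (Function.update w j (JDeriv C.toKahlerStructure x₀ (w j) v))
      = Complex.I * C.Ω x₀ (Function.update w j (christoffel x₀ v (w j)))
        - C.Ω x₀ (Function.update w j (christoffel x₀ (C.J x₀ v) (w j))) := fun j ↦ by
    rw [JDeriv_eq, christoffel_comm x₀ (w j), christoffel_comm x₀ (w j)]
    have hJ := C.type_Ω x₀ (Function.update w j (christoffel x₀ v (w j))) j
    rw [Function.update_self, Function.update_idem] at hJ
    rw [← hJ]
    exact (C.Ω x₀).map_update_sub w j _ _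
  simp only [h3, Finset.sum_sub_distrib, ← Finset.mul_sum] at h
  rw [volumeCov_apply, volumeCov_apply, ← h]
  linear_combination (-∑ j, C.Ω x₀ (Function.update w j (christoffel x₀ v (w j)))) * Complex.I_mul_I

theorem norm_volume_of_isUnitaryFamily (C : CalabiYauStructure E X n) (x : X)
    {e : Fin n → TangentSpace 𝓘(ℝ, E) x} (he : IsUnitaryFamily (C.J x) e) : ‖C.Ω x e‖ = 1 :=
  C.norm_Ω x e he.orthonormal fun a b ↦ by rw [symp_eq_inner, he.isotropic]

/-- `|Ω(w)|²` is the Hermitian Gram determinant of `w`. -/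
theorem volume_mul_conj (C : CalabiYauStructure E X n) (x : X)
    (w : Fin n → TangentSpace 𝓘(ℝ, E) x) :
    C.Ω x w * starRingEnd ℂ (C.Ω x w)
      = (Matrix.of fun a b ↦ hermitian (C.J x) (w a) (w b)).det := by
  have hn : Module.finrank ℝ (TangentSpace 𝓘(ℝ, E) x) = 2 * n := C.finrank_eq
  obtain ⟨e, he⟩ := IsUnitaryFamily.exists_basis (C.inner_J x) n hn.ge
  exact he.map_mul_conj_eq_det (C.J_J x) (C.inner_J x) (by rw [hn, Fintype.card_fin])
    (C.Ω x).toAlternatingMap (C.type_Ω x) (norm_volume_of_isUnitaryFamily C x he) w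

/-- Differentiating `|Ω(w)|² = det ⟨w_a, w_b⟩` along constant fields which are unitary at `x₀`. -/
theorem re_volumeDeriv_mul_conj (C : CalabiYauStructure E X n) (x₀ : X)
    (u : TangentSpace 𝓘(ℝ, E) x₀) {e : Fin n → TangentSpace 𝓘(ℝ, E) x₀}
    (he : IsUnitaryFamily (C.J x₀) e) :
    2 * (volumeDeriv C x₀ u e * starRingEnd ℂ (C.Ω x₀ e)).re
      = ∑ a, metricDeriv x₀ u (e a) (e a) := by
  let W : Fin n → Π x : X, TangentSpace 𝓘(ℝ, E) x := fun a ↦ constField E x₀ (toModel E x₀ (e a))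
  have hW : ∀ a, W a x₀ = e a := fun a ↦ by
    simp only [W]
    rw [constField_self, ContinuousLinearEquiv.symm_apply_apply]
  have hh := mdifferentiableAt_volumeHat_apply C x₀ e
  have hc := mdifferentiableAt_clm_comp Complex.conjCLE.toContinuousLinearMap hh.1
  have hl := (mdifferentiableAt_mul hh.1 hc.1).2 (toModel E x₀ u)
  let G : Fin n → Fin n → X → ℂ := fun a b x ↦ hermitian (C.J x) (W a x) (W b x)
  have hG : ∀ a b, G a b =ᶠ[nhds x₀] fun x ↦
      (Complex.ofRealCLM (metricHat E x₀ x (toModel E x₀ (e a)) (toModel E x₀ (e b))) : ℂ)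
        + Complex.I * Complex.ofRealCLM (metricHat E x₀ x (toModel E x₀ (e a))
          (JHat C.toKahlerStructure x₀ x (toModel E x₀ (e b)))) := fun a b ↦ by
    filter_upwards [eventually_mem_baseSet (E := E) x₀] with x hx
    conv_rhs => rw [← coord_constField hx (toModel E x₀ (e a))]
    rw [JHat_apply _ hx, metricHat_coord hx]
    conv_rhs => rw [← coord_constField hx (toModel E x₀ (e b))]
    rw [metricHat_coord hx, constField_coord hx]
    rfl
  have hmet : ∀ a b, MDifferentiableAt 𝓘(ℝ, E) 𝓘(ℝ, ℝ) (fun x ↦ metricHat E x₀ x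
      (toModel E x₀ (e a)) (toModel E x₀ (e b))) x₀ := fun a b ↦
    (mdifferentiableAt_clm_apply₂ (mdifferentiableAt_metricHat x₀) mdifferentiableAt_const
      mdifferentiableAt_const).1
  have hGd : ∀ a b, MDifferentiableAt 𝓘(ℝ, E) 𝓘(ℝ, ℂ) (G a b) x₀ := fun a b ↦ by
    refine MDifferentiableAt.congr_of_eventuallyEq ?_ (hG a b)
    refine (mdifferentiableAt_clm_comp _ (hmet a b)).1.add ?_
    exact (mdifferentiableAt_mul mdifferentiableAt_const (mdifferentiableAt_clm_comp _
      (mdifferentiableAt_clm_apply₂ (mdifferentiableAt_metricHat x₀) mdifferentiableAt_const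
        (mdifferentiableAt_JHat_apply C.toKahlerStructure x₀ _).1).1).1).1
  have hG1 : ∀ a b, G a b x₀ = if a = b then 1 else 0 := fun a b ↦ by
    simp only [G, hW]
    split_ifs with hab
    · rw [hab, hermitian_self_of_norm_eq_one (C.inner_J x₀) (he.orthonormal.1 b)]
    · exact he.hermitian_eq_zero hab
  have hr := (mdifferentiableAt_det hGd hG1).2 (toModel E x₀ u)
  have hGaa : ∀ a, chartDeriv (F := E) (G a a) x₀ (toModel E x₀ u)
      = (metricDeriv x₀ u (e a) (e a) : ℂ) := fun a ↦ by
    have h1 : G a a =ᶠ[nhds x₀] fun x ↦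
        Complex.ofRealCLM (metricHat E x₀ x (toModel E x₀ (e a)) (toModel E x₀ (e a))) := by
      filter_upwards [eventually_mem_baseSet (E := E) x₀] with x hx
      have h0 := inner_apply_self (C.inner_J x) (W a x)
      rw [real_inner_comm] at h0
      simp only [G, hermitian, h0, metricHat_apply hx]
      simp [W]
    rw [chartDeriv_congr h1, (mdifferentiableAt_clm_comp _ (hmet a a)).2,
      (mdifferentiableAt_clm_apply₂ (mdifferentiableAt_metricHat x₀) mdifferentiableAt_const
      mdifferentiableAt_const).2, chartDeriv_const]
    simp [metricDeriv]
  have hlr : (fun x ↦ volumeHat C x₀ x (fun j ↦ toModel E x₀ (e j))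
      * Complex.conjCLE.toContinuousLinearMap (volumeHat C x₀ x (fun j ↦ toModel E x₀ (e j))))
      =ᶠ[nhds x₀] fun x ↦ (Matrix.of fun a b ↦ G a b x).det := by
    filter_upwards [eventually_mem_baseSet (E := E) x₀] with x hx
    rw [volumeHat_apply C hx]
    exact volume_mul_conj C x _
  rw [chartDeriv_congr hlr, hr, hc.2, hh.2, volumeHat_self] at hl
  simp only [hGaa] at hl
  have := congrArg Complex.re hl
  rw [Complex.re_sum] at this
  simp only [Complex.ofReal_re] at this
  rw [this]
  simp
  ring

/-- On a Calabi–Yau manifold `∇Ω = 0`. The form `∇_u Ω` is of type `(n, 0)`, hence vanishes as soon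
as it does on a unitary basis `e`; there `∇_u Ω(e)` is an imaginary multiple of `Ω(e)` as `|Ω|` is
constant, and by holomorphy so is `i ∇_u Ω(e)`. -/
theorem volumeCov_eq_zero (C : CalabiYauStructure E X n) (x₀ : X) (u : TangentSpace 𝓘(ℝ, E) x₀) :
    volumeCov C x₀ u = 0 := by
  have hn : Module.finrank ℝ (TangentSpace 𝓘(ℝ, E) x₀) = 2 * n := C.finrank_eq
  have hcard : Module.finrank ℝ (TangentSpace 𝓘(ℝ, E) x₀) = 2 * Fintype.card (Fin n) := by
    rw [hn, Fintype.card_fin]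
  obtain ⟨e, he⟩ := IsUnitaryFamily.exists_basis (C.inner_J x₀) n hn.ge
  have hnorm := norm_volume_of_isUnitaryFamily C x₀ he
  have hconj : C.Ω x₀ e * starRingEnd ℂ (C.Ω x₀ e) = 1 := by
    rw [Complex.mul_conj, Complex.normSq_eq_norm_sq, hnorm]
    simp
  let t : TangentSpace 𝓘(ℝ, E) x₀ → ℂ := fun u ↦ volumeCov C x₀ u e * starRingEnd ℂ (C.Ω x₀ e)
  have hre : ∀ u, (t u).re = 0 := fun u ↦ by
    have h1 := re_volumeDeriv_mul_conj C x₀ u he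
    have h2 : ∀ a, C.Ω x₀ (Function.update e a (christoffel x₀ u (e a)))
        = hermitian (C.J x₀) (christoffel x₀ u (e a)) (e a) * C.Ω x₀ e := fun a ↦ by
      have := he.map_update (C.J_J x₀) (C.inner_J x₀) hcard (C.Ω x₀).toAlternatingMap (C.type_Ω x₀)
        e a (fun b hb ↦ he.hermitian_eq_zero hb) (christoffel x₀ u (e a))
      rwa [Function.update_eq_self] at this
    have h3 : t u = volumeDeriv C x₀ u e * starRingEnd ℂ (C.Ω x₀ e)
        - ∑ a, hermitian (C.J x₀) (christoffel x₀ u (e a)) (e a) := by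
      simp only [t, volumeCov_apply, h2, ← Finset.sum_mul]
      linear_combination (-∑ a, hermitian (C.J x₀) (christoffel x₀ u (e a)) (e a)) * hconj
    have h4 : ∀ a, metricDeriv x₀ u (e a) (e a)
        = 2 * (hermitian (C.J x₀) (christoffel x₀ u (e a)) (e a)).re := fun a ↦ by
      have h5 := real_inner_comm (e a) (christoffel x₀ u (e a))
      rw [metricDeriv_eq]
      simp [hermitian]
      linarith
    rw [h3, Complex.sub_re, Complex.re_sum]
    simp only [h4, ← Finset.mul_sum] at h1
    linarith
  have him : ∀ u, (t (C.J x₀ u)).im = 0 := fun u ↦ by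
    have h1 := congrArg (fun z ↦ (z * starRingEnd ℂ (C.Ω x₀ e)).re) (volumeCov_holomorphic C x₀ u e)
    have h2 : (t u + Complex.I * t (C.J x₀ u)).re = 0 := by
      simpa only [t, add_mul, mul_assoc, zero_mul, Complex.zero_re] using h1
    simpa [hre] using h2
  have ht : t u = 0 := by
    refine Complex.ext (hre u) ?_
    have := him (-C.J x₀ u)
    rwa [map_neg, C.J_J, neg_neg] at this
  have h0 : volumeCov C x₀ u e = 0 := by
    refine (mul_eq_zero.1 ht).resolve_right fun h ↦ ?_
    rw [h, mul_zero] at hconj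
    exact zero_ne_one hconj
  ext w
  rw [he.map_eq_det (C.J_J x₀) (C.inner_J x₀) hcard _ (volumeCov_type C x₀ u) w, h0, mul_zero]
  rfl

/-- The equation `∇Ω = 0` in terms of the Christoffel symbols. -/
theorem volumeDeriv_eq (C : CalabiYauStructure E X n) (x₀ : X) (u : TangentSpace 𝓘(ℝ, E) x₀)
    (w : Fin n → TangentSpace 𝓘(ℝ, E) x₀) :
    volumeDeriv C x₀ u w = ∑ j, C.Ω x₀ (Function.update w j (christoffel x₀ u (w j))) := by
  have h := volumeCov_apply C x₀ u w
  rw [volumeCov_eq_zero] at h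
  exact (sub_eq_zero.1 h.symm)

end CalabiYau

/-! ### The pulled back connection along a map -/

section Along

variable {E : Type*} [NormedAddCommGroup E] [NormedSpace ℝ E] [FiniteDimensional ℝ E]
  {X : Type*} [TopologicalSpace X] [ChartedSpace E X] [IsManifold 𝓘(ℝ, E) ∞ X]
  [Bundle.RiemannianBundle (fun x : X ↦ TangentSpace 𝓘(ℝ, E) x)]
  {F : Type*} [NormedAddCommGroup F] [NormedSpace ℝ F] [FiniteDimensional ℝ F]
  {Y : Type*} [TopologicalSpace Y] [ChartedSpace F Y] [IsManifold 𝓘(ℝ, F) ∞ Y]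

/-- The section `σ` of `i^* TX` is differentiable at `y`. -/
def MDiffAlong (i : Y → X) (σ : Π p : Y, TangentSpace 𝓘(ℝ, E) (i p)) (y : Y) : Prop :=
  MDifferentiableAt 𝓘(ℝ, F) (𝓘(ℝ, E).prod 𝓘(ℝ, E))
    (fun p ↦ (⟨i p, σ p⟩ : TangentBundle 𝓘(ℝ, E) X)) y

theorem mdifferentiableAt_comp_and_chartDeriv {W : Type*} [NormedAddCommGroup W] [NormedSpace ℝ W]
    {i : Y → X} {y : Y} (hi : MDifferentiableAt 𝓘(ℝ, F) 𝓘(ℝ, E) i y) {g : X → W}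
    (hg : MDifferentiableAt 𝓘(ℝ, E) 𝓘(ℝ, W) g (i y)) :
    MDifferentiableAt 𝓘(ℝ, F) 𝓘(ℝ, W) (fun p ↦ g (i p)) y ∧
    ∀ v : TangentSpace 𝓘(ℝ, F) y, chartDeriv (F := F) (fun p ↦ g (i p)) y (toModel F y v)
      = chartDeriv (F := E) g (i y) (toModel E (i y) (differential i y v)) := by
  refine ⟨hg.comp y hi, fun v ↦ ?_⟩
  exact congrArg (fun L : TangentSpace 𝓘(ℝ, F) y →L[ℝ] W ↦ L v) (mfderiv_comp y hg hi)

variable {i : Y → X} {y : Y}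

theorem eventually_comp_mem_baseSet (hi : MDifferentiableAt 𝓘(ℝ, F) 𝓘(ℝ, E) i y) :
    ∀ᶠ p in nhds y, i p ∈ (tangentTriv E (i y)).baseSet :=
  hi.continuousAt.eventually (eventually_mem_baseSet (E := E) (i y))

theorem mdiffAlong_iff (hi : MDifferentiableAt 𝓘(ℝ, F) 𝓘(ℝ, E) i y)
    {σ : Π p : Y, TangentSpace 𝓘(ℝ, E) (i p)} :
    MDiffAlong (F := F) i σ y ↔
      MDifferentiableAt 𝓘(ℝ, F) 𝓘(ℝ, E) (fun p ↦ coord E (i y) (i p) (σ p)) y := by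
  rw [MDiffAlong, mdifferentiableAt_totalSpace]
  have h : (fun p ↦ (tangentTriv E (i y) ⟨i p, σ p⟩).2)
      =ᶠ[nhds y] fun p ↦ coord E (i y) (i p) (σ p) := by
    filter_upwards [eventually_comp_mem_baseSet hi] with p hp
    rw [coord_apply hp]
  constructor
  · exact fun hσ ↦ hσ.2.congr_of_eventuallyEq h.symm
  · exact fun hσ ↦ ⟨hi, hσ.congr_of_eventuallyEq h⟩

theorem MDiffAlong.congr {σ τ : Π p : Y, TangentSpace 𝓘(ℝ, E) (i p)}
    (hσ : MDiffAlong (F := F) i σ y) (h : ∀ᶠ p in nhds y, τ p = σ p) :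
    MDiffAlong (F := F) i τ y :=
  MDifferentiableAt.congr_of_eventuallyEq hσ (h.mono fun p hp ↦ by simp only [hp])

theorem MDiffAlong.sub (hi : MDifferentiableAt 𝓘(ℝ, F) 𝓘(ℝ, E) i y)
    {σ τ : Π p : Y, TangentSpace 𝓘(ℝ, E) (i p)} (hσ : MDiffAlong (F := F) i σ y)
    (hτ : MDiffAlong (F := F) i τ y) : MDiffAlong (F := F) i (fun p ↦ σ p - τ p) y := by
  rw [mdiffAlong_iff hi] at hσ hτ ⊢
  simp only [map_sub]
  exact hσ.sub hτ

theorem MDiffAlong.add (hi : MDifferentiableAt 𝓘(ℝ, F) 𝓘(ℝ, E) i y)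
    {σ τ : Π p : Y, TangentSpace 𝓘(ℝ, E) (i p)} (hσ : MDiffAlong (F := F) i σ y)
    (hτ : MDiffAlong (F := F) i τ y) : MDiffAlong (F := F) i (fun p ↦ σ p + τ p) y := by
  rw [mdiffAlong_iff hi] at hσ hτ ⊢
  simp only [map_add]
  exact hσ.add hτ

theorem MDiffAlong.smul (hi : MDifferentiableAt 𝓘(ℝ, F) 𝓘(ℝ, E) i y) {c : Y → ℝ}
    {σ : Π p : Y, TangentSpace 𝓘(ℝ, E) (i p)} (hc : MDifferentiableAt 𝓘(ℝ, F) 𝓘(ℝ, ℝ) c y)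
    (hσ : MDiffAlong (F := F) i σ y) : MDiffAlong (F := F) i (fun p ↦ c p • σ p) y := by
  rw [mdiffAlong_iff hi] at hσ ⊢
  simp only [map_smul]
  exact hc.smul hσ

theorem MDiffAlong.J (K : KahlerStructure E X) (hi : MDifferentiableAt 𝓘(ℝ, F) 𝓘(ℝ, E) i y)
    {σ : Π p : Y, TangentSpace 𝓘(ℝ, E) (i p)} (hσ : MDiffAlong (F := F) i σ y) :
    MDiffAlong (F := F) i (fun p ↦ K.J (i p) (σ p)) y :=
  mdifferentiableAt_J_comp K hi hσ

theorem mdiffAlong_constField (hi : MDifferentiableAt 𝓘(ℝ, F) 𝓘(ℝ, E) i y) (u : E) :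
    MDiffAlong (F := F) i (fun p ↦ constField E (i y) u (i p)) y :=
  (mdifferentiableAt_constField (i y) u).comp y hi

/-- In the coordinates around `i y`, the pulled back connection is the derivative of the
coefficients corrected by the Christoffel symbols. -/
theorem chartDeriv_coord [IsContMDiffRiemannianBundle 𝓘(ℝ, E) ∞ E
      (fun x : X ↦ TangentSpace 𝓘(ℝ, E) x)]
    (hi : MDifferentiableAt 𝓘(ℝ, F) 𝓘(ℝ, E) i y) (σ : Π p : Y, TangentSpace 𝓘(ℝ, E) (i p))
    (v : TangentSpace 𝓘(ℝ, F) y) :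
    chartDeriv (F := F) (fun p ↦ coord E (i y) (i p) (σ p)) y (toModel F y v)
      = toModel E (i y) (pullbackCov i σ y v - christoffel (i y) (differential i y v) (σ y)) := by
  have h : (fun p ↦ (tangentTriv E (i y) ⟨i p, σ p⟩).2)
      =ᶠ[nhds y] fun p ↦ coord E (i y) (i p) (σ p) := by
    filter_upwards [eventually_comp_mem_baseSet hi] with p hp
    rw [coord_apply hp]
  rw [pullbackCov, ← christoffel_apply, add_sub_cancel_right, tangentTriv_symm_self,
    ContinuousLinearEquiv.apply_symm_apply, mvfderiv_eq_chartDeriv_toModel, chartDeriv_congr h]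

variable [IsContMDiffRiemannianBundle 𝓘(ℝ, E) ∞ E (fun x : X ↦ TangentSpace 𝓘(ℝ, E) x)]

/-- The pulled back connection is metric. -/
theorem MDiffAlong.inner (hi : MDifferentiableAt 𝓘(ℝ, F) 𝓘(ℝ, E) i y)
    {σ τ : Π p : Y, TangentSpace 𝓘(ℝ, E) (i p)} (hσ : MDiffAlong (F := F) i σ y)
    (hτ : MDiffAlong (F := F) i τ y) :
    MDifferentiableAt 𝓘(ℝ, F) 𝓘(ℝ, ℝ) (fun p ↦ (inner ℝ (σ p) (τ p) : ℝ)) y ∧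
    ∀ v : TangentSpace 𝓘(ℝ, F) y,
      chartDeriv (F := F) (fun p ↦ (inner ℝ (σ p) (τ p) : ℝ)) y (toModel F y v)
        = inner ℝ (pullbackCov i σ y v) (τ y) + inner ℝ (σ y) (pullbackCov i τ y v) := by
  have hm := mdifferentiableAt_comp_and_chartDeriv hi (mdifferentiableAt_metricHat (i y))
  have h := mdifferentiableAt_clm_apply₂ hm.1 ((mdiffAlong_iff hi).1 hσ) ((mdiffAlong_iff hi).1 hτ)
  have he : (fun p ↦ (Inner.inner ℝ (σ p) (τ p) : ℝ)) =ᶠ[nhds y] fun p ↦ metricHat E (i y) (i p)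
      (coord E (i y) (i p) (σ p)) (coord E (i y) (i p) (τ p)) := by
    filter_upwards [eventually_comp_mem_baseSet hi] with p hp
    rw [metricHat_coord hp]
  refine ⟨h.1.congr_of_eventuallyEq he, fun v ↦ ?_⟩
  rw [chartDeriv_congr he, h.2, hm.2, chartDeriv_coord hi, chartDeriv_coord hi, coord_self,
    coord_self, metricHat_self, metricHat_self]
  have := metricDeriv_eq (i y) (differential i y v) (σ y) (τ y)
  rw [metricDeriv] at this
  rw [this, inner_sub_left, inner_sub_right]
  ring

/-- The pulled back connection commutes with `J`. -/
theorem MDiffAlong.pullbackCov_J (K : KahlerStructure E X)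
    (hi : MDifferentiableAt 𝓘(ℝ, F) 𝓘(ℝ, E) i y)
    {σ : Π p : Y, TangentSpace 𝓘(ℝ, E) (i p)} (hσ : MDiffAlong (F := F) i σ y)
    (v : TangentSpace 𝓘(ℝ, F) y) :
    pullbackCov i (fun p ↦ K.J (i p) (σ p)) y v = K.J (i y) (pullbackCov i σ y v) := by
  have hm := mdifferentiableAt_comp_and_chartDeriv hi (mdifferentiableAt_JHat K (i y))
  have h := (mdifferentiableAt_clm_apply hm.1 ((mdiffAlong_iff hi).1 hσ)).2 (toModel F y v)
  have he : (fun p ↦ coord E (i y) (i p) (K.J (i p) (σ p))) =ᶠ[nhds y]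
      fun p ↦ JHat K (i y) (i p) (coord E (i y) (i p) (σ p)) := by
    filter_upwards [eventually_comp_mem_baseSet hi] with p hp
    rw [JHat_coord K hp]
  rw [← chartDeriv_congr he, chartDeriv_coord hi, hm.2, chartDeriv_coord hi, coord_self,
    ← toModel_JDeriv, JHat_self, ← map_add] at h
  have h' := (toModel E (i y)).injective h
  rw [JDeriv_eq, map_sub] at h'
  rw [sub_eq_iff_eq_add.1 h']
  abel

/-- As `∇Ω = 0`, the derivative of `Ω(σ₁, …, σₙ)` is obtained by differentiating the `σ_j`. -/
theorem MDiffAlong.volume {n : ℕ} (C : CalabiYauStructure E X n)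
    (hi : MDifferentiableAt 𝓘(ℝ, F) 𝓘(ℝ, E) i y)
    {σ : Fin n → Π p : Y, TangentSpace 𝓘(ℝ, E) (i p)} (hσ : ∀ j, MDiffAlong (F := F) i (σ j) y) :
    MDifferentiableAt 𝓘(ℝ, F) 𝓘(ℝ, ℂ) (fun p ↦ C.Ω (i p) (fun j ↦ σ j p)) y ∧
    ∀ v : TangentSpace 𝓘(ℝ, F) y,
      chartDeriv (F := F) (fun p ↦ C.Ω (i p) (fun j ↦ σ j p)) y (toModel F y v)
        = ∑ j, C.Ω (i y) (Function.update (fun j ↦ σ j y) j (pullbackCov i (σ j) y v)) := by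
  have hm := mdifferentiableAt_comp_and_chartDeriv hi (mdifferentiableAt_volumeHat C (i y))
  have h := mdifferentiableAt_alternating_apply hm.1 (fun j ↦ (mdiffAlong_iff hi).1 (hσ j))
  have he : (fun p ↦ C.Ω (i p) (fun j ↦ σ j p)) =ᶠ[nhds y]
      fun p ↦ volumeHat C (i y) (i p) (fun j ↦ coord E (i y) (i p) (σ j p)) := by
    filter_upwards [eventually_comp_mem_baseSet hi] with p hp
    rw [volumeHat_coord C hp]
  refine ⟨h.1.congr_of_eventuallyEq he, fun v ↦ ?_⟩
  rw [chartDeriv_congr he, h.2, hm.2]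
  simp only [coord_self, chartDeriv_coord hi]
  rw [← volumeDeriv_apply, volumeDeriv_eq, ← Finset.sum_add_distrib]
  refine Finset.sum_congr rfl fun j _ ↦ ?_
  have hm : Function.update (fun j ↦ toModel E (i y) (σ j y)) j
      (toModel E (i y) (pullbackCov i (σ j) y v - christoffel (i y) (differential i y v) (σ j y)))
      = fun a ↦ toModel E (i y) (Function.update (fun j ↦ σ j y) j (pullbackCov i (σ j) y v
        - christoffel (i y) (differential i y v) (σ j y)) a) := by
    ext1 a
    rcases eq_or_ne a j with rfl | ha
    · simp
    · simp [ha]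
  rw [hm, volumeHat_self, ContinuousAlternatingMap.map_update_sub]
  ring

end Along

/-! ### Submanifolds: symmetry of the second fundamental form and projections -/

section Submanifold

/-- One step of the Gram–Schmidt process. The formula holds without linear independence: if the
last vector depends on the others, its orthogonal component is zero, and so is the last term. -/
theorem starProjection_span_fin_succ {V : Type*} [NormedAddCommGroup V] [InnerProductSpace ℝ V]
    [FiniteDimensional ℝ V] {m : ℕ} (s : Fin (m + 1) → V) (v : V) :
    (Submodule.span ℝ (Set.range s)).starProjection v
      = (Submodule.span ℝ (Set.range (Fin.init s))).starProjection v
        + (inner ℝ (s (Fin.last m)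
            - (Submodule.span ℝ (Set.range (Fin.init s))).starProjection (s (Fin.last m))) v
          * (inner ℝ (s (Fin.last m)
            - (Submodule.span ℝ (Set.range (Fin.init s))).starProjection (s (Fin.last m)))
              (s (Fin.last m)
            - (Submodule.span ℝ (Set.range (Fin.init s))).starProjection (s (Fin.last m))) : ℝ)⁻¹)
          • (s (Fin.last m)
            - (Submodule.span ℝ (Set.range (Fin.init s))).starProjection (s (Fin.last m))) := by
  set K := Submodule.span ℝ (Set.range (Fin.init s)) with hK
  set n := s (Fin.last m) - K.starProjection (s (Fin.last m)) with hn
  have hKS : K ≤ Submodule.span ℝ (Set.range s) := by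
    refine Submodule.span_mono ?_
    rintro _ ⟨a, rfl⟩
    exact ⟨a.castSucc, rfl⟩
  have hnK : ∀ w ∈ K, inner ℝ n w = 0 := fun w hw ↦ Submodule.starProjection_inner_eq_zero _ w hw
  have hsn : s (Fin.last m) = n + K.starProjection (s (Fin.last m)) := by simp [hn]
  refine Submodule.eq_starProjection_of_mem_of_inner_eq_zero ?_ fun w hw ↦ ?_
  · refine add_mem (hKS (Submodule.starProjection_apply_mem _ _)) (Submodule.smul_mem _ _ ?_)
    exact sub_mem (Submodule.subset_span ⟨_, rfl⟩) (hKS (Submodule.starProjection_apply_mem _ _))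
  · have hperp : ∀ w ∈ K, inner ℝ (v - (K.starProjection v
        + (inner ℝ n v * (inner ℝ n n : ℝ)⁻¹) • n)) w = 0 := fun w hw ↦ by
      rw [← sub_sub, inner_sub_left, Submodule.starProjection_inner_eq_zero _ w hw,
        inner_smul_left, hnK w hw]
      simp
    have hperp' : inner ℝ (v - (K.starProjection v
        + (inner ℝ n v * (inner ℝ n n : ℝ)⁻¹) • n)) n = 0 := by
      have h1 := hnK _ (Submodule.starProjection_apply_mem K v)
      rw [inner_sub_left, inner_add_left, inner_smul_left, real_inner_comm n,
        real_inner_comm n, h1]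
      by_cases h0 : n = 0
      · simp [h0]
      · have : (inner ℝ n n : ℝ) ≠ 0 := by simpa using h0
        rw [conj_trivial, mul_assoc, inv_mul_cancel₀ this, mul_one, zero_add]
        simp
    induction hw using Submodule.span_induction with
    | mem w hw =>
      obtain ⟨a, rfl⟩ := hw
      refine Fin.lastCases ?_ (fun b ↦ ?_) a
      · rw [hsn, inner_add_right, hperp', hperp _ (Submodule.starProjection_apply_mem _ _),
          add_zero]
      · exact hperp _ (Submodule.subset_span ⟨b, rfl⟩)
    | zero => exact inner_zero_right _
    | add w w' _ _ hw hw' => rw [inner_add_right, hw, hw', add_zero]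
    | smul c w _ hw => rw [inner_smul_right, hw, mul_zero]

variable {E : Type*} [NormedAddCommGroup E] [NormedSpace ℝ E] [FiniteDimensional ℝ E]
  {X : Type*} [TopologicalSpace X] [ChartedSpace E X] [IsManifold 𝓘(ℝ, E) ∞ X]
  [Bundle.RiemannianBundle (fun x : X ↦ TangentSpace 𝓘(ℝ, E) x)]
  {F : Type*} [NormedAddCommGroup F] [NormedSpace ℝ F] [FiniteDimensional ℝ F]
  {Y : Type*} [TopologicalSpace Y] [ChartedSpace F Y] [IsManifold 𝓘(ℝ, F) ∞ Y]
  {i : Y → X} {y : Y}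

/-- In coordinates, `di` applied to fields with constant coefficients is the derivative of `i`. -/
theorem coord_differential_constField
    (hi : MDifferentiableAt 𝓘(ℝ, F) 𝓘(ℝ, E) i y)
    (hi' : ∀ᶠ p in nhds y, MDifferentiableAt 𝓘(ℝ, F) 𝓘(ℝ, E) i p) (w : F) :
    (fun p ↦ coord E (i y) (i p) (differential i p (constField F y w p))) =ᶠ[nhds y]
      fun p ↦ fderiv ℝ (extChartAt 𝓘(ℝ, E) (i y) ∘ i ∘ (extChartAt 𝓘(ℝ, F) y).symm)
        (extChartAt 𝓘(ℝ, F) y p) w := by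
  filter_upwards [hi', eventually_mem_baseSet (E := F) y, eventually_comp_mem_baseSet hi,
    extChartAt_source_mem_nhds (I := 𝓘(ℝ, F)) y] with p hip hpY hpX hp
  have hpy : (extChartAt 𝓘(ℝ, F) y).symm (extChartAt 𝓘(ℝ, F) y p) = p :=
    (extChartAt 𝓘(ℝ, F) y).left_inv hp
  have hX : i p ∈ (chartAt E (i y)).source := hpX
  have hY : p ∈ (chartAt F y).source := hpY
  have : IsManifold 𝓘(ℝ, E) 1 X := .of_le (n := ∞) (by simp)
  have : IsManifold 𝓘(ℝ, F) 1 Y := .of_le (n := ∞) (by simp)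
  have d1 : MDifferentiableAt 𝓘(ℝ, E) 𝓘(ℝ, E) (extChartAt 𝓘(ℝ, E) (i y)) (i p) :=
    mdifferentiableAt_extChartAt hX
  have d2 : MDifferentiableWithinAt 𝓘(ℝ, F) 𝓘(ℝ, F) (extChartAt 𝓘(ℝ, F) y).symm
      (Set.range 𝓘(ℝ, F)) (extChartAt 𝓘(ℝ, F) y p) :=
    mdifferentiableWithinAt_extChartAt_symm ((extChartAt 𝓘(ℝ, F) y).map_source hp)
  rw [ModelWithCorners.Boundaryless.range_eq_univ, mdifferentiableWithinAt_univ] at d2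
  have d3 : MDifferentiableAt 𝓘(ℝ, F) 𝓘(ℝ, E) (extChartAt 𝓘(ℝ, E) (i y) ∘ i)
    ((extChartAt 𝓘(ℝ, F) y).symm (extChartAt 𝓘(ℝ, F) y p)) := by
    rw [hpy]; exact d1.comp p hip
  have e1 := mfderiv_comp (extChartAt 𝓘(ℝ, F) y p) d3 d2
  rw [mfderiv_eq_fderiv] at e1
  have e2 : mfderiv 𝓘(ℝ, F) 𝓘(ℝ, E) (extChartAt 𝓘(ℝ, E) (i y) ∘ i) p
    = (mfderiv 𝓘(ℝ, E) 𝓘(ℝ, E) (extChartAt 𝓘(ℝ, E) (i y)) (i p)).comp (differential i p) :=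
    mfderiv_comp p d1 hip
  have e3 := TangentBundle.symmL_trivializationAt (I := 𝓘(ℝ, F)) hY
  rw [ModelWithCorners.Boundaryless.range_eq_univ, mfderivWithin_univ] at e3
  have e4 := TangentBundle.continuousLinearMapAt_trivializationAt (I := 𝓘(ℝ, E)) hX
  rw [constField_eq_symmL hpY]
  have f1 : fderiv ℝ (extChartAt 𝓘(ℝ, E) (i y) ∘ i ∘ (extChartAt 𝓘(ℝ, F) y).symm)
      (extChartAt 𝓘(ℝ, F) y p) w
      = mfderiv 𝓘(ℝ, F) 𝓘(ℝ, E) (extChartAt 𝓘(ℝ, E) (i y) ∘ i)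
        ((extChartAt 𝓘(ℝ, F) y).symm (extChartAt 𝓘(ℝ, F) y p))
        (mfderiv 𝓘(ℝ, F) 𝓘(ℝ, F) (extChartAt 𝓘(ℝ, F) y).symm (extChartAt 𝓘(ℝ, F) y p) w) :=
    congrArg (fun L : F →L[ℝ] E ↦ L w) e1
  rw [f1, coord, e4, hpy]
  refine Eq.trans ?_ (congrArg (fun L : TangentSpace 𝓘(ℝ, F) p →L[ℝ] E ↦
    L ((tangentTriv F y).symmL ℝ p w)) e2).symm |>.trans ?_
  · rfl
  · rw [e3]
    rfl

/-- The fields `di(W)`, for `W` with constant coefficients, are differentiable, and as the second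
derivative of `i` and the Christoffel symbols are symmetric, so is `∇_v di(W)`. -/
theorem differential_constField [IsContMDiffRiemannianBundle 𝓘(ℝ, E) ∞ E
      (fun x : X ↦ TangentSpace 𝓘(ℝ, E) x)]
    (hi : ContMDiff 𝓘(ℝ, F) 𝓘(ℝ, E) ∞ i) (y : Y) :
    (∀ w : F, MDiffAlong (F := F) i (fun p ↦ differential (E := E) i p (constField F y w p)) y) ∧
    ∀ v w : TangentSpace 𝓘(ℝ, F) y,
      pullbackCov i (fun p ↦ differential (E := E) i p (FiberBundle.extend F w p)) y v
        = pullbackCov i (fun p ↦ differential (E := E) i p (FiberBundle.extend F v p)) y w := by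
  have hd : ∀ p, MDifferentiableAt 𝓘(ℝ, F) 𝓘(ℝ, E) i p := hi.mdifferentiable (by simp)
  have he := coord_differential_constField (hd y) (Filter.Eventually.of_forall hd)
  have hy : (extChartAt 𝓘(ℝ, F) y).symm (extChartAt 𝓘(ℝ, F) y y) = y := extChartAt_to_inv y
  set g := extChartAt 𝓘(ℝ, E) (i y) ∘ i ∘ (extChartAt 𝓘(ℝ, F) y).symm with hg
  have hgs : ContDiffAt ℝ ∞ g (extChartAt 𝓘(ℝ, F) y y) := by
    have := (contMDiffAt_iff.1 (hi y)).2
    rwa [ModelWithCorners.Boundaryless.range_eq_univ, contDiffWithinAt_univ] at this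
  have hg2 : HasFDerivAt (fderiv ℝ g) (fderiv ℝ (fderiv ℝ g) (extChartAt 𝓘(ℝ, F) y y))
      (extChartAt 𝓘(ℝ, F) y y) :=
    ((hgs.fderiv_right (m := 1) (by
      rw [one_add_one_eq_two]
      exact ENat.LEInfty.out)).differentiableAt (by simp)).hasFDerivAt
  have hD : ∀ w : F, HasFDerivAt ((fun p ↦ coord E (i y) (i p)
      (differential i p (constField F y w p))) ∘ (extChartAt 𝓘(ℝ, F) y).symm)
      ((ContinuousLinearMap.apply ℝ E w).comp (fderiv ℝ (fderiv ℝ g) (extChartAt 𝓘(ℝ, F) y y)))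
      (extChartAt 𝓘(ℝ, F) y y) := fun w ↦ by
    refine ((ContinuousLinearMap.apply ℝ E w).hasFDerivAt.comp _ hg2).congr_of_eventuallyEq ?_
    have h1 := continuousAt_extChartAt_symm (I := 𝓘(ℝ, F)) y
    rw [ContinuousAt, hy] at h1
    filter_upwards [h1.eventually (he w), extChartAt_target_mem_nhds (I := 𝓘(ℝ, F)) y] with z hz hzt
    rw [Function.comp_apply, hz, (extChartAt 𝓘(ℝ, F) y).right_inv hzt]
    rfl
  have hD' := fun w ↦ (hD w).mdifferentiableAt_and_chartDeriv
  refine ⟨fun w ↦ (mdiffAlong_iff (hd y)).2 (hD' w).1, fun v w ↦ ?_⟩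
  have hcov : ∀ v w : TangentSpace 𝓘(ℝ, F) y,
      toModel E (i y) (pullbackCov i (fun p ↦ differential (E := E) i p
        (FiberBundle.extend F w p)) y v)
      = fderiv ℝ (fderiv ℝ g) (extChartAt 𝓘(ℝ, F) y y) (toModel F y v) (toModel F y w)
        + toModel E (i y) (christoffel (i y) (differential i y v) (differential i y w)) :=
    fun v w ↦ by
      have h1 := chartDeriv_coord (hd y) (fun p ↦ differential (E := E) i p
        (FiberBundle.extend F w p)) v
      have h2 := (hD' (toModel F y w)).2 (toModel F y v)
      rw [extend_eq_constField, h2, constField_self, ContinuousLinearEquiv.symm_apply_apply,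
        map_sub] at h1
      rw [extend_eq_constField]
      exact (eq_add_of_sub_eq h1.symm)
  apply (toModel E (i y)).injective
  rw [hcov, hcov, christoffel_comm]
  congr 1
  exact hgs.isSymmSndFDerivAt (by simpa using ENat.LEInfty.out) _ _

variable [IsContMDiffRiemannianBundle 𝓘(ℝ, E) ∞ E (fun x : X ↦ TangentSpace 𝓘(ℝ, E) x)]

/-- The orthogonal projection of a differentiable section onto the span of a differentiable frame is
differentiable. -/
theorem MDiffAlong.starProjection_span (hi : MDifferentiableAt 𝓘(ℝ, F) 𝓘(ℝ, E) i y) {m : ℕ}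
    {s : Fin m → Π p : Y, TangentSpace 𝓘(ℝ, E) (i p)} (hs : ∀ a, MDiffAlong (F := F) i (s a) y)
    (hli : LinearIndependent ℝ fun a ↦ s a y) {σ : Π p : Y, TangentSpace 𝓘(ℝ, E) (i p)}
    (hσ : MDiffAlong (F := F) i σ y) :
    MDiffAlong (F := F) i
      (fun p ↦ (Submodule.span ℝ (Set.range fun a ↦ s a p)).starProjection (σ p)) y := by
  induction m generalizing σ with
  | zero =>
    refine (hσ.sub hi hσ).congr (Filter.Eventually.of_forall fun p ↦ ?_)
    simp
  | succ m ih =>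
    have hli' := linearIndependent_finSucc'.1 hli
    have ih' : ∀ {σ : Π p : Y, TangentSpace 𝓘(ℝ, E) (i p)}, MDiffAlong (F := F) i σ y →
        MDiffAlong (F := F) i (fun p ↦ (Submodule.span ℝ (Set.range (Fin.init fun a ↦
          s a p))).starProjection (σ p)) y := fun hσ ↦
      ih (s := fun a ↦ s a.castSucc) (fun a ↦ hs _) hli'.1 hσ
    have hn := (hs (Fin.last m)).sub hi (ih' (hs (Fin.last m)))
    have hnn : (Inner.inner ℝ (s (Fin.last m) y - (Submodule.span ℝ (Set.range (Fin.init fun a ↦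
          s a y))).starProjection (s (Fin.last m) y)) (s (Fin.last m) y -
          (Submodule.span ℝ (Set.range (Fin.init fun a ↦
          s a y))).starProjection (s (Fin.last m) y)) : ℝ) ≠ 0 := by
      rw [Ne, inner_self_eq_zero, sub_eq_zero]
      intro h
      exact hli'.2 (h ▸ Submodule.starProjection_apply_mem _ _)
    refine ((ih' hσ).add hi (MDiffAlong.smul hi ?_ hn)).congr
      (Filter.Eventually.of_forall fun p ↦ starProjection_span_fin_succ _ _)
    exact (mdifferentiableAt_mul (hn.inner hi hσ).1
      (mdifferentiableAt_inv (hn.inner hi hn).1 hnn).1).1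

end Submanifold

/-! ### Coisotropic submanifolds and their null foliation -/

section Coisotropic

variable {E : Type*} [NormedAddCommGroup E] [NormedSpace ℝ E] [FiniteDimensional ℝ E]
  {X : Type*} [TopologicalSpace X] [ChartedSpace E X] [IsManifold 𝓘(ℝ, E) ∞ X]
  [Bundle.RiemannianBundle (fun x : X ↦ TangentSpace 𝓘(ℝ, E) x)]
  {F : Type*} [NormedAddCommGroup F] [NormedSpace ℝ F] [FiniteDimensional ℝ F]
  {Y : Type*} [TopologicalSpace Y] [ChartedSpace F Y] [IsManifold 𝓘(ℝ, F) ∞ Y]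
  {i : Y → X}

theorem mem_symplecticNormal_iff (K : KahlerStructure E X) (y : Y)
    (v : TangentSpace 𝓘(ℝ, E) (i y)) :
    v ∈ symplecticNormal (F := F) K i y ↔ K.J (i y) v ∈ (tangentImage (F := F) i y)ᗮ := by
  rw [Submodule.mem_orthogonal']
  exact forall₂_congr fun w _ ↦ by rw [symp_eq_inner]

theorem J_mem_symplecticNormal (K : KahlerStructure E X) (y : Y)
    {v : TangentSpace 𝓘(ℝ, E) (i y)} (hv : v ∈ (tangentImage (F := F) i y)ᗮ) :
    K.J (i y) v ∈ symplecticNormal (F := F) K i y := by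
  rw [mem_symplecticNormal_iff, K.J_J]
  exact neg_mem hv

/-- As `J` maps `(TY)^ω` onto the normal space of `Y`, it intertwines the two projections. -/
theorem starProjection_symplecticNormal (K : KahlerStructure E X) (y : Y)
    (v : TangentSpace 𝓘(ℝ, E) (i y)) :
    (symplecticNormal (F := F) K i y).starProjection v
      = -K.J (i y) ((tangentImage (F := F) i y)ᗮ.starProjection (K.J (i y) v)) := by
  refine Submodule.eq_starProjection_of_mem_of_inner_eq_zero (neg_mem (J_mem_symplecticNormal K y
    (Submodule.starProjection_apply_mem _ _))) fun w hw ↦ ?_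
  have h := Submodule.starProjection_inner_eq_zero (K := (tangentImage (F := F) i y)ᗮ)
    (K.J (i y) v) _ ((mem_symplecticNormal_iff K y w).1 hw)
  rw [← apply_inner_apply (K.J_J _) (K.inner_J _), map_sub, map_neg, K.J_J, neg_neg]
  exact h

namespace IsCoisotropicSubmanifold

variable {K : KahlerStructure E X} {l k : ℕ} (h : IsCoisotropicSubmanifold (F := F) K l k i) (y : Y)

include h

theorem map_nullDistribution :
    (nullDistribution K i y).map (differential (F := F) i y).toLinearMap
      = symplecticNormal (F := F) K i y := by
  rw [nullDistribution, Submodule.map_comap_eq]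
  exact inf_eq_right.2 (h.coisotropic y)

theorem mem_horizontalSpace_iff {v : TangentSpace 𝓘(ℝ, E) (i y)} :
    v ∈ horizontalSpace (F := F) K i y
      ↔ v ∈ tangentImage (F := F) i y ∧ v ∈ (symplecticNormal (F := F) K i y)ᗮ := by
  rw [horizontalSpace, h.map_nullDistribution, Submodule.mem_inf]

theorem starProjection_horizontalSpace (v : TangentSpace 𝓘(ℝ, E) (i y)) :
    (horizontalSpace (F := F) K i y).starProjection v
      = (tangentImage (F := F) i y).starProjection v
        - (symplecticNormal (F := F) K i y).starProjection v := by
  refine Submodule.eq_starProjection_of_mem_of_inner_eq_zero ?_ fun w hw ↦ ?_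
  · refine (h.mem_horizontalSpace_iff y).2 ⟨sub_mem (Submodule.starProjection_apply_mem _ _)
      (h.coisotropic y (Submodule.starProjection_apply_mem _ _)),
      (Submodule.mem_orthogonal' _ _).2 fun w hw ↦ ?_⟩
    have h1 := Submodule.starProjection_inner_eq_zero (K := tangentImage (F := F) i y) v w
      (h.coisotropic y hw)
    have h2 := Submodule.starProjection_inner_eq_zero (K := symplecticNormal (F := F) K i y) v w hw
    rw [inner_sub_left] at h1 h2 ⊢
    linarith
  · obtain ⟨hw, hw'⟩ := (h.mem_horizontalSpace_iff y).1 hw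
    rw [← sub_add, inner_add_left, Submodule.starProjection_inner_eq_zero _ w hw,
      (Submodule.mem_orthogonal _ _).1 hw' _ (Submodule.starProjection_apply_mem _ _), add_zero]

theorem mdifferentiableAt : MDifferentiableAt 𝓘(ℝ, F) 𝓘(ℝ, E) i y :=
  h.isSmoothEmbedding.contMDiff.mdifferentiable (by simp) y

variable [IsContMDiffRiemannianBundle 𝓘(ℝ, E) ∞ E (fun x : X ↦ TangentSpace 𝓘(ℝ, E) x)] {y}

/-- The projection onto `TY` preserves differentiability, as the images of the fields with constant
coefficients form a frame of `TY`. -/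
theorem mdiffAlong_tangentImage {σ : Π p : Y, TangentSpace 𝓘(ℝ, E) (i p)}
    (hσ : MDiffAlong (F := F) i σ y) :
    MDiffAlong (F := F) i (fun p ↦ (tangentImage (F := F) i p).starProjection (σ p)) y := by
  let b := Module.finBasis ℝ F
  have hs := MDiffAlong.starProjection_span (h.mdifferentiableAt y)
    (s := fun a p ↦ differential (E := E) i p (constField F y (b a) p))
    (fun a ↦ (differential_constField h.isSmoothEmbedding.contMDiff y).1 (b a)) ?_ hσ
  · refine hs.congr ?_
    filter_upwards [eventually_mem_baseSet (E := F) y] with p hp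
    have hspan : tangentImage (F := F) i p = Submodule.span ℝ (Set.range fun a ↦
        differential (E := E) i p (constField F y (b a) p)) := by
      have h1 : Submodule.span ℝ (Set.range fun a ↦ constField F y (b a) p) = ⊤ := by
        have h2 : (Set.range fun a ↦ constField F y (b a) p)
            = ((tangentTriv F y).symmL ℝ p).toLinearMap '' Set.range b := by
          rw [← Set.range_comp]
          exact congrArg Set.range (funext fun a ↦ constField_eq_symmL hp _)
        rw [h2, Submodule.span_image, b.span_eq, Submodule.map_top, LinearMap.range_eq_top]
        intro v
        exact ⟨coord F y p v, (constField_eq_symmL hp _).symm.trans (constField_coord hp v)⟩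
      have h3 : (Set.range fun a ↦ differential (E := E) i p (constField F y (b a) p))
          = (differential (E := E) (F := F) i p).toLinearMap ''
            Set.range fun a ↦ constField F y (b a) p := by
        rw [← Set.range_comp]
        rfl
      rw [h3, Submodule.span_image, h1, Submodule.map_top, tangentImage]
    rw [hspan]
  · have h1 : (fun a ↦ differential (E := E) i y (constField F y (b a) y))
        = (differential (E := E) (F := F) i y).toLinearMap ∘ ((toModel F y).symm ∘ b) := by
      ext1 a
      simp [constField_self]
    rw [h1]
    refine LinearIndependent.map' ?_ _ (LinearMap.ker_eq_bot.2 (h.differential_injective y))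
    exact b.linearIndependent.map' (toModel F y).symm.toLinearMap
      (LinearMap.ker_eq_bot.2 (toModel F y).symm.injective)

theorem mdiffAlong_tangentImage_orthogonal {σ : Π p : Y, TangentSpace 𝓘(ℝ, E) (i p)}
    (hσ : MDiffAlong (F := F) i σ y) :
    MDiffAlong (F := F) i (fun p ↦ (tangentImage (F := F) i p)ᗮ.starProjection (σ p)) y :=
  (hσ.sub (h.mdifferentiableAt y) (h.mdiffAlong_tangentImage hσ)).congr
    (Filter.Eventually.of_forall fun _ ↦ Submodule.starProjection_orthogonal_val _)

theorem mdiffAlong_symplecticNormal {σ : Π p : Y, TangentSpace 𝓘(ℝ, E) (i p)}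
    (hσ : MDiffAlong (F := F) i σ y) :
    MDiffAlong (F := F) i
      (fun p ↦ (symplecticNormal (F := F) K i p).starProjection (σ p)) y := by
  have hi := h.mdifferentiableAt y
  have h1 := (h.mdiffAlong_tangentImage_orthogonal (hσ.J K hi)).J K hi
  refine (h1.sub hi (h1.add hi h1)).congr (Filter.Eventually.of_forall fun p ↦ ?_)
  simp only [starProjection_symplecticNormal]
  abel

theorem mdiffAlong_horizontalSpace {σ : Π p : Y, TangentSpace 𝓘(ℝ, E) (i p)}
    (hσ : MDiffAlong (F := F) i σ y) :
    MDiffAlong (F := F) i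
      (fun p ↦ (horizontalSpace (F := F) K i p).starProjection (σ p)) y :=
  ((h.mdiffAlong_tangentImage hσ).sub (h.mdifferentiableAt y)
    (h.mdiffAlong_symplecticNormal hσ)).congr
    (Filter.Eventually.of_forall fun p ↦ h.starProjection_horizontalSpace p _)

/-- The normal component of `∇_v σ`, for a field `σ` tangent to `Y`, depends only on the value of
`σ`: pair `σ` with a normal field. -/
theorem inner_pullbackCov_of_mem_tangentImage {σ : Π p : Y, TangentSpace 𝓘(ℝ, E) (i p)}
    (hσ : MDiffAlong (F := F) i σ y) (hσT : ∀ p, σ p ∈ tangentImage (F := F) i p)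
    (v w : TangentSpace 𝓘(ℝ, F) y) (hw : σ y = differential i y w)
    {ν : TangentSpace 𝓘(ℝ, E) (i y)} (hν : ν ∈ (tangentImage (F := F) i y)ᗮ) :
    inner ℝ (pullbackCov i σ y v) ν = inner ℝ (secondFundamentalForm i y v w) ν := by
  have hi := h.mdifferentiableAt y
  let n : Π p : Y, TangentSpace 𝓘(ℝ, E) (i p) := fun p ↦
    (tangentImage (F := F) i p)ᗮ.starProjection (constField E (i y) (toModel E (i y) ν) (i p))
  have hn : MDiffAlong (F := F) i n y :=
    h.mdiffAlong_tangentImage_orthogonal (mdiffAlong_constField hi _)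
  have hny : n y = ν := by
    simp only [n]
    rw [constField_self, ContinuousLinearEquiv.symm_apply_apply,
      Submodule.starProjection_eq_self_iff.2 hν]
  have key : ∀ τ : Π p : Y, TangentSpace 𝓘(ℝ, E) (i p), MDiffAlong (F := F) i τ y →
      (∀ p, τ p ∈ tangentImage (F := F) i p) →
      inner ℝ (pullbackCov i τ y v) ν = -inner ℝ (τ y) (pullbackCov i n y v) := fun τ hτ hτT ↦ by
    have h1 := (hτ.inner hi hn).2 v
    rw [chartDeriv_eq_zero_of_eventually_eq (c := (0 : ℝ)), hny] at h1
    · rw [eq_neg_iff_add_eq_zero, ← h1]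
      rfl
    · refine Filter.Eventually.of_forall fun p ↦ ?_
      exact (Submodule.mem_orthogonal _ _).1 (Submodule.starProjection_apply_mem _ _) _ (hτT p)
  have h2 : MDiffAlong (F := F) i
      (fun p ↦ differential (E := E) i p (FiberBundle.extend F w p)) y := by
    rw [extend_eq_constField]
    exact (differential_constField h.isSmoothEmbedding.contMDiff y).1 _
  rw [secondFundamentalForm, Submodule.inner_starProjection_left_eq_right,
    Submodule.starProjection_eq_self_iff.2 hν, key σ hσ hσT, key _ h2 fun p ↦ ⟨_, rfl⟩, hw,
    FiberBundle.extend_apply_self]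

theorem secondFundamentalForm_comm (v w : TangentSpace 𝓘(ℝ, F) y) :
    secondFundamentalForm (E := E) i y v w = secondFundamentalForm i y w v := by
  rw [secondFundamentalForm, secondFundamentalForm,
    (differential_constField h.isSmoothEmbedding.contMDiff y).2 v w]

end IsCoisotropicSubmanifold

/-- A section of `(TY)^ω` through the vector `u` at `y`: the projection of the field with constant
coefficients through `u`. -/
def nullSection (K : KahlerStructure E X) (i : Y → X) (y : Y) (u : TangentSpace 𝓘(ℝ, E) (i y))
    (p : Y) : TangentSpace 𝓘(ℝ, E) (i p) :=
  (symplecticNormal (F := F) K i p).starProjection (constField E (i y) (toModel E (i y) u) (i p))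

theorem nullSection_mem (K : KahlerStructure E X) (i : Y → X) (y : Y)
    (u : TangentSpace 𝓘(ℝ, E) (i y)) (p : Y) :
    nullSection (F := F) K i y u p ∈ symplecticNormal (F := F) K i p :=
  Submodule.starProjection_apply_mem _ _

theorem nullSection_self (K : KahlerStructure E X) {i : Y → X} {y : Y}
    {u : TangentSpace 𝓘(ℝ, E) (i y)} (hu : u ∈ symplecticNormal (F := F) K i y) :
    nullSection (F := F) K i y u y = u := by
  rw [nullSection, constField_self, ContinuousLinearEquiv.symm_apply_apply,
    Submodule.starProjection_eq_self_iff.2 hu]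

namespace IsCoisotropicSubmanifold

variable [IsContMDiffRiemannianBundle 𝓘(ℝ, E) ∞ E (fun x : X ↦ TangentSpace 𝓘(ℝ, E) x)]
  {K : KahlerStructure E X} {l k : ℕ} (h : IsCoisotropicSubmanifold (F := F) K l k i) {y : Y}

include h

theorem mdiffAlong_nullSection (u : TangentSpace 𝓘(ℝ, E) (i y)) :
    MDiffAlong (F := F) i (nullSection (F := F) K i y u) y :=
  h.mdiffAlong_symplecticNormal (mdiffAlong_constField (h.mdifferentiableAt y) _)

/-- `⟨S(v, w), J u⟩`, for `w` and `u` tangent to the null foliation, is computed by the section of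
`(TY)^ω` through `w`. -/
theorem inner_pullbackCov_nullSection {v w u : TangentSpace 𝓘(ℝ, F) y}
    (hw : w ∈ nullDistribution K i y) (hu : u ∈ nullDistribution K i y) :
    inner ℝ (pullbackCov i (nullSection (F := F) K i y (differential i y w)) y v)
        (K.J (i y) (differential i y u))
      = inner ℝ (secondFundamentalForm i y v w) (K.J (i y) (differential i y u)) :=
  h.inner_pullbackCov_of_mem_tangentImage (h.mdiffAlong_nullSection _)
    (fun p ↦ h.coisotropic p (nullSection_mem K i y _ p)) v w (nullSection_self K hw)
    ((mem_symplecticNormal_iff K y _).1 hu)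

/-- The symmetry of the second fundamental form of a coisotropic submanifold along its null
foliation, obtained by differentiating `⟨φ, J ψ⟩ = 0` for sections `φ`, `ψ` of `(TY)^ω`. -/
theorem inner_secondFundamentalForm_J_comm {v w u : TangentSpace 𝓘(ℝ, F) y}
    (hw : w ∈ nullDistribution K i y) (hu : u ∈ nullDistribution K i y) :
    inner ℝ (secondFundamentalForm i y v w) (K.J (i y) (differential i y u))
      = inner ℝ (secondFundamentalForm i y v u) (K.J (i y) (differential i y w)) := by
  have hi := h.mdifferentiableAt y
  have hφ := h.mdiffAlong_nullSection (differential i y w)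
  have hψ := h.mdiffAlong_nullSection (differential i y u)
  have h1 := (hφ.inner hi (hψ.J K hi)).2 v
  rw [chartDeriv_eq_zero_of_eventually_eq (c := (0 : ℝ)), hψ.pullbackCov_J K hi,
    nullSection_self K (u := differential i y w) hw,
    nullSection_self K (u := differential i y u) hu, h.inner_pullbackCov_nullSection hw hu] at h1
  · have h2 := K.inner_J (i y) (differential i y w)
      (pullbackCov i (nullSection (F := F) K i y (differential i y u)) y v)
    rw [real_inner_comm, h.inner_pullbackCov_nullSection hu hw] at h2
    have h3 : (0 : ℝ) = _ := h1
    linarith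
  · refine Filter.Eventually.of_forall fun p ↦ ?_
    exact (Submodule.mem_orthogonal _ _).1 ((mem_symplecticNormal_iff K p _).1
      (nullSection_mem K i y _ p)) _ (h.coisotropic p (nullSection_mem K i y _ p))

/-- The rotation `∑ ⟨∇_v f_a, J e_a⟩` of a leafwise frame `f` with `f(y) = e` is minus the leafwise
mean curvature form: by the symmetries of `S` it equals `∑ ⟨S(e_a, e_a), J v⟩`. -/
theorem sum_inner_pullbackCov_nullSection {v : TangentSpace 𝓘(ℝ, F) y}
    (hv : v ∈ nullDistribution K i y) :
    ∑ a, inner ℝ (pullbackCov i (nullSection (F := F) K i y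
        (differential i y (leafFrame h y a))) y v) (K.J (i y) (differential i y (leafFrame h y a)))
      = -leafwiseMeanCurvatureForm h y v := by
  have he := (isLeafFrame_leafFrame h y).1
  have h1 : leafwiseMeanCurvatureForm h y v
      = -inner ℝ (leafwiseMeanCurvature h y) (K.J (i y) (differential i y v)) := by
    rw [← K.inner_J, ← symp_eq_inner]
    rfl
  rw [h1, neg_neg, leafwiseMeanCurvature, sum_inner]
  refine Finset.sum_congr rfl fun a _ ↦ ?_
  rw [h.inner_pullbackCov_nullSection (he a) (he a), h.secondFundamentalForm_comm v,
    h.inner_secondFundamentalForm_J_comm hv (he a)]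

end IsCoisotropicSubmanifold

end Coisotropic

/-! ### The covariant derivative of the Maslov charge -/

section MaslovCharge

theorem append_update_left {V : Type*} {l k : ℕ} [DecidableEq (Fin l)] (e : Fin l → V)
    (η : Fin k → V) (a : Fin l) (v : V) :
    Fin.append (Function.update e a v) η
      = Function.update (Fin.append e η) (Fin.castAdd k a) v := by
  ext m
  refine Fin.addCases (fun b ↦ ?_) (fun b ↦ ?_) m
  · simp [Function.update_apply]
  · have hne : Fin.natAdd l b ≠ Fin.castAdd k a := fun h ↦ by
      have := congrArg Fin.val h
      simp at this
      omega
    simp [hne]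

/-- The form `e ↦ Ω(e₁, …, e_l, η₁, …, η_k)` in the first `l` arguments, for fixed `η`. -/
def contractTail {V : Type*} [AddCommGroup V] [Module ℝ V] {l k : ℕ}
    (Ω : V [⋀^Fin (l + k)]→ₗ[ℝ] ℂ) (η : Fin k → V) : V [⋀^Fin l]→ₗ[ℝ] ℂ where
  toFun e := Ω (Fin.append e η)
  map_update_add' {_} e a v w := by simp [append_update_left]
  map_update_smul' {_} e a c v := by simp [append_update_left]
  map_eq_zero_of_eq' e a b hab hne := by
    refine Ω.map_eq_zero_of_eq _ (i := Fin.castAdd k a) (j := Fin.castAdd k b)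
      (by simpa using hab) ?_
    simpa using hne

variable {E : Type*} [NormedAddCommGroup E] [NormedSpace ℝ E] [FiniteDimensional ℝ E]
  {X : Type*} [TopologicalSpace X] [ChartedSpace E X] [IsManifold 𝓘(ℝ, E) ∞ X]
  [Bundle.RiemannianBundle (fun x : X ↦ TangentSpace 𝓘(ℝ, E) x)]
  {F : Type*} [NormedAddCommGroup F] [NormedSpace ℝ F] [FiniteDimensional ℝ F]
  {Y : Type*} [TopologicalSpace Y] [ChartedSpace F Y] [IsManifold 𝓘(ℝ, F) ∞ Y]
  {i : Y → X}

theorem evalTensor_canonicalMaslovCharge {l k : ℕ} (C : CalabiYauStructure E X (l + k))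
    (h : IsCoisotropicSubmanifold (F := F) C.toKahlerStructure l k i) (p : Y)
    (η η' : Fin k → TangentSpace 𝓘(ℝ, E) (i p)) :
    evalTensor η η' (canonicalMaslovCharge C h p)
      = C.Ω (i p) (Fin.append (fun a ↦ differential i p (leafFrame h p a)) η)
        * C.Ω (i p) (Fin.append (fun a ↦ differential i p (leafFrame h p a)) η') := rfl

namespace IsCoisotropicSubmanifold

section Kahler

variable {K : KahlerStructure E X} {l k : ℕ} (h : IsCoisotropicSubmanifold (F := F) K l k i) (y : Y)

include h

theorem hermitian_eq_zero {y : Y} {v u : TangentSpace 𝓘(ℝ, E) (i y)}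
    (hv : v ∈ horizontalSpace (F := F) K i y) (hu : u ∈ symplecticNormal (F := F) K i y) :
    hermitian (K.J (i y)) v u = 0 := by
  obtain ⟨hv1, hv2⟩ := (h.mem_horizontalSpace_iff y).1 hv
  rw [hermitian, (Submodule.mem_orthogonal' _ _).1 hv2 u hu,
    (Submodule.mem_orthogonal _ _).1 ((mem_symplecticNormal_iff K y u).1 hu) v hv1]
  simp

theorem isUnitaryFamily_leafFrame :
    IsUnitaryFamily (K.J (i y)) fun a ↦ differential (E := E) i y (leafFrame h y a) := by
  have he := isLeafFrame_leafFrame h y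
  refine ⟨he.2, fun a b ↦ ?_⟩
  rw [← symp_eq_inner]
  exact (he.1 a) _ ⟨_, rfl⟩

theorem symplecticNormal_le_span_leafFrame :
    symplecticNormal (F := F) K i y
      ≤ Submodule.span ℝ (Set.range fun a ↦ differential (E := E) i y (leafFrame h y a)) := by
  have he := isLeafFrame_leafFrame h y
  refine (Submodule.eq_of_le_of_finrank_eq (Submodule.span_le.2 ?_) ?_).ge
  · rintro _ ⟨a, rfl⟩
    exact he.1 a
  · rw [finrank_span_eq_card he.2.linearIndependent, h.finrank_symplecticNormal y,
      Fintype.card_fin]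

theorem exists_isUnitaryFamily_append :
    ∃ ε : Fin k → TangentSpace 𝓘(ℝ, E) (i y), IsUnitaryFamily (K.J (i y))
      (Fin.append (fun a ↦ differential (E := E) i y (leafFrame h y a)) ε) := by
  have hn : Module.finrank ℝ (TangentSpace 𝓘(ℝ, E) (i y)) = 2 * (l + k) := h.finrank_ambient
  exact (h.isUnitaryFamily_leafFrame y).exists_append (K.inner_J _) k hn.ge

/-- `∇ - ∇^H` takes values in `T𝓕 ⊕ NY`. -/
theorem sub_starProjection_horizontalSpace_mem (x : TangentSpace 𝓘(ℝ, E) (i y)) :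
    x - (horizontalSpace (F := F) K i y).starProjection x
      ∈ (nullDistribution K i y).map (differential (F := F) i y).toLinearMap ⊔
        (tangentImage (F := F) i y)ᗮ := by
  rw [h.map_nullDistribution, h.starProjection_horizontalSpace, ← sub_add, add_comm]
  exact Submodule.add_mem_sup (Submodule.starProjection_apply_mem _ _)
    (Submodule.sub_starProjection_mem_orthogonal _)

end Kahler

variable [IsContMDiffRiemannianBundle 𝓘(ℝ, E) ∞ E (fun x : X ↦ TangentSpace 𝓘(ℝ, E) x)]
  {l k : ℕ} {C : CalabiYauStructure E X (l + k)}
  (h : IsCoisotropicSubmanifold (F := F) C.toKahlerStructure l k i) {y : Y}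

/-- Replacing the member `e_a` of the leafwise frame by `x`, next to horizontal vectors, multiplies
`Ω` by the Hermitian product of `x` and `e_a`. -/
theorem volume_update_leafFrame {η : Fin k → TangentSpace 𝓘(ℝ, E) (i y)}
    (hη : ∀ j, η j ∈ horizontalSpace (F := F) C.toKahlerStructure i y) (a : Fin l)
    (x : TangentSpace 𝓘(ℝ, E) (i y)) :
    C.Ω (i y) (Function.update (Fin.append (fun a ↦ differential i y (leafFrame h y a)) η)
        (Fin.castAdd k a) x)
      = hermitian (C.J (i y)) x (differential i y (leafFrame h y a))
        * C.Ω (i y) (Fin.append (fun a ↦ differential i y (leafFrame h y a)) η) := by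
  obtain ⟨ε, hε⟩ := h.exists_isUnitaryFamily_append y
  have hcard : Module.finrank ℝ (TangentSpace 𝓘(ℝ, E) (i y)) = 2 * Fintype.card (Fin (l + k)) := by
    rw [Fintype.card_fin]
    exact h.finrank_ambient
  have h1 := hε.map_update (C.J_J _) (C.inner_J _) hcard (C.Ω (i y)).toAlternatingMap (C.type_Ω _)
    (Fin.append (fun a ↦ differential i y (leafFrame h y a)) η) (Fin.castAdd k a) ?_ x
  · have h2 : Function.update (Fin.append (fun a ↦ differential i y (leafFrame h y a)) η)
        (Fin.castAdd k a) (differential i y (leafFrame h y a))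
        = Fin.append (fun a ↦ differential i y (leafFrame h y a)) η :=
      Function.update_eq_self_iff.2 (by rw [Fin.append_left])
    rw [Fin.append_left, h2] at h1
    exact h1
  · intro b hb
    rw [Fin.append_left]
    induction b using Fin.addCases with
    | left b =>
      rw [Fin.append_left]
      exact (h.isUnitaryFamily_leafFrame y).hermitian_eq_zero fun hba ↦ hb (hba ▸ rfl)
    | right b =>
      rw [Fin.append_right]
      exact h.hermitian_eq_zero (hη b) ((isLeafFrame_leafFrame h y).1 a)

/-- Differentiating `Ω(f₁, …, f_l, η₁, …, η_k)` for the frame `f` of `T𝓕` which is the leafwise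
frame at `y`, and horizontal sections `η`. -/
theorem volume_append_nullSection {η : Fin k → Π p : Y, TangentSpace 𝓘(ℝ, E) (i p)}
    (hη : ∀ j, IsHorizontalSectionAt (F := F) C.toKahlerStructure i (η j) y) :
    MDifferentiableAt 𝓘(ℝ, F) 𝓘(ℝ, ℂ) (fun p ↦ C.Ω (i p) (Fin.append
      (fun a ↦ nullSection (F := F) C.toKahlerStructure i y (differential i y (leafFrame h y a)) p)
      (fun j ↦ η j p))) y ∧
    ∀ v : TangentSpace 𝓘(ℝ, F) y, chartDeriv (F := F) (fun p ↦ C.Ω (i p) (Fin.append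
        (fun a ↦ nullSection (F := F) C.toKahlerStructure i y
          (differential i y (leafFrame h y a)) p) (fun j ↦ η j p))) y (toModel F y v)
      = (∑ a, hermitian (C.J (i y)) (pullbackCov i (nullSection (F := F) C.toKahlerStructure i y
            (differential i y (leafFrame h y a))) y v) (differential i y (leafFrame h y a)))
          * C.Ω (i y) (Fin.append (fun a ↦ differential i y (leafFrame h y a)) (fun j ↦ η j y))
        + ∑ j, C.Ω (i y) (Fin.append (fun a ↦ differential i y (leafFrame h y a))
          (Function.update (fun j ↦ η j y) j
            (horizontalCov C.toKahlerStructure i (η j) y v))) := by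
  have hi := h.mdifferentiableAt y
  let f : Fin l → Π p : Y, TangentSpace 𝓘(ℝ, E) (i p) := fun a ↦
    nullSection (F := F) C.toKahlerStructure i y (differential i y (leafFrame h y a))
  have hfy : ∀ a, f a y = differential i y (leafFrame h y a) := fun a ↦
    nullSection_self C.toKahlerStructure ((isLeafFrame_leafFrame h y).1 a)
  let s : Fin (l + k) → Π p : Y, TangentSpace 𝓘(ℝ, E) (i p) := Fin.append f η
  have hs : ∀ m, MDiffAlong (F := F) i (s m) y := fun m ↦ by
    induction m using Fin.addCases with
    | left a =>
      simp only [s, Fin.append_left]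
      exact h.mdiffAlong_nullSection _
    | right j =>
      simp only [s, Fin.append_right]
      exact (hη j).2
  have hsp : ∀ p, (fun m ↦ s m p) = Fin.append (fun a ↦ f a p) (fun j ↦ η j p) := fun p ↦ by
    ext1 m
    induction m using Fin.addCases with
    | left a => simp only [s, Fin.append_left]
    | right j => simp only [s, Fin.append_right]
  have hv := MDiffAlong.volume C hi hs
  simp only [hsp, hfy, Fin.sum_univ_add] at hv
  refine ⟨hv.1, fun v ↦ (hv.2 v).trans ?_⟩
  congr 1
  · rw [Finset.sum_mul]
    refine Finset.sum_congr rfl fun a _ ↦ ?_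
    rw [h.volume_update_leafFrame fun j ↦ (hη j).1 y]
    simp only [s, Fin.append_left]
    rfl
  · refine Finset.sum_congr rfl fun j _ ↦ ?_
    simp only [s, Fin.append_right, ← append_update]
    rw [horizontalCov, ← sub_eq_zero]
    have hc := contract_mem_transverseCanonical h y (C.type_Ω (i y)) (isLeafFrame_leafFrame h y)
    have h0 := hc.2 (Function.update (fun j ↦ η j y) j (pullbackCov i (η j) y v
      - (horizontalSpace (F := F) C.toKahlerStructure i y).starProjection
        (pullbackCov i (η j) y v))) j (by
          rw [Function.update_self]
          exact h.sub_starProjection_horizontalSpace_mem y _)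
    rw [ContinuousAlternatingMap.map_update_sub] at h0
    exact h0

/-- `∇_v Δ = -2 i α(v) Δ` along the leaves. -/
theorem maslovCov_canonicalMaslovCharge {v : TangentSpace 𝓘(ℝ, F) y}
    (hv : v ∈ nullDistribution C.toKahlerStructure i y)
    {η η' : Fin k → Π p : Y, TangentSpace 𝓘(ℝ, E) (i p)}
    (hη : ∀ j, IsHorizontalSectionAt (F := F) C.toKahlerStructure i (η j) y)
    (hη' : ∀ j, IsHorizontalSectionAt (F := F) C.toKahlerStructure i (η' j) y) :
    maslovCov (canonicalMaslovCharge C h) y v η η'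
      = -(2 * Complex.I * leafwiseMeanCurvatureForm h y v)
        * evalTensor (fun j ↦ η j y) (fun j ↦ η' j y) (canonicalMaslovCharge C h y) := by
  have hi := h.mdifferentiableAt y
  let f : Fin l → Π p : Y, TangentSpace 𝓘(ℝ, E) (i p) := fun a ↦
    nullSection (F := F) C.toKahlerStructure i y (differential i y (leafFrame h y a))
  have hfy : ∀ a, f a y = differential i y (leafFrame h y a) := fun a ↦
    nullSection_self C.toKahlerStructure ((isLeafFrame_leafFrame h y).1 a)
  have hfy' : (fun a ↦ f a y) = fun a ↦ differential i y (leafFrame h y a) := funext hfy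
  have hf : ∀ a, MDiffAlong (F := F) i (f a) y := fun a ↦ h.mdiffAlong_nullSection _
  -- the Gram determinant of the frame `f`
  let G : Fin l → Fin l → Y → ℂ := fun a b p ↦ ((inner ℝ (f a p) (f b p) : ℝ) : ℂ)
  have hG : ∀ a b, MDifferentiableAt 𝓘(ℝ, F) 𝓘(ℝ, ℂ) (G a b) y ∧ ∀ u : F,
      chartDeriv (F := F) (G a b) y u
        = (chartDeriv (F := F) (fun p ↦ (inner ℝ (f a p) (f b p) : ℝ)) y u : ℂ) := fun a b ↦
    mdifferentiableAt_clm_comp Complex.ofRealCLM ((hf a).inner hi (hf b)).1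
  have hG1 : ∀ a b, G a b y = if a = b then 1 else 0 := fun a b ↦ by
    simp only [G, hfy, orthonormal_iff_ite.1 (isLeafFrame_leafFrame h y).2 a b]
    split_ifs <;> simp
  let D : Y → ℂ := fun p ↦ (Matrix.of fun a b ↦ G a b p).det
  have hD : MDifferentiableAt 𝓘(ℝ, F) 𝓘(ℝ, ℂ) D y ∧ _ :=
    mdifferentiableAt_det (fun a b ↦ (hG a b).1) hG1
  have hD1 : D y = 1 := by
    have : (Matrix.of fun a b ↦ G a b y) = (1 : Matrix (Fin l) (Fin l) ℂ) := by
      ext a b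
      simp [hG1, Matrix.one_apply]
    simp only [D, this, Matrix.det_one]
  have hDv : chartDeriv (F := F) D y (toModel F y v)
      = ∑ a, 2 * ((inner ℝ (pullbackCov i (f a) y v)
        (differential i y (leafFrame h y a)) : ℝ) : ℂ) := by
    rw [hD.2]
    refine Finset.sum_congr rfl fun a _ ↦ ?_
    rw [(hG a a).2, ((hf a).inner hi (hf a)).2, hfy,
      real_inner_comm (pullbackCov i (f a) y v)]
    push_cast
    ring
  -- the charge in terms of the frame `f`
  let A : Y → ℂ := fun p ↦ C.Ω (i p) (Fin.append (fun a ↦ f a p) (fun j ↦ η j p))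
  let B : Y → ℂ := fun p ↦ C.Ω (i p) (Fin.append (fun a ↦ f a p) (fun j ↦ η' j p))
  have hA : MDifferentiableAt 𝓘(ℝ, F) 𝓘(ℝ, ℂ) A y ∧ _ := h.volume_append_nullSection hη
  have hB : MDifferentiableAt 𝓘(ℝ, F) 𝓘(ℝ, ℂ) B y ∧ _ := h.volume_append_nullSection hη'
  have hq : (fun p ↦ evalTensor (fun j ↦ η j p) (fun j ↦ η' j p) (canonicalMaslovCharge C h p))
      =ᶠ[nhds y] fun p ↦ A p * B p * (D p)⁻¹ := by
    have hne : ∀ᶠ p in nhds y, D p ≠ 0 :=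
      hD.1.continuousAt.eventually_ne (by rw [hD1]; exact one_ne_zero)
    filter_upwards [hne] with p hp
    have htype : ∀ η : Fin k → TangentSpace 𝓘(ℝ, E) (i p), ∀ w a,
        contractTail (C.Ω (i p)).toAlternatingMap η (Function.update w a (C.J (i p) (w a)))
          = Complex.I * contractTail (C.Ω (i p)).toAlternatingMap η w := fun η w a ↦ by
      have := C.type_Ω (i p) (Fin.append w η) (Fin.castAdd k a)
      rw [Fin.append_left, ← append_update_left] at this
      exact this
    have hgram := map_mul_map_eq_gram_det (C.J_J (i p))
      (contractTail (C.Ω (i p)).toAlternatingMap fun j ↦ η j p)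
      (contractTail (C.Ω (i p)).toAlternatingMap fun j ↦ η' j p) (htype _) (htype _)
      (isLeafFrame_leafFrame h p).2 (fun a ↦ f a p)
      (fun a ↦ h.symplecticNormal_le_span_leafFrame p (nullSection_mem _ i y _ p))
    have hgram' : A p * B p = D p * evalTensor (fun j ↦ η j p) (fun j ↦ η' j p)
      (canonicalMaslovCharge C h p) := hgram
    rw [hgram', mul_comm (D p), mul_assoc, mul_inv_cancel₀ hp, mul_one]
  have hI := mdifferentiableAt_inv hD.1 (by rw [hD1]; exact one_ne_zero)
  have hAB := mdifferentiableAt_mul hA.1 hB.1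
  have hder := (mdifferentiableAt_mul hAB.1 hI.1).2 (toModel F y v)
  have hAy : A y = C.Ω (i y) (Fin.append (fun a ↦ differential i y (leafFrame h y a))
      (fun j ↦ η j y)) := by simp only [A, hfy]
  have hBy : B y = C.Ω (i y) (Fin.append (fun a ↦ differential i y (leafFrame h y a))
      (fun j ↦ η' j y)) := by simp only [B, hfy]
  have hm := h.sum_inner_pullbackCov_nullSection hv
  have hS : ∑ a, hermitian (C.J (i y)) (pullbackCov i (f a) y v)
      (differential i y (leafFrame h y a))
      = ∑ a, ((inner ℝ (pullbackCov i (f a) y v) (differential i y (leafFrame h y a)) : ℝ) : ℂ)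
        - Complex.I * leafwiseMeanCurvatureForm h y v := by
    have hm' : (leafwiseMeanCurvatureForm h y v : ℂ) = -∑ a, ((inner ℝ (pullbackCov i (f a) y v)
        (C.J (i y) (differential i y (leafFrame h y a))) : ℝ) : ℂ) := by
      rw [← Complex.ofReal_sum, eq_neg_iff_add_eq_zero, ← Complex.ofReal_add]
      simp only [f, hm]
      simp
    rw [hm', mul_neg, sub_neg_eq_add, Finset.mul_sum, ← Finset.sum_add_distrib]
    rfl
  rw [hI.2, hAB.2, hA.2, hB.2, hD1, hDv, ← Finset.mul_sum] at hder
  simp only [maslovCov, evalTensor_canonicalMaslovCharge]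
  simp only [evalTensor_canonicalMaslovCharge] at hq
  rw [mvfderiv_eq_chartDeriv_toModel, chartDeriv_congr hq, hder, hAy, hBy, ← Finset.sum_mul,
    ← Finset.mul_sum]
  simp only [f] at hS ⊢
  rw [hS]
  simp only [inv_one]
  ring

end IsCoisotropicSubmanifold

end MaslovCharge

/-! ### The equivalence -/

section Main

variable {E : Type*} [NormedAddCommGroup E] [NormedSpace ℝ E] [FiniteDimensional ℝ E]
  {X : Type*} [TopologicalSpace X] [ChartedSpace E X] [IsManifold 𝓘(ℝ, E) ∞ X]
  [Bundle.RiemannianBundle (fun x : X ↦ TangentSpace 𝓘(ℝ, E) x)]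
  {F : Type*} [NormedAddCommGroup F] [NormedSpace ℝ F] [FiniteDimensional ℝ F]
  {Y : Type*} [TopologicalSpace Y] [ChartedSpace F Y] [IsManifold 𝓘(ℝ, F) ∞ Y]
  {i : Y → X}

namespace IsCoisotropicSubmanifold

/-- The leafwise mean curvature form only sees the component along the null foliation: the mean
curvature vector is normal, so `J` maps it into `T𝓕`, which is orthogonal to `H`. -/
theorem leafwiseMeanCurvatureForm_eq_zero {K : KahlerStructure E X} {l k : ℕ}
    (h : IsCoisotropicSubmanifold (F := F) K l k i) {y : Y}
    (h0 : ∀ v ∈ nullDistribution K i y, leafwiseMeanCurvatureForm h y v = 0) :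
    leafwiseMeanCurvatureForm h y = 0 := by
  have hJ : K.J (i y) (leafwiseMeanCurvature h y) ∈ symplecticNormal (F := F) K i y :=
    J_mem_symplecticNormal K y (Submodule.sum_mem _ fun a _ ↦
      Submodule.starProjection_apply_mem _ _)
  obtain ⟨v, hv⟩ := h.coisotropic y hJ
  have hv' : v ∈ nullDistribution K i y := by
    change differential i y v ∈ symplecticNormal (F := F) K i y
    exact hv ▸ hJ
  -- `α(v) = |J H|²` for the vector `v` with `di v = J H`
  have h1 : inner ℝ (K.J (i y) (leafwiseMeanCurvature h y))
      (K.J (i y) (leafwiseMeanCurvature h y)) = (0 : ℝ) := by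
    have h2 := h0 v hv'
    have h3 : K.symp (i y) (leafwiseMeanCurvature h y) (differential i y v) = 0 := h2
    rw [symp_eq_inner] at h3
    rw [← h3]
    exact congrArg _ hv.symm
  ext u
  change K.symp (i y) (leafwiseMeanCurvature h y) (differential i y u) = 0
  rw [symp_eq_inner, inner_self_eq_zero.1 h1, inner_zero_left]

variable [IsContMDiffRiemannianBundle 𝓘(ℝ, E) ∞ E (fun x : X ↦ TangentSpace 𝓘(ℝ, E) x)]

/-- There are horizontal sections on which the Maslov charge does not vanish. -/
theorem exists_evalTensor_ne_zero {l k : ℕ} {C : CalabiYauStructure E X (l + k)}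
    (h : IsCoisotropicSubmanifold (F := F) C.toKahlerStructure l k i) (y : Y) :
    ∃ η : Fin k → Π p : Y, TangentSpace 𝓘(ℝ, E) (i p),
      (∀ j, IsHorizontalSectionAt (F := F) C.toKahlerStructure i (η j) y) ∧
      evalTensor (fun j ↦ η j y) (fun j ↦ η j y) (canonicalMaslovCharge C h y) ≠ 0 := by
  obtain ⟨ε, hε⟩ := h.exists_isUnitaryFamily_append y
  have hεN : ∀ j, ∀ u ∈ symplecticNormal (F := F) C.toKahlerStructure i y,
      inner ℝ u (ε j) = (0 : ℝ) ∧ inner ℝ (C.J (i y) u) (ε j) = (0 : ℝ) := fun j u hu ↦ by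
    have hu' := h.symplecticNormal_le_span_leafFrame y hu
    clear hu
    induction hu' using Submodule.span_induction with
    | mem u hu =>
      obtain ⟨a, rfl⟩ := hu
      have hne : Fin.castAdd k a ≠ Fin.natAdd l j := fun h ↦ by
        have := congrArg Fin.val h
        simp at this
        omega
      have h1 := hε.orthonormal.2 hne
      have h2 := hε.isotropic (Fin.castAdd k a) (Fin.natAdd l j)
      simp only [Fin.append_left, Fin.append_right] at h1 h2
      exact ⟨h1, h2⟩
    | zero => simp
    | add u u' _ _ hu hu' => simp [inner_add_left, hu, hu']
    | smul c u _ hu => simp [inner_smul_left, hu]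
  have hεH : ∀ j, ε j ∈ horizontalSpace (F := F) C.toKahlerStructure i y := fun j ↦ by
    refine (h.mem_horizontalSpace_iff y).2 ⟨?_, (Submodule.mem_orthogonal _ _).2 fun u hu ↦
      (hεN j u hu).1⟩
    refine (Submodule.orthogonal_orthogonal (tangentImage (E := E) (F := F) i y)).le ?_
    refine (Submodule.mem_orthogonal _ _).2 fun u hu ↦ ?_
    have h1 := (hεN j _ (J_mem_symplecticNormal C.toKahlerStructure y hu)).2
    rw [C.J_J, inner_neg_left, neg_eq_zero] at h1
    exact h1
  let η : Fin k → Π p : Y, TangentSpace 𝓘(ℝ, E) (i p) := fun j p ↦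
    (horizontalSpace (F := F) C.toKahlerStructure i p).starProjection
      (constField E (i y) (toModel E (i y) (ε j)) (i p))
  have hηy : ∀ j, η j y = ε j := fun j ↦ by
    simp only [η]
    rw [constField_self, ContinuousLinearEquiv.symm_apply_apply,
      Submodule.starProjection_eq_self_iff.2 (hεH j)]
  refine ⟨η, fun j ↦ ⟨fun p ↦ Submodule.starProjection_apply_mem _ _,
    h.mdiffAlong_horizontalSpace (mdiffAlong_constField (h.mdifferentiableAt y) _)⟩, ?_⟩
  simp only [hηy, evalTensor_canonicalMaslovCharge]
  have hnorm := norm_volume_of_isUnitaryFamily C (i y) hε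
  have hne : C.Ω (i y) (Fin.append (fun a ↦ differential i y (leafFrame h y a)) ε) ≠ 0 := by
    rw [← norm_pos_iff, hnorm]
    exact one_pos
  exact mul_ne_zero hne hne

end IsCoisotropicSubmanifold

end Main
end

theorem theorem7p3
    {E : Type*} [NormedAddCommGroup E] [NormedSpace ℝ E] [FiniteDimensional ℝ E]
    {X : Type*} [TopologicalSpace X] [ChartedSpace E X] [IsManifold 𝓘(ℝ, E) ∞ X]
    [Bundle.RiemannianBundle (fun x : X ↦ TangentSpace 𝓘(ℝ, E) x)]
    [IsContMDiffRiemannianBundle 𝓘(ℝ, E) ∞ E (fun x : X ↦ TangentSpace 𝓘(ℝ, E) x)]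
    {F : Type*} [NormedAddCommGroup F] [NormedSpace ℝ F] [FiniteDimensional ℝ F]
    {Y : Type*} [TopologicalSpace Y] [ChartedSpace F Y] [IsManifold 𝓘(ℝ, F) ∞ Y]
    {l k : ℕ} (C : CalabiYauStructure E X (l + k)) {i : Y → X}
    (h : IsCoisotropicSubmanifold (F := F) C.toKahlerStructure l k i) :
    IsLeafwiseSpecial C h ↔ IsLeafwiseMinimal h := by
  constructor
  · intro hs y
    refine h.leafwiseMeanCurvatureForm_eq_zero fun v hv ↦ ?_
    obtain ⟨η, hη, hne⟩ := h.exists_evalTensor_ne_zero y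
    have h1 := hs y v hv η η hη hη
    rw [h.maslovCov_canonicalMaslovCharge hv hη hη] at h1
    simpa [hne] using h1
  · intro hm y v hv η η' hη hη'
    rw [h.maslovCov_canonicalMaslovCharge hv hη hη', hm y]
    simp
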